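/- Fix a countable set of variables and finite alphabets of predicate symbols and of function symbols (each with an arity; constants are function symbols of arity $0$). Consider - terms $u ::= x \mid f(u,\dots,u)$; - conditions built from queries $R(x_1,\dots,x_k)$ and $\neg R(x_1,\dots,x_k)$ on variables, $\mathit{true}$ and $\mathit{false}$ by $\wedge,\vee,\exists x,\forall x$; - definitions built from $\mathit{cond}\Rightarrow R(\vec u)$ by $\wedge$ and $\forall x$; - constrains built from $R(\vec u)\Rightarrow \mathit{cond}$ by $\wedge$ and $\forall x$. An LFP formula is a sequence $cl_1,\dots,cl_s$ of clauses, each of the form $\mathit{define}(\mathit{def})$ or $\mathit{constrain}(\mathit{con})$. The relation $R$ in $\mathit{cond}\Rightarrow R(\vec u)$ is called asserted, and defined; the relation $R$ in $R(\vec u)\Rightarrow\mathit{cond}$ is called asserted, and constrained. The formula is stratified if, for all $i$, relations asserted or positively queried in $cl_i$ are not asserted in $cl_{i+1},\dots,cl_s$, and relations negatively queried in $cl_i$ are not asserted in $cl_i,\dots,cl_s$. Let $\mathrm{rank}(R)$ be the largest $i$ such that $R$ is asserted in $cl_i$, or $0$ if there is none. Let $\mathcal U$ be a finite non-empty universe,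 with interpretations $\zeta$ of the function symbols and $\varsigma$ of the free variables, and let $\varrho_0$ be an interpretation of the relations of rank $0$. For interpretations of all relations write $\varrho_1\sqsubseteq\varrho_2$ if for some $0\le j\le s$: $\varrho_1(R)=\varrho_2(R)$ whenever $\mathrm{rank}(R)<j$; $\varrho_1(R)\subseteq\varrho_2(R)$ whenever $\mathrm{rank}(R)=j$ and $j=0$ or $R$ is defined; $\varrho_1(R)\supseteq\varrho_2(R)$ whenever $\mathrm{rank}(R)=j$ and $R$ is constrained; and $j=s$ or $\varrho_1(R)\ne\varrho_2(R)$ for some $R$ of rank $j$. The best solution is the $\sqsubseteq$-least $\varrho$ that satisfies $cl_1,\dots,cl_s$ and has $\varrho(R)\supseteq\varrho_0(R)$ for all $R$ of rank $0$. Consider machines that work on S-expressions and one hash table indexed by S-expressions, where forming or taking apart a pair, testing equality, and reading or writing a table entry take unit time. There are a single program for such a machine and a constant $C$ such that, for every stratified formula $cl_1,\dots,cl_s$ and all $\mathcal U,\zeta,\varsigma,\varrho_0$ as above, the best solution exists and the program computes it in at most $$C\cdot\Bigl(|\varrho_0|+\sum_{i=1}^{s}|cl_i|\,|\mathcal U|^{k_i}+1\Bigr)$$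 steps. Here $|\varrho_0|$ is the sum of the cardinalities of the relations $\varrho_0(R)$ of rank $0$, $|cl_i|$ is the number of symbols of $cl_i$, and $k_i$ is the maximal nesting depth of quantifiers in $cl_i$. The input consists of the syntax trees of the clauses, a list of the elements of $\mathcal U$, and a list of the facts in $\varrho_0$, with $\zeta$ and $\varsigma$ stored in the hash table. The output consists of a repetition-free list of ground atoms and a hash table that decides membership in this list. The list contains $R(\vec a)$ if and only if $\vec a\in\varrho(R)$ for $R$ not constrained, and if and only if $\vec a\notin\varrho(R)$ for $R$ constrained. -/

import Mathlib

namespace LFP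

/-! ## Formulae of layered fixed point logic

Variables are natural numbers; the finitely many predicate and function symbols are numbered. -/

/-- Finite alphabets of predicate symbols and of function symbols, with their arities. -/
structure Signature where
  numPred : ℕ
  predArity : Fin numPred → ℕ
  numFn : ℕ
  fnArity : Fin numFn → ℕ

/-- Terms `u ::= x | f(u, …, u)`; constants are function symbols of arity `0`. -/
inductive Term (S : Signature) : Type
  | var (x : ℕ) : Term S
  | app (f : Fin S.numFn) (args : Fin (S.fnArity f) → Term S) : Term S

/-- Conditions. -/
inductive Cond (S : Signature) : Type
  | pos (R : Fin S.numPred) (xs : Fin (S.predArity R) → ℕ) : Cond S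
  | neg (R : Fin S.numPred) (xs : Fin (S.predArity R) → ℕ) : Cond S
  | and (c d : Cond S) : Cond S
  | or (c d : Cond S) : Cond S
  | ex (x : ℕ) (c : Cond S) : Cond S
  | all (x : ℕ) (c : Cond S) : Cond S
  | tru : Cond S
  | fls : Cond S

/-- Definitions; `imp c R us` is `c ⇒ R(us)`. -/
inductive Defn (S : Signature) : Type
  | imp (c : Cond S) (R : Fin S.numPred) (us : Fin (S.predArity R) → Term S) : Defn S
  | all (x : ℕ) (d : Defn S) : Defn S
  | and (d d₂ : Defn S) : Defn S

/-- Constrains; `imp R us c` is `R(us) ⇒ c`. -/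
inductive Constr (S : Signature) : Type
  | imp (R : Fin S.numPred) (us : Fin (S.predArity R) → Term S) (c : Cond S) : Constr S
  | all (x : ℕ) (d : Constr S) : Constr S
  | and (d d₂ : Constr S) : Constr S

/-- Clauses (layers). A formula of order `s` is a family `Fin s → Clause S`; its layers are
numbered `1, …, s` in the definition of the rank below. -/
inductive Clause (S : Signature) : Type
  | define (d : Defn S) : Clause S
  | constrain (d : Constr S) : Clause S

variable {S : Signature}

/-! ### Size: number of symbols -/

def Term.size : Term S → ℕ
  | .var _ => 1
  | .app _ args => 1 + ∑ i, (args i).size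

def Cond.size : Cond S → ℕ
  | .pos R _ => 1 + S.predArity R
  | .neg R _ => 1 + S.predArity R
  | .and c d => 1 + c.size + d.size
  | .or c d => 1 + c.size + d.size
  | .ex _ c => 1 + c.size
  | .all _ c => 1 + c.size
  | .tru => 1
  | .fls => 1

def Defn.size : Defn S → ℕ
  | .imp c _ us => 1 + c.size + (1 + ∑ i, (us i).size)
  | .all _ d => 1 + d.size
  | .and d d₂ => 1 + d.size + d₂.size

def Constr.size : Constr S → ℕ
  | .imp _ us c => 1 + (1 + ∑ i, (us i).size) + c.size
  | .all _ d => 1 + d.size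
  | .and d d₂ => 1 + d.size + d₂.size

def Clause.size : Clause S → ℕ
  | .define d => 1 + d.size
  | .constrain d => 1 + d.size

/-! ### Maximal nesting depth of quantifiers -/

def Cond.depth : Cond S → ℕ
  | .pos _ _ => 0
  | .neg _ _ => 0
  | .and c d => max c.depth d.depth
  | .or c d => max c.depth d.depth
  | .ex _ c => 1 + c.depth
  | .all _ c => 1 + c.depth
  | .tru => 0
  | .fls => 0

def Defn.depth : Defn S → ℕ
  | .imp c _ _ => c.depth
  | .all _ d => 1 + d.depth
  | .and d d₂ => max d.depth d₂.depth

def Constr.depth : Constr S → ℕ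
  | .imp _ _ c => c.depth
  | .all _ d => 1 + d.depth
  | .and d d₂ => max d.depth d₂.depth

def Clause.depth : Clause S → ℕ
  | .define d => d.depth
  | .constrain d => d.depth

/-! ### Free variables -/

def Term.free : Term S → Set ℕ
  | .var x => {x}
  | .app _ args => ⋃ i, (args i).free

def Cond.free : Cond S → Set ℕ
  | .pos _ xs => Set.range xs
  | .neg _ xs => Set.range xs
  | .and c d => c.free ∪ d.free
  | .or c d => c.free ∪ d.free
  | .ex x c => c.free \ {x}
  | .all x c => c.free \ {x}
  | .tru => ∅
  | .fls => ∅

def Defn.free : Defn S → Set ℕ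
  | .imp c _ us => c.free ∪ ⋃ i, (us i).free
  | .all x d => d.free \ {x}
  | .and d d₂ => d.free ∪ d₂.free

def Constr.free : Constr S → Set ℕ
  | .imp _ us c => (⋃ i, (us i).free) ∪ c.free
  | .all x d => d.free \ {x}
  | .and d d₂ => d.free ∪ d₂.free

def Clause.free : Clause S → Set ℕ
  | .define d => d.free
  | .constrain d => d.free

/-! ### Positive and negative queries, assertions, stratification -/

def Cond.posUsed : Cond S → Set (Fin S.numPred)
  | .pos R _ => {R}
  | .neg _ _ => ∅
  | .and c d => c.posUsed ∪ d.posUsed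
  | .or c d => c.posUsed ∪ d.posUsed
  | .ex _ c => c.posUsed
  | .all _ c => c.posUsed
  | .tru => ∅
  | .fls => ∅

def Cond.negUsed : Cond S → Set (Fin S.numPred)
  | .pos _ _ => ∅
  | .neg R _ => {R}
  | .and c d => c.negUsed ∪ d.negUsed
  | .or c d => c.negUsed ∪ d.negUsed
  | .ex _ c => c.negUsed
  | .all _ c => c.negUsed
  | .tru => ∅
  | .fls => ∅

def Defn.posUsed : Defn S → Set (Fin S.numPred)
  | .imp c _ _ => c.posUsed
  | .all _ d => d.posUsed
  | .and d d₂ => d.posUsed ∪ d₂.posUsed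

def Defn.negUsed : Defn S → Set (Fin S.numPred)
  | .imp c _ _ => c.negUsed
  | .all _ d => d.negUsed
  | .and d d₂ => d.negUsed ∪ d₂.negUsed

def Defn.asserted : Defn S → Set (Fin S.numPred)
  | .imp _ R _ => {R}
  | .all _ d => d.asserted
  | .and d d₂ => d.asserted ∪ d₂.asserted

def Constr.posUsed : Constr S → Set (Fin S.numPred)
  | .imp _ _ c => c.posUsed
  | .all _ d => d.posUsed
  | .and d d₂ => d.posUsed ∪ d₂.posUsed

def Constr.negUsed : Constr S → Set (Fin S.numPred)
  | .imp _ _ c => c.negUsed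
  | .all _ d => d.negUsed
  | .and d d₂ => d.negUsed ∪ d₂.negUsed

def Constr.asserted : Constr S → Set (Fin S.numPred)
  | .imp R _ _ => {R}
  | .all _ d => d.asserted
  | .and d d₂ => d.asserted ∪ d₂.asserted

def Clause.posUsed : Clause S → Set (Fin S.numPred)
  | .define d => d.posUsed
  | .constrain d => d.posUsed

def Clause.negUsed : Clause S → Set (Fin S.numPred)
  | .define d => d.negUsed
  | .constrain d => d.negUsed

def Clause.asserted : Clause S → Set (Fin S.numPred)
  | .define d => d.asserted
  | .constrain d => d.asserted

def Stratified {s : ℕ} (cls : Fin s → Clause S) : Prop :=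
  ∀ i : Fin s,
    (∀ R ∈ (cls i).asserted, ∀ j, i < j → R ∉ (cls j).asserted) ∧
    (∀ R ∈ (cls i).posUsed, ∀ j, i < j → R ∉ (cls j).asserted) ∧
    (∀ R ∈ (cls i).negUsed, ∀ j, i ≤ j → R ∉ (cls j).asserted)

open Classical in
/-- The largest number (counted from `1`) of a layer that asserts `R`, and `0` if none does. -/
noncomputable def rank {s : ℕ} (cls : Fin s → Clause S) (R : Fin S.numPred) : ℕ :=
  Finset.univ.sup fun i : Fin s => if R ∈ (cls i).asserted then (i : ℕ) + 1 else 0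

def IsDefined {s : ℕ} (cls : Fin s → Clause S) (R : Fin S.numPred) : Prop :=
  ∃ i d, cls i = .define d ∧ R ∈ d.asserted

def IsConstrained {s : ℕ} (cls : Fin s → Clause S) (R : Fin S.numPred) : Prop :=
  ∃ i d, cls i = .constrain d ∧ R ∈ d.asserted

/-! ### Semantics -/

/-- Interpretations of the predicate symbols. -/
abbrev Interp (S : Signature) (U : Type*) := (R : Fin S.numPred) → Set (Fin (S.predArity R) → U)

/-- Interpretations of the function symbols. -/
abbrev FnInterp (S : Signature) (U : Type*) := (f : Fin S.numFn) → (Fin (S.fnArity f) → U) → U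

section Semantics

variable {U : Type*}

def Term.eval (ζ : FnInterp S U) (ς : ℕ → U) : Term S → U
  | .var x => ς x
  | .app f args => ζ f fun i => (args i).eval ζ ς

def Cond.Sat (ϱ : Interp S U) : (ℕ → U) → Cond S → Prop
  | ς, .pos R xs => (fun i => ς (xs i)) ∈ ϱ R
  | ς, .neg R xs => (fun i => ς (xs i)) ∉ ϱ R
  | ς, .and c d => c.Sat ϱ ς ∧ d.Sat ϱ ς
  | ς, .or c d => c.Sat ϱ ς ∨ d.Sat ϱ ς
  | ς, .ex x c => ∃ a : U, c.Sat ϱ (Function.update ς x a)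
  | ς, .all x c => ∀ a : U, c.Sat ϱ (Function.update ς x a)
  | _, .tru => True
  | _, .fls => False

def Defn.Sat (ϱ : Interp S U) (ζ : FnInterp S U) : (ℕ → U) → Defn S → Prop
  | ς, .imp c R us => c.Sat ϱ ς → (fun i => (us i).eval ζ ς) ∈ ϱ R
  | ς, .all x d => ∀ a : U, d.Sat ϱ ζ (Function.update ς x a)
  | ς, .and d d₂ => d.Sat ϱ ζ ς ∧ d₂.Sat ϱ ζ ς

def Constr.Sat (ϱ : Interp S U) (ζ : FnInterp S U) : (ℕ → U) → Constr S → Prop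
  | ς, .imp R us c => (fun i => (us i).eval ζ ς) ∈ ϱ R → c.Sat ϱ ς
  | ς, .all x d => ∀ a : U, d.Sat ϱ ζ (Function.update ς x a)
  | ς, .and d d₂ => d.Sat ϱ ζ ς ∧ d₂.Sat ϱ ζ ς

def Clause.Sat (ϱ : Interp S U) (ζ : FnInterp S U) (ς : ℕ → U) : Clause S → Prop
  | .define d => d.Sat ϱ ζ ς
  | .constrain d => d.Sat ϱ ζ ς

/-- The lexicographic order on interpretations determined by the layers of `cls`. -/
def LexLE {s : ℕ} (cls : Fin s → Clause S) (ϱ₁ ϱ₂ : Interp S U) : Prop :=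
  ∃ j ≤ s,
    (∀ R, rank cls R < j → ϱ₁ R = ϱ₂ R) ∧
    (∀ R, rank cls R = j → (j = 0 ∨ IsDefined cls R) → ϱ₁ R ⊆ ϱ₂ R) ∧
    (∀ R, rank cls R = j → IsConstrained cls R → ϱ₂ R ⊆ ϱ₁ R) ∧
    (j = s ∨ ∃ R, rank cls R = j ∧ ϱ₁ R ≠ ϱ₂ R)

/-- The models of `cls` that contain the given facts `ϱ₀` about the relations of rank `0`
(the values of `ϱ₀` at the other relations are irrelevant). -/
def models {s : ℕ} (cls : Fin s → Clause S) (ζ : FnInterp S U) (ς : ℕ → U) (ϱ₀ : Interp S U) :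
    Set (Interp S U) :=
  {ϱ | (∀ i, (cls i).Sat ϱ ζ ς) ∧ ∀ R, rank cls R = 0 → ϱ₀ R ⊆ ϱ R}

/-- The best solution: the least element of `models` in the lexicographic order. -/
def IsBestSolution {s : ℕ} (cls : Fin s → Clause S) (ζ : FnInterp S U) (ς : ℕ → U)
    (ϱ₀ ϱ : Interp S U) : Prop :=
  ϱ ∈ models cls ζ ς ϱ₀ ∧ ∀ ϱ' ∈ models cls ζ ς ϱ₀, LexLE cls ϱ ϱ'

open Classical in
/-- `|ϱ₀|`: the sum of the cardinalities of the given relations of rank `0`. -/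
noncomputable def factCount {s : ℕ} (cls : Fin s → Clause S) (ϱ₀ : Interp S U) : ℕ :=
  ∑ R, if rank cls R = 0 then (ϱ₀ R).ncard else 0

end Semantics

/-! ## Machines with unit-time hash tables

Values are S-expressions over numbered atoms. A machine has finitely many registers (those named
in its program) and one hash table indexed by values. Forming a pair, taking it apart, comparing
two values, and reading or writing one entry of the table takes unit time. As pairs can be kept
unique by a hash table from pairs of addresses to addresses (so that equal values have equal
addresses), this is, up to a constant factor, a random access machine with unit-time operations on
hash tables whose keys are pairs of machine words. There is no arithmetic. -/

inductive Val : Type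
  | atom (n : ℕ) : Val
  | pair (a b : Val) : Val
  deriving DecidableEq

/-- The atom `0` also serves as the empty list and as the default value. -/
abbrev Val.nil : Val := .atom 0

/-- First component (`nil` for atoms). -/
def Val.fst : Val → Val
  | .atom _ => .nil
  | .pair a _ => a

/-- Second component (`nil` for atoms). -/
def Val.snd : Val → Val
  | .atom _ => .nil
  | .pair _ b => b

/-- Lists as values. -/
def Val.list : List Val → Val
  | [] => .nil
  | v :: l => .pair v (Val.list l)

def Val.tuple {k : ℕ} (v : Fin k → Val) : Val := Val.list (List.ofFn v)

structure State where
  reg : ℕ → Val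
  tab : Val → Val

inductive Expr : Type
  | reg (r : ℕ) : Expr
  | atom (n : ℕ) : Expr
  | pair (a b : Expr) : Expr
  | fst (a : Expr) : Expr
  | snd (a : Expr) : Expr
  | get (a : Expr) : Expr

/-- The value of an expression; `get` looks up the hash table. -/
def Expr.eval (σ : State) : Expr → Val
  | .reg r => σ.reg r
  | .atom n => .atom n
  | .pair a b => .pair (a.eval σ) (b.eval σ)
  | .fst a => (a.eval σ).fst
  | .snd a => (a.eval σ).snd
  | .get a => σ.tab (a.eval σ)

/-- The number of steps for the evaluation of an expression: one for each operation. -/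
def Expr.cost : Expr → ℕ
  | .reg _ => 1
  | .atom _ => 1
  | .pair a b => 1 + a.cost + b.cost
  | .fst a => 1 + a.cost
  | .snd a => 1 + a.cost
  | .get a => 1 + a.cost

/-- Programs. `put k v` stores `v` under the key `k` in the hash table. -/
inductive Prog : Type
  | skip : Prog
  | assign (r : ℕ) (a : Expr) : Prog
  | put (k v : Expr) : Prog
  | seq (p q : Prog) : Prog
  | ifEq (a b : Expr) (p q : Prog) : Prog
  | whileNe (a b : Expr) (p : Prog) : Prog

/-- `Exec p σ t τ`: started in the state `σ`, the program `p` halts after `t` steps in the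
state `τ`. -/
inductive Exec : Prog → State → ℕ → State → Prop
  | skip (σ : State) : Exec .skip σ 1 σ
  | assign (σ : State) (r : ℕ) (a : Expr) :
      Exec (.assign r a) σ (1 + a.cost) ⟨Function.update σ.reg r (a.eval σ), σ.tab⟩
  | put (σ : State) (k v : Expr) :
      Exec (.put k v) σ (1 + k.cost + v.cost)
        ⟨σ.reg, Function.update σ.tab (k.eval σ) (v.eval σ)⟩
  | seq {p q : Prog} {σ τ υ : State} {t u : ℕ} (hp : Exec p σ t τ) (hq : Exec q τ u υ) :
      Exec (.seq p q) σ (t + u) υ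
  | ifEq_true {a b : Expr} {p q : Prog} {σ τ : State} {t : ℕ} (h : a.eval σ = b.eval σ)
      (hp : Exec p σ t τ) : Exec (.ifEq a b p q) σ (1 + a.cost + b.cost + t) τ
  | ifEq_false {a b : Expr} {p q : Prog} {σ τ : State} {t : ℕ} (h : a.eval σ ≠ b.eval σ)
      (hq : Exec q σ t τ) : Exec (.ifEq a b p q) σ (1 + a.cost + b.cost + t) τ
  | while_done {a b : Expr} {p : Prog} {σ : State} (h : a.eval σ = b.eval σ) :
      Exec (.whileNe a b p) σ (1 + a.cost + b.cost) σ
  | while_step {a b : Expr} {p : Prog} {σ τ υ : State} {t u : ℕ} (h : a.eval σ ≠ b.eval σ)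
      (hp : Exec p σ t τ) (hw : Exec (.whileNe a b p) τ u υ) :
      Exec (.whileNe a b p) σ (1 + a.cost + b.cost + t + u) υ

/-! ## Input and output of the solver -/

def Term.code : Term S → Val
  | .var x => .pair (.atom 0) (.atom x)
  | .app f args => .pair (.atom 1) (.pair (.atom f) (Val.tuple fun i => (args i).code))

def Cond.code : Cond S → Val
  | .pos R xs => .pair (.atom 0) (.pair (.atom R) (Val.tuple fun i => .atom (xs i)))
  | .neg R xs => .pair (.atom 1) (.pair (.atom R) (Val.tuple fun i => .atom (xs i)))
  | .and c d => .pair (.atom 2) (.pair c.code d.code)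
  | .or c d => .pair (.atom 3) (.pair c.code d.code)
  | .ex x c => .pair (.atom 4) (.pair (.atom x) c.code)
  | .all x c => .pair (.atom 5) (.pair (.atom x) c.code)
  | .tru => .pair (.atom 6) .nil
  | .fls => .pair (.atom 7) .nil

def Defn.code : Defn S → Val
  | .imp c R us =>
      .pair (.atom 0) (.pair c.code (.pair (.atom R) (Val.tuple fun i => (us i).code)))
  | .all x d => .pair (.atom 1) (.pair (.atom x) d.code)
  | .and d d₂ => .pair (.atom 2) (.pair d.code d₂.code)

def Constr.code : Constr S → Val
  | .imp R us c =>
      .pair (.atom 0) (.pair c.code (.pair (.atom R) (Val.tuple fun i => (us i).code)))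
  | .all x d => .pair (.atom 1) (.pair (.atom x) d.code)
  | .and d d₂ => .pair (.atom 2) (.pair d.code d₂.code)

def Clause.code : Clause S → Val
  | .define d => .pair (.atom 0) d.code
  | .constrain d => .pair (.atom 1) d.code

/-- Ground atoms `R(a₁, …, aₖ)`. -/
abbrev GroundAtom (S : Signature) (U : Type*) :=
  (R : Fin S.numPred) × (Fin (S.predArity R) → U)

section Representation

variable {U : Type*} {n : ℕ}

/-- The value that represents an element of the universe, for a numbering `e` of the universe. -/
def elemCode (e : U ≃ Fin n) (a : U) : Val := .atom (e a)

def GroundAtom.code (e : U ≃ Fin n) (A : GroundAtom S U) : Val :=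
  .pair (.atom A.1) (Val.tuple fun i => elemCode e (A.2 i))

/-- The key under which the value of `f(a₁, …, aₖ)` is stored. -/
def fnKey (e : U ≃ Fin n) (p : (f : Fin S.numFn) × (Fin (S.fnArity f) → U)) : Val :=
  .pair (.atom 0) (.pair (.atom p.1) (Val.tuple fun i => elemCode e (p.2 i)))

/-- The key under which the value of a free variable is stored. -/
def varKey (x : ℕ) : Val := .pair (.atom 1) (.atom x)

/-- The key of a ground atom in the result. -/
def atomKey (e : U ≃ Fin n) (A : GroundAtom S U) : Val := .pair (.atom 2) (A.code e)

/-- The initial state: the formula, the universe and the list `L` of given facts are in the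
registers `0`, `1` and `2`; the interpretations of the function symbols and of the free variables
of the formula are in the hash table; everything else is empty. -/
noncomputable def initialState (e : U ≃ Fin n) {s : ℕ} (cls : Fin s → Clause S)
    (ζ : FnInterp S U) (ς : ℕ → U) (L : List (GroundAtom S U)) : State where
  reg
    | 0 => Val.tuple fun i => (cls i).code
    | 1 => Val.tuple fun i : Fin n => elemCode e (e.symm i)
    | 2 => Val.list (L.map (GroundAtom.code e))
    | _ => .nil
  tab :=
    Function.extend (fnKey (S := S) e) (fun p => elemCode e (ζ p.1 p.2)) <|
      Function.extend (fun x : {x : ℕ // ∃ i, x ∈ (cls i).free} => varKey x)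
        (fun x => elemCode e (ς x)) fun _ => .nil

/-- The ground atoms by which an interpretation is recorded: those that hold, for a relation that
is not constrained; those that fail, for a constrained relation (which is a greatest solution and
may hold of almost all tuples). -/
def Recorded {s : ℕ} (cls : Fin s → Clause S) (ϱ : Interp S U) (A : GroundAtom S U) : Prop :=
  (¬ IsConstrained cls A.1 ∧ A.2 ∈ ϱ A.1) ∨ (IsConstrained cls A.1 ∧ A.2 ∉ ϱ A.1)

/-- The final state `σ` delivers `ϱ`: register `0` lists the recorded ground atoms without
repetition, and the hash table decides whether a ground atom is recorded. -/
def Delivers (e : U ≃ Fin n) {s : ℕ} (cls : Fin s → Clause S) (ϱ : Interp S U)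
    (σ : State) : Prop :=
  (∃ L : List (GroundAtom S U), L.Nodup ∧ (∀ A, A ∈ L ↔ Recorded cls ϱ A) ∧
    σ.reg 0 = Val.list (L.map (GroundAtom.code e))) ∧
  ∀ A : GroundAtom S U,
    (Recorded cls ϱ A → σ.tab (atomKey e A) = .atom 1) ∧
    (¬ Recorded cls ϱ A → σ.tab (atomKey e A) = .atom 0)

end Representation

end LFP

namespace LFP

/-! ## Loop-free programs -/

/-! Every layer is a propositional least fixed point problem. A constrain `R(u) ⇒ cond` is the
definition `¬cond ⇒ Rᶜ(u)` of the complement of `R`, and a greatest `R` is a least `Rᶜ`. So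
constrained relations are represented by their complements, with a flag per predicate that says
which representation is in use, and a layer asks for the least set of recorded ground atoms that is
closed under finitely many ground rules `g → A` (`ground`, `instances`, `LeastExt`). A literal of
`g` may demand that an atom is not recorded; by stratification this happens only for relations that
are already complete (`stable_instances`), so the least closed extension exists.

The sets `T 0 ⊆ T 1 ⊆ …` obtained in this way describe the best solution. Given another model,
consider the least rank at which it differs. Below this rank it has the same recorded atoms, and it
is closed under the rules of the layer in question; hence it contains the recorded atoms of that
layer by leastness (`Layers.lexLE`).

For the running time, grounding a clause visits each symbol once per assignment to the quantifiers
above it, which takes `O(|cl| |U|^k)` rounds and produces rules of that total size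
(`runs_instances`, `weight_instances`). The rules contain nested conjunctions and disjunctions. They
are solved by tasks `(g :: k, B)`: record `B` once `g` and then all of `k` are established. A
conjunction extends the continuation, a disjunction forks with the same continuation, and a literal
whose atom is not yet recorded suspends the task until that atom is. A mark in the hash table
ensures that each task is expanded only once. Since the continuation depends only on the position of
`g` in its rule, there are no more tasks than symbols, in spite of the forks (`length_unfold`,
`length_allTasks`), and a potential bounds the steps linearly (`Sol.Step.potential_lt`).
`Sol.Step.sound` and `Sol.Complete.pop` show that the result is the least extension.

The machine is one loop whose loop-free body interprets the top of a control stack. A round has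
bounded cost, so only rounds are counted (`Runs.exec`); a step of the propositional solver is one
round (`Sol.Step.simulate`). Nothing is erased between layers: the marks and waiting lists are
indexed by the list of the remaining clauses, which differs from layer to layer. -/

/-- The final state of a loop-free program (loops are skipped). -/
def Prog.run : Prog → State → State
  | .skip, σ => σ
  | .assign r a, σ => ⟨Function.update σ.reg r (a.eval σ), σ.tab⟩
  | .put k v, σ => ⟨σ.reg, Function.update σ.tab (k.eval σ) (v.eval σ)⟩
  | .seq p q, σ => q.run (p.run σ)
  | .ifEq a b p q, σ => if a.eval σ = b.eval σ then p.run σ else q.run σ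
  | .whileNe _ _ _, σ => σ

def Prog.loopFree : Prog → Bool
  | .seq p q => p.loopFree && q.loopFree
  | .ifEq _ _ p q => p.loopFree && q.loopFree
  | .whileNe _ _ _ => false
  | _ => true

/-- A bound on the running time of a loop-free program. -/
def Prog.maxCost : Prog → ℕ
  | .skip => 1
  | .assign _ a => 1 + a.cost
  | .put k v => 1 + k.cost + v.cost
  | .seq p q => p.maxCost + q.maxCost
  | .ifEq a b p q => 1 + a.cost + b.cost + (p.maxCost + q.maxCost)
  | .whileNe _ _ _ => 0

/-- Without loops the execution is a function of the state, and its cost is bounded independently of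
the state. This is why a round of the main loop counts as unit time. -/
theorem Prog.exec_run (p : Prog) (hp : p.loopFree = true) (σ : State) :
    ∃ t ≤ p.maxCost, Exec p σ t (p.run σ) := by
  induction p generalizing σ with
  | skip => exact ⟨1, le_rfl, .skip σ⟩
  | assign r a => exact ⟨_, le_rfl, .assign σ r a⟩
  | put k v => exact ⟨_, le_rfl, .put σ k v⟩
  | seq p q ihp ihq =>
    simp only [loopFree, Bool.and_eq_true] at hp
    obtain ⟨t, ht, h⟩ := ihp hp.1 σ
    obtain ⟨u, hu, h'⟩ := ihq hp.2 (p.run σ)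
    exact ⟨t + u, Nat.add_le_add ht hu, .seq h h'⟩
  | ifEq a b p q ihp ihq =>
    simp only [loopFree, Bool.and_eq_true] at hp
    obtain ⟨t, ht, h⟩ := ihp hp.1 σ
    obtain ⟨u, hu, h'⟩ := ihq hp.2 σ
    by_cases hab : a.eval σ = b.eval σ
    · refine ⟨_, ?_, by simpa only [run, if_pos hab] using Exec.ifEq_true hab h⟩
      simp only [maxCost]; omega
    · refine ⟨_, ?_, by simpa only [run, if_neg hab] using Exec.ifEq_false hab h'⟩
      simp only [maxCost]; omega
  | whileNe => simp [loopFree] at hp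

/-- Branch on the atom delivered by `a`. -/
def Prog.switch (a : Expr) : ℕ → List Prog → Prog
  | _, [] => .skip
  | n, p :: ps => .ifEq a (.atom n) p (switch a (n + 1) ps)

theorem Prog.run_switch (a : Expr) (σ : State) (i : ℕ) (p : Prog) :
    ∀ (n : ℕ) (ps : List Prog), a.eval σ = .atom (n + i) → ps[i]? = some p →
      (switch a n ps).run σ = p.run σ := by
  induction i with
  | zero =>
    rintro n (_ | ⟨q, ps⟩) h h'
    · simp at h'
    · simp only [List.getElem?_cons_zero,
        Option.some.injEq] at h'
      simp [switch, run, Expr.eval, h, h']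
  | succ i ih =>
    rintro n (_ | ⟨q, ps⟩) h h'
    · simp at h'
    · rw [List.getElem?_cons_succ] at h'
      rw [switch, run, if_neg, ih (n + 1) ps _ h']
      · rw [h]; congr 1; omega
      · rw [h, Expr.eval]; simp

/-! ## The solver

The solver is a stack machine. Its registers are: `1` the universe, `2` the list of recorded ground
atoms, `3` the control stack, `4` the value stack, `5` the kind of the current clause and `8` its
opposite, `6` the initial tasks collected so far, `7` the remaining clauses. Ground conditions are
tagged values: `0` literals, `1` conjunctions and disjunctions, `2` true and false, `3` assertions
of ground atoms. -/

namespace Solver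

open Prog

abbrev tagged (n : ℕ) (v : Val) : Val := .pair (.atom n) v

abbrev eTagged (n : ℕ) (a : Expr) : Expr := .pair (.atom n) a

/-- The argument of the topmost control item. -/
abbrev eArg : Expr := .snd (.fst (.reg 3))

abbrev eRest : Expr := .snd (.reg 3)

abbrev setCtrl (a : Expr) : Prog := .assign 3 a

/-- Ground the condition on top of the control stack. -/
def groundProg : Prog :=
  let b : Expr := .snd eArg
  let query (q : Expr) : Prog :=
    setCtrl (.pair (eTagged 1 (.snd b)) (.pair (eTagged 3 (.pair q (.fst b))) eRest))
  let conn (o : Expr) : Prog :=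
    setCtrl (.pair (eTagged 0 (.fst b)) (.pair (eTagged 0 (.snd b)) (.pair (eTagged 4 o) eRest)))
  let quant (o : Expr) : Prog :=
    .seq (.assign 4 (.pair (eTagged 2 o) (.reg 4)))
      (setCtrl (.pair
        (eTagged 5 (.pair (.fst b) (.pair (eTagged 0 (.snd b)) (.pair (eTagged 4 o) (.reg 1)))))
        (.pair (eTagged 6 (.pair (.fst b) (.get (eTagged 1 (.fst b))))) eRest)))
  let const (o : Expr) : Prog :=
    .seq (.assign 4 (.pair (eTagged 2 o) (.reg 4))) (setCtrl eRest)
  switch (.fst eArg) 0 [query (.reg 5), query (.reg 8), conn (.reg 5), conn (.reg 8),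
    quant (.reg 8), quant (.reg 5), const (.reg 5), const (.reg 8)]

/-- Work on the task on top of the control stack. -/
def taskProg : Prog :=
  let k : Expr := .snd eArg
  let b : Expr := .snd (.fst eArg)
  let isRecorded : Expr := .get (eTagged 2 (.snd b))
  let goOn : Prog := setCtrl (.pair (eTagged 17 k) eRest)
  let watchKey (a : Expr) : Expr := eTagged 5 (.pair (.reg 7) a)
  let lit : Prog :=
    .ifEq (.get (eTagged 3 (.fst (.snd b)))) (.fst b)
      (.ifEq isRecorded (.atom 1) goOn
        (.seq (.put (watchKey (.snd b)) (.pair k (.get (watchKey (.snd b))))) (setCtrl eRest)))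
      (.ifEq isRecorded (.atom 1) (setCtrl eRest) goOn)
  let bin : Prog :=
    .ifEq (.fst b) (.atom 0)
      (setCtrl (.pair (eTagged 17 (.pair (.fst (.snd b)) (.pair (.snd (.snd b)) k))) eRest))
      (setCtrl (.pair (eTagged 17 (.pair (.fst (.snd b)) k))
        (.pair (eTagged 17 (.pair (.snd (.snd b)) k)) eRest)))
  let unit : Prog := .ifEq b (.atom 0) goOn (setCtrl eRest)
  let assert : Prog :=
    .ifEq (.get (eTagged 2 b)) (.atom 1) (setCtrl eRest)
      (.seq (.put (eTagged 2 b) (.atom 1))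
        (.seq (.assign 2 (.pair b (.reg 2)))
          (setCtrl (.pair (eTagged 16 (.get (watchKey b))) eRest))))
  .ifEq (.get (eTagged 4 (.pair (.reg 7) eArg))) (.atom 1) (setCtrl eRest)
    (.seq (.put (eTagged 4 (.pair (.reg 7) eArg)) (.atom 1))
      (switch (.fst (.fst eArg)) 0 [lit, bin, unit, assert]))

/-- Tuples of variables. -/
def tupleProg : Prog :=
  .ifEq eArg (.atom 0)
    (.seq (.assign 4 (.pair (.atom 0) (.reg 4))) (setCtrl eRest))
    (setCtrl (.pair (eTagged 1 (.snd eArg)) (.pair (eTagged 2 (.fst eArg)) eRest)))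

/-- Tuples are built from the back: `tupleProg` schedules the tail before the head, so that the head
is put in front of a finished tail. -/
def varProg : Prog :=
  .seq (.assign 4 (.pair (.pair (.get (eTagged 1 eArg)) (.fst (.reg 4))) (.snd (.reg 4))))
    (setCtrl eRest)

def litProg : Prog :=
  .seq (.assign 4 (.pair
      (eTagged 0 (.pair (.fst eArg) (.pair (.snd eArg) (.fst (.reg 4))))) (.snd (.reg 4))))
    (setCtrl eRest)

/-- The operand evaluated last is on top and becomes the first argument. The swap is harmless, and
`ground` is defined with the same order. -/
def binProg : Prog :=
  .seq (.assign 4 (.pair (eTagged 1 (.pair eArg (.pair (.fst (.reg 4)) (.fst (.snd (.reg 4))))))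
      (.snd (.snd (.reg 4)))))
    (setCtrl eRest)

/-- Run a pair of control items for all elements of the universe. -/
def loopProg : Prog :=
  let item : Expr := .fst (.snd eArg)
  let op : Expr := .fst (.snd (.snd eArg))
  let us : Expr := .snd (.snd (.snd eArg))
  .ifEq us (.atom 0) (setCtrl eRest)
    (.seq (.put (eTagged 1 (.fst eArg)) (.fst us))
      (setCtrl (.pair item (.pair op (.pair
        (eTagged 5 (.pair (.fst eArg) (.pair item (.pair op (.snd us))))) eRest)))))

def restoreProg : Prog := .seq (.put (eTagged 1 (.fst eArg)) (.snd eArg)) (setCtrl eRest)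

/-- Evaluate a term. -/
def termProg : Prog :=
  let b : Expr := .snd eArg
  switch (.fst eArg) 0
    [.seq (.assign 4 (.pair (.get (eTagged 1 b)) (.reg 4))) (setCtrl eRest),
      setCtrl (.pair (eTagged 8 (.snd b)) (.pair (eTagged 10 (.fst b)) eRest))]

def argsProg : Prog :=
  .ifEq eArg (.atom 0)
    (.seq (.assign 4 (.pair (.atom 0) (.reg 4))) (setCtrl eRest))
    (setCtrl (.pair (eTagged 7 (.fst eArg)) (.pair (eTagged 8 (.snd eArg))
      (.pair (eTagged 9 (.atom 0)) eRest))))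

def consProg : Prog :=
  .seq (.assign 4 (.pair (.pair (.fst (.snd (.reg 4))) (.fst (.reg 4))) (.snd (.snd (.reg 4)))))
    (setCtrl eRest)

def appProg : Prog :=
  .seq (.assign 4 (.pair (.get (eTagged 0 (.pair eArg (.fst (.reg 4))))) (.snd (.reg 4))))
    (setCtrl eRest)

/-- Ground a definition or constrain. -/
def clauseProg : Prog :=
  let b : Expr := .snd eArg
  switch (.fst eArg) 0
    [setCtrl (.pair (eTagged 0 (.fst b)) (.pair (eTagged 8 (.snd (.snd b)))
        (.pair (eTagged 12 (.fst (.snd b))) eRest))),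
      setCtrl (.pair (eTagged 5 (.pair (.fst b)
          (.pair (eTagged 11 (.snd b)) (.pair (eTagged 13 (.atom 0)) (.reg 1)))))
        (.pair (eTagged 6 (.pair (.fst b) (.get (eTagged 1 (.fst b))))) eRest)),
      setCtrl (.pair (eTagged 11 (.fst b)) (.pair (eTagged 11 (.snd b)) eRest))]

/-- Create an initial task. -/
def initProg : Prog :=
  .seq (.put (eTagged 3 eArg) (.reg 5))
    (.seq (.assign 6 (.pair (.pair (.fst (.snd (.reg 4)))
        (.pair (eTagged 3 (.pair eArg (.fst (.reg 4)))) (.atom 0))) (.reg 6)))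
      (.seq (.assign 4 (.snd (.snd (.reg 4)))) (setCtrl eRest)))

/-- The machine cannot negate a bit, so the opposite bit is stored beside it. -/
def setMode (a : Expr) : Prog :=
  .seq (.assign 5 a) (.ifEq (.reg 5) (.atom 0) (.assign 8 (.atom 1)) (.assign 8 (.atom 0)))

/-- Start the next clause. -/
def layerProg : Prog :=
  .ifEq eArg (.atom 0) (setCtrl eRest)
    (.seq (setMode (.fst (.fst eArg)))
      (.seq (.assign 7 (.snd eArg))
        (setCtrl (.pair (eTagged 11 (.snd (.fst eArg))) (.pair (eTagged 15 (.atom 0))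
          (.pair (eTagged 14 (.snd eArg)) eRest))))))

def solveProg : Prog :=
  .seq (setCtrl (.pair (eTagged 16 (.reg 6)) eRest)) (.assign 6 (.atom 0))

def wakeProg : Prog :=
  .ifEq eArg (.atom 0) (setCtrl eRest)
    (setCtrl (.pair (eTagged 17 (.fst eArg)) (.pair (eTagged 16 (.snd eArg)) eRest)))

/-- Record the given facts. -/
def factsProg : Prog :=
  .ifEq eArg (.atom 0) (setCtrl eRest)
    (.seq (.put (eTagged 2 (.fst eArg)) (.atom 1))
      (setCtrl (.pair (eTagged 18 (.snd eArg)) eRest)))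

/-- The position in the list is the tag of the control item. Item 13 does nothing: `loopProg` runs
pairs of items, and the loop over the instances of a clause needs no second one. -/
def body : Prog :=
  switch (.fst (.fst (.reg 3))) 0
    [groundProg, tupleProg, varProg, litProg, binProg, loopProg, restoreProg, termProg, argsProg,
      consProg, appProg, clauseProg, initProg, setCtrl eRest, layerProg, solveProg, wakeProg,
      taskProg, factsProg]

/-- Register 2 already lists the given facts and starts the output. Register 5 is `nil`, which is
`bit false`, so register 8 must become 1. -/
def prologue : Prog :=
  .seq (setCtrl (.pair (eTagged 18 (.reg 2)) (.pair (eTagged 14 (.reg 0)) (.atom 0))))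
    (.seq (.assign 0 (.atom 0)) (.assign 8 (.atom 1)))

def epilogue : Prog := .assign 0 (.reg 2)

def program : Prog := .seq prologue (.seq (.whileNe (.reg 3) (.atom 0) body) epilogue)

theorem loopFree_body : body.loopFree = true := rfl

/-! ### Configurations and the machine states that represent them -/

/-- Configurations of the solver. -/
structure Cfg where
  ctrl : Val
  vals : Val
  out : Val
  mode : Bool
  work : Val
  tok : Val
  tab : Val → Val

abbrev bit (b : Bool) : Val := .atom b.toNat

/-- The state of the machine for a configuration and the list `u` of the universe. -/
def conc (u : Val) (c : Cfg) : State where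
  reg
    | 1 => u
    | 2 => c.out
    | 3 => c.ctrl
    | 4 => c.vals
    | 5 => bit c.mode
    | 6 => c.work
    | 7 => c.tok
    | 8 => bit !c.mode
    | _ => .nil
  tab := c.tab

section conc

variable (u ctrl vals out work tok : Val) (mode : Bool) (tab : Val → Val) (v : Val)

@[simp]
theorem conc_reg_one (c : Cfg) : (conc u c).reg 1 = u := rfl
@[simp]
theorem conc_reg_two (c : Cfg) : (conc u c).reg 2 = c.out := rfl
@[simp]
theorem conc_reg_three (c : Cfg) : (conc u c).reg 3 = c.ctrl := rfl
@[simp]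
theorem conc_reg_four (c : Cfg) : (conc u c).reg 4 = c.vals := rfl
@[simp]
theorem conc_reg_five (c : Cfg) : (conc u c).reg 5 = bit c.mode := rfl
@[simp]
theorem conc_reg_six (c : Cfg) : (conc u c).reg 6 = c.work := rfl
@[simp]
theorem conc_reg_seven (c : Cfg) : (conc u c).reg 7 = c.tok := rfl
@[simp]
theorem conc_reg_eight (c : Cfg) : (conc u c).reg 8 = bit !c.mode := rfl
@[simp]
theorem conc_tab (c : Cfg) : (conc u c).tab = c.tab := rfl

@[simp]
theorem conc_update_two :
    (⟨Function.update (conc u ⟨ctrl, vals, out, mode, work, tok, tab⟩).reg 2 v, tab⟩ : State) =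
      conc u ⟨ctrl, vals, v, mode, work, tok, tab⟩ := by
  simp only [conc, State.mk.injEq, and_true]
  funext n
  by_cases h : n = 2
  · subst h; simp
  · rw [Function.update_of_ne h]; split <;> first | rfl | contradiction

@[simp]
theorem conc_update_three :
    (⟨Function.update (conc u ⟨ctrl, vals, out, mode, work, tok, tab⟩).reg 3 v, tab⟩ : State) =
      conc u ⟨v, vals, out, mode, work, tok, tab⟩ := by
  simp only [conc, State.mk.injEq, and_true]
  funext n
  by_cases h : n = 3
  · subst h; simp
  · rw [Function.update_of_ne h]; split <;> first | rfl | contradiction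

@[simp]
theorem conc_update_four :
    (⟨Function.update (conc u ⟨ctrl, vals, out, mode, work, tok, tab⟩).reg 4 v, tab⟩ : State) =
      conc u ⟨ctrl, v, out, mode, work, tok, tab⟩ := by
  simp only [conc, State.mk.injEq, and_true]
  funext n
  by_cases h : n = 4
  · subst h; simp
  · rw [Function.update_of_ne h]; split <;> first | rfl | contradiction

@[simp]
theorem conc_update_six :
    (⟨Function.update (conc u ⟨ctrl, vals, out, mode, work, tok, tab⟩).reg 6 v, tab⟩ : State) =
      conc u ⟨ctrl, vals, out, mode, v, tok, tab⟩ := by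
  simp only [conc, State.mk.injEq, and_true]
  funext n
  by_cases h : n = 6
  · subst h; simp
  · rw [Function.update_of_ne h]; split <;> first | rfl | contradiction

@[simp]
theorem conc_update_seven :
    (⟨Function.update (conc u ⟨ctrl, vals, out, mode, work, tok, tab⟩).reg 7 v, tab⟩ : State) =
      conc u ⟨ctrl, vals, out, mode, work, v, tab⟩ := by
  simp only [conc, State.mk.injEq, and_true]
  funext n
  by_cases h : n = 7
  · subst h; simp
  · rw [Function.update_of_ne h]; split <;> first | rfl | contradiction

@[simp]
theorem conc_update_mode (m : Bool) :
    (⟨Function.update (Function.update (conc u ⟨ctrl, vals, out, mode, work, tok, tab⟩).reg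
      5 (bit m)) 8 (bit !m), tab⟩ : State) = conc u ⟨ctrl, vals, out, m, work, tok, tab⟩ := by
  simp only [conc, State.mk.injEq, and_true]
  funext n
  by_cases h : n = 8
  · subst h; simp
  rw [Function.update_of_ne h]
  by_cases h' : n = 5
  · subst h'; simp
  rw [Function.update_of_ne h']; split <;> first | rfl | contradiction

@[simp]
theorem conc_update_tab (t : Val → Val) :
    (⟨(conc u ⟨ctrl, vals, out, mode, work, tok, tab⟩).reg, t⟩ : State) =
      conc u ⟨ctrl, vals, out, mode, work, tok, t⟩ := rfl

theorem run_setMode (a : Expr) (m : Bool)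
    (h : a.eval (conc u ⟨ctrl, vals, out, mode, work, tok, tab⟩) = bit m) :
    (setMode a).run (conc u ⟨ctrl, vals, out, mode, work, tok, tab⟩) =
      conc u ⟨ctrl, vals, out, m, work, tok, tab⟩ := by
  rw [← conc_update_mode u ctrl vals out work tok mode tab m]
  cases m <;> simp [setMode, run, h, Expr.eval] <;> rfl

end conc

/-! ### Rounds of the main loop and their cost -/

/-- One round of the main loop. -/
def Step (u : Val) (c c' : Cfg) : Prop := c.ctrl ≠ .nil ∧ body.run (conc u c) = conc u c'

/-- `Runs u n c c'`: at most `n` rounds of the main loop lead from `c` to `c'`. -/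
inductive Runs (u : Val) : ℕ → Cfg → Cfg → Prop
  | refl (n : ℕ) (c : Cfg) : Runs u n c c
  | step {n : ℕ} {c c' c'' : Cfg} (h : Step u c c') (h' : Runs u n c' c'') : Runs u (n + 1) c c''

theorem Runs.mono {u : Val} {n n' : ℕ} {c c' : Cfg} (h : Runs u n c c') (hn : n ≤ n') :
    Runs u n' c c' := by
  induction h generalizing n' with
  | refl => exact .refl _ _
  | step h _ ih =>
    obtain _ | n' := n'
    · omega
    · exact .step h (ih (by omega))

theorem Runs.trans {u : Val} {n n' : ℕ} {c c' c'' : Cfg} (h : Runs u n c c')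
    (h' : Runs u n' c' c'') : Runs u (n + n') c c'' := by
  induction h with
  | refl => exact h'.mono (by omega)
  | step h _ ih => exact ((Runs.step h (ih h'))).mono (by omega)

theorem Step.runs {u : Val} {c c' : Cfg} (h : Step u c c') : Runs u 1 c c' :=
  .step h (.refl 0 _)

/-- The test of the loop costs 3; it is paid in each round and once more at the end. -/
theorem Runs.exec {u : Val} {n : ℕ} {c c' : Cfg} (h : Runs u n c c') (hc : c'.ctrl = .nil) :
    ∃ t ≤ (body.maxCost + 3) * n + 3,
      Exec (.whileNe (.reg 3) (.atom 0) body) (conc u c) t (conc u c') := by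
  induction h with
  | refl n c =>
    refine ⟨3, by omega, ?_⟩
    exact Exec.while_done (a := .reg 3) (b := .atom 0) hc
  | @step n c c' c'' h _ ih =>
    obtain ⟨t, ht, hx⟩ := ih hc
    obtain ⟨t', ht', hx'⟩ := body.exec_run loopFree_body (conc u c)
    rw [h.2] at hx'
    refine ⟨_, ?_, Exec.while_step (a := .reg 3) (b := .atom 0) h.1 hx' hx⟩
    simp only [Expr.cost]
    rw [Nat.mul_succ]; omega

theorem run_body {u : Val} {c : Cfg} {i : ℕ} {a K : Val} {p : Prog}
    (hc : c.ctrl = .pair (tagged i a) K)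
    (hp : [groundProg, tupleProg, varProg, litProg, binProg, loopProg, restoreProg, termProg,
      argsProg, consProg, appProg, clauseProg, initProg, setCtrl eRest, layerProg, solveProg,
      wakeProg, taskProg, factsProg][i]? = some p) :
    body.run (conc u c) = p.run (conc u c) := by
  refine run_switch _ _ i p 0 _ ?_ hp
  simp [Expr.eval, conc_reg_three, hc, Val.fst]

end Solver

end LFP

namespace LFP

namespace Solver

open Prog

set_option linter.unusedSimpArgs false

/-! ### The effect of one round, for each kind of control item -/

section Steps

variable (u K V out work tok : Val) (mode : Bool) (tab : Val → Val)

theorem step_pos (R xs : Val) :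
    Step u ⟨(tagged 0 (tagged 0 (R.pair xs))).pair K, V, out, mode, work, tok, tab⟩
      ⟨(tagged 1 xs).pair ((tagged 3 ((bit (mode)).pair R)).pair K), V, out, mode, work, tok,
        tab⟩ := by
  refine ⟨by simp, ?_⟩
  rw [run_body rfl rfl, groundProg, run_switch _ _ 0 _ 0 _ rfl rfl]
  simp [run, Expr.eval, Val.fst, Val.snd]

theorem step_neg (R xs : Val) :
    Step u ⟨(tagged 0 (tagged 1 (R.pair xs))).pair K, V, out, mode, work, tok, tab⟩
      ⟨(tagged 1 xs).pair ((tagged 3 ((bit (!mode)).pair R)).pair K), V, out, mode, work, tok,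
        tab⟩ := by
  refine ⟨by simp, ?_⟩
  rw [run_body rfl rfl, groundProg, run_switch _ _ 1 _ 0 _ rfl rfl]
  simp [run, Expr.eval, Val.fst, Val.snd]

theorem step_and (c d : Val) :
    Step u ⟨(tagged 0 (tagged 2 (c.pair d))).pair K, V, out, mode, work, tok, tab⟩
      ⟨(tagged 0 c).pair ((tagged 0 d).pair ((tagged 4 (bit (mode))).pair K)), V, out, mode, work, tok,
        tab⟩ := by
  refine ⟨by simp, ?_⟩
  rw [run_body rfl rfl, groundProg, run_switch _ _ 2 _ 0 _ rfl rfl]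
  simp [run, Expr.eval, Val.fst, Val.snd]

theorem step_or (c d : Val) :
    Step u ⟨(tagged 0 (tagged 3 (c.pair d))).pair K, V, out, mode, work, tok, tab⟩
      ⟨(tagged 0 c).pair ((tagged 0 d).pair ((tagged 4 (bit (!mode))).pair K)), V, out, mode, work, tok,
        tab⟩ := by
  refine ⟨by simp, ?_⟩
  rw [run_body rfl rfl, groundProg, run_switch _ _ 3 _ 0 _ rfl rfl]
  simp [run, Expr.eval, Val.fst, Val.snd]

theorem step_ex (x c : Val) :
    Step u ⟨(tagged 0 (tagged 4 (x.pair c))).pair K, V, out, mode, work, tok, tab⟩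
      ⟨(tagged 5 (x.pair ((tagged 0 c).pair ((tagged 4 (bit (!mode))).pair u)))).pair
        ((tagged 6 (x.pair (tab (tagged 1 x)))).pair K), (tagged 2 (bit (!mode))).pair V, out, mode, work, tok,
        tab⟩ := by
  refine ⟨by simp, ?_⟩
  rw [run_body rfl rfl, groundProg, run_switch _ _ 4 _ 0 _ rfl rfl]
  simp [run, Expr.eval, Val.fst, Val.snd]

theorem step_all (x c : Val) :
    Step u ⟨(tagged 0 (tagged 5 (x.pair c))).pair K, V, out, mode, work, tok, tab⟩
      ⟨(tagged 5 (x.pair ((tagged 0 c).pair ((tagged 4 (bit (mode))).pair u)))).pair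
        ((tagged 6 (x.pair (tab (tagged 1 x)))).pair K), (tagged 2 (bit (mode))).pair V, out, mode, work, tok,
        tab⟩ := by
  refine ⟨by simp, ?_⟩
  rw [run_body rfl rfl, groundProg, run_switch _ _ 5 _ 0 _ rfl rfl]
  simp [run, Expr.eval, Val.fst, Val.snd]

theorem step_tru (v : Val) :
    Step u ⟨(tagged 0 (tagged 6 v)).pair K, V, out, mode, work, tok, tab⟩
      ⟨K, (tagged 2 (bit (mode))).pair V, out, mode, work, tok,
        tab⟩ := by
  refine ⟨by simp, ?_⟩
  rw [run_body rfl rfl, groundProg, run_switch _ _ 6 _ 0 _ rfl rfl]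
  simp [run, Expr.eval, Val.fst, Val.snd]

theorem step_fls (v : Val) :
    Step u ⟨(tagged 0 (tagged 7 v)).pair K, V, out, mode, work, tok, tab⟩
      ⟨K, (tagged 2 (bit (!mode))).pair V, out, mode, work, tok,
        tab⟩ := by
  refine ⟨by simp, ?_⟩
  rw [run_body rfl rfl, groundProg, run_switch _ _ 7 _ 0 _ rfl rfl]
  simp [run, Expr.eval, Val.fst, Val.snd]

theorem step_tuple_nil  :
    Step u ⟨(tagged 1 .nil).pair K, V, out, mode, work, tok, tab⟩
      ⟨K, Val.nil.pair V, out, mode, work, tok,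
        tab⟩ := by
  refine ⟨by simp, ?_⟩
  rw [run_body rfl rfl]
  simp [tupleProg, run, Expr.eval, Val.fst, Val.snd]

theorem step_tuple_cons (x xs : Val) :
    Step u ⟨(tagged 1 (x.pair xs)).pair K, V, out, mode, work, tok, tab⟩
      ⟨(tagged 1 xs).pair ((tagged 2 x).pair K), V, out, mode, work, tok,
        tab⟩ := by
  refine ⟨by simp, ?_⟩
  rw [run_body rfl rfl]
  simp [tupleProg, run, Expr.eval, Val.fst, Val.snd]

theorem step_var (x t : Val) :
    Step u ⟨(tagged 2 x).pair K, t.pair V, out, mode, work, tok, tab⟩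
      ⟨K, ((tab (tagged 1 x)).pair t).pair V, out, mode, work, tok,
        tab⟩ := by
  refine ⟨by simp, ?_⟩
  rw [run_body rfl rfl]
  simp [varProg, run, Expr.eval, Val.fst, Val.snd]

theorem step_mkLit (q R t : Val) :
    Step u ⟨(tagged 3 (q.pair R)).pair K, t.pair V, out, mode, work, tok, tab⟩
      ⟨K, (tagged 0 (q.pair (R.pair t))).pair V, out, mode, work, tok,
        tab⟩ := by
  refine ⟨by simp, ?_⟩
  rw [run_body rfl rfl]
  simp [litProg, run, Expr.eval, Val.fst, Val.snd]

theorem step_bin (o g h : Val) :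
    Step u ⟨(tagged 4 o).pair K, g.pair (h.pair V), out, mode, work, tok, tab⟩
      ⟨K, (tagged 1 (o.pair (g.pair h))).pair V, out, mode, work, tok,
        tab⟩ := by
  refine ⟨by simp, ?_⟩
  rw [run_body rfl rfl]
  simp [binProg, run, Expr.eval, Val.fst, Val.snd]

theorem step_loop_nil (x i o : Val) :
    Step u ⟨(tagged 5 (x.pair (i.pair (o.pair .nil)))).pair K, V, out, mode, work, tok, tab⟩
      ⟨K, V, out, mode, work, tok,
        tab⟩ := by
  refine ⟨by simp, ?_⟩
  rw [run_body rfl rfl]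
  simp [loopProg, run, Expr.eval, Val.fst, Val.snd]

theorem step_loop_cons (x i o a us : Val) :
    Step u ⟨(tagged 5 (x.pair (i.pair (o.pair (a.pair us))))).pair K, V, out, mode, work, tok, tab⟩
      ⟨i.pair (o.pair ((tagged 5 (x.pair (i.pair (o.pair us)))).pair K)), V, out, mode, work, tok,
        Function.update tab (tagged 1 x) a⟩ := by
  refine ⟨by simp, ?_⟩
  rw [run_body rfl rfl]
  simp [loopProg, run, Expr.eval, Val.fst, Val.snd]

theorem step_restore (x v : Val) :
    Step u ⟨(tagged 6 (x.pair v)).pair K, V, out, mode, work, tok, tab⟩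
      ⟨K, V, out, mode, work, tok,
        Function.update tab (tagged 1 x) v⟩ := by
  refine ⟨by simp, ?_⟩
  rw [run_body rfl rfl]
  simp [restoreProg, run, Expr.eval, Val.fst, Val.snd]

theorem step_term_var (x : Val) :
    Step u ⟨(tagged 7 (tagged 0 x)).pair K, V, out, mode, work, tok, tab⟩
      ⟨K, (tab (tagged 1 x)).pair V, out, mode, work, tok,
        tab⟩ := by
  refine ⟨by simp, ?_⟩
  rw [run_body rfl rfl, termProg, run_switch _ _ 0 _ 0 _ rfl rfl]
  simp [run, Expr.eval, Val.fst, Val.snd]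

theorem step_term_app (f us : Val) :
    Step u ⟨(tagged 7 (tagged 1 (f.pair us))).pair K, V, out, mode, work, tok, tab⟩
      ⟨(tagged 8 us).pair ((tagged 10 f).pair K), V, out, mode, work, tok,
        tab⟩ := by
  refine ⟨by simp, ?_⟩
  rw [run_body rfl rfl, termProg, run_switch _ _ 1 _ 0 _ rfl rfl]
  simp [run, Expr.eval, Val.fst, Val.snd]

theorem step_args_nil  :
    Step u ⟨(tagged 8 .nil).pair K, V, out, mode, work, tok, tab⟩
      ⟨K, Val.nil.pair V, out, mode, work, tok,
        tab⟩ := by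
  refine ⟨by simp, ?_⟩
  rw [run_body rfl rfl]
  simp [argsProg, run, Expr.eval, Val.fst, Val.snd]

theorem step_args_cons (v us : Val) :
    Step u ⟨(tagged 8 (v.pair us)).pair K, V, out, mode, work, tok, tab⟩
      ⟨(tagged 7 v).pair ((tagged 8 us).pair ((tagged 9 .nil).pair K)), V, out, mode, work, tok,
        tab⟩ := by
  refine ⟨by simp, ?_⟩
  rw [run_body rfl rfl]
  simp [argsProg, run, Expr.eval, Val.fst, Val.snd]

theorem step_cons (v t : Val) :
    Step u ⟨(tagged 9 .nil).pair K, t.pair (v.pair V), out, mode, work, tok, tab⟩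
      ⟨K, (v.pair t).pair V, out, mode, work, tok,
        tab⟩ := by
  refine ⟨by simp, ?_⟩
  rw [run_body rfl rfl]
  simp [consProg, run, Expr.eval, Val.fst, Val.snd]

theorem step_app (f t : Val) :
    Step u ⟨(tagged 10 f).pair K, t.pair V, out, mode, work, tok, tab⟩
      ⟨K, (tab (tagged 0 (f.pair t))).pair V, out, mode, work, tok,
        tab⟩ := by
  refine ⟨by simp, ?_⟩
  rw [run_body rfl rfl]
  simp [appProg, run, Expr.eval, Val.fst, Val.snd]

theorem step_imp (c R us : Val) :
    Step u ⟨(tagged 11 (tagged 0 (c.pair (R.pair us)))).pair K, V, out, mode, work, tok, tab⟩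
      ⟨(tagged 0 c).pair ((tagged 8 us).pair ((tagged 12 R).pair K)), V, out, mode, work, tok,
        tab⟩ := by
  refine ⟨by simp, ?_⟩
  rw [run_body rfl rfl, clauseProg, run_switch _ _ 0 _ 0 _ rfl rfl]
  simp [run, Expr.eval, Val.fst, Val.snd]

theorem step_clause_all (x d : Val) :
    Step u ⟨(tagged 11 (tagged 1 (x.pair d))).pair K, V, out, mode, work, tok, tab⟩
      ⟨(tagged 5 (x.pair ((tagged 11 d).pair ((tagged 13 .nil).pair u)))).pair
        ((tagged 6 (x.pair (tab (tagged 1 x)))).pair K), V, out, mode, work, tok,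
        tab⟩ := by
  refine ⟨by simp, ?_⟩
  rw [run_body rfl rfl, clauseProg, run_switch _ _ 1 _ 0 _ rfl rfl]
  simp [run, Expr.eval, Val.fst, Val.snd]

theorem step_clause_and (c d : Val) :
    Step u ⟨(tagged 11 (tagged 2 (c.pair d))).pair K, V, out, mode, work, tok, tab⟩
      ⟨(tagged 11 c).pair ((tagged 11 d).pair K), V, out, mode, work, tok,
        tab⟩ := by
  refine ⟨by simp, ?_⟩
  rw [run_body rfl rfl, clauseProg, run_switch _ _ 2 _ 0 _ rfl rfl]
  simp [run, Expr.eval, Val.fst, Val.snd]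

/-- The flag of the asserted predicate is written while the instances are collected. Flags are read
only when the layer is solved, so they are then complete for this layer. -/
theorem step_init (R t g : Val) :
    Step u ⟨(tagged 12 R).pair K, t.pair (g.pair V), out, mode, work, tok, tab⟩
      ⟨K, V, out, mode, (g.pair ((tagged 3 (R.pair t)).pair .nil)).pair work, tok,
        Function.update tab (tagged 3 R) (bit mode)⟩ := by
  refine ⟨by simp, ?_⟩
  rw [run_body rfl rfl]
  simp [initProg, run, Expr.eval, Val.fst, Val.snd]

theorem step_nop (v : Val) :
    Step u ⟨(tagged 13 v).pair K, V, out, mode, work, tok, tab⟩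
      ⟨K, V, out, mode, work, tok, tab⟩ := by
  refine ⟨by simp, ?_⟩
  rw [run_body rfl rfl]
  simp [run, Expr.eval, Val.snd]

theorem step_layer_nil  :
    Step u ⟨(tagged 14 .nil).pair K, V, out, mode, work, tok, tab⟩
      ⟨K, V, out, mode, work, tok,
        tab⟩ := by
  refine ⟨by simp, ?_⟩
  rw [run_body rfl rfl]
  simp [layerProg, run, Expr.eval, Val.fst, Val.snd]

theorem step_layer_cons (m : Bool) (d ds : Val) :
    Step u ⟨(tagged 14 (((bit m).pair d).pair ds)).pair K, V, out, mode, work, tok, tab⟩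
      ⟨(tagged 11 d).pair ((tagged 15 .nil).pair ((tagged 14 ds).pair K)), V, out, m, work, ds,
        tab⟩ := by
  refine ⟨by simp, ?_⟩
  rw [run_body rfl rfl]
  rw [layerProg, run, if_neg (by simp [Expr.eval, Val.fst, Val.snd]), run,
    run_setMode (m := m) (h := by simp [Expr.eval, Val.fst, Val.snd])]
  simp [run, Expr.eval, Val.fst, Val.snd]

theorem step_solve  :
    Step u ⟨(tagged 15 .nil).pair K, V, out, mode, work, tok, tab⟩
      ⟨(tagged 16 work).pair K, V, out, mode, .nil, tok,
        tab⟩ := by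
  refine ⟨by simp, ?_⟩
  rw [run_body rfl rfl]
  simp [solveProg, run, Expr.eval, Val.fst, Val.snd]

theorem step_wake_nil  :
    Step u ⟨(tagged 16 .nil).pair K, V, out, mode, work, tok, tab⟩
      ⟨K, V, out, mode, work, tok,
        tab⟩ := by
  refine ⟨by simp, ?_⟩
  rw [run_body rfl rfl]
  simp [wakeProg, run, Expr.eval, Val.fst, Val.snd]

theorem step_wake_cons (t ts : Val) :
    Step u ⟨(tagged 16 (t.pair ts)).pair K, V, out, mode, work, tok, tab⟩
      ⟨(tagged 17 t).pair ((tagged 16 ts).pair K), V, out, mode, work, tok,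
        tab⟩ := by
  refine ⟨by simp, ?_⟩
  rw [run_body rfl rfl]
  simp [wakeProg, run, Expr.eval, Val.fst, Val.snd]

theorem step_facts_nil  :
    Step u ⟨(tagged 18 .nil).pair K, V, out, mode, work, tok, tab⟩
      ⟨K, V, out, mode, work, tok,
        tab⟩ := by
  refine ⟨by simp, ?_⟩
  rw [run_body rfl rfl]
  simp [factsProg, run, Expr.eval, Val.fst, Val.snd]

theorem step_facts_cons (A l : Val) :
    Step u ⟨(tagged 18 (A.pair l)).pair K, V, out, mode, work, tok, tab⟩
      ⟨(tagged 18 l).pair K, V, out, mode, work, tok,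
        Function.update tab (tagged 2 A) (.atom 1)⟩ := by
  refine ⟨by simp, ?_⟩
  rw [run_body rfl rfl]
  simp [factsProg, run, Expr.eval, Val.fst, Val.snd]

theorem step_task_visited (t : Val) (h : tab (tagged 4 (tok.pair t)) = .atom 1) :
    Step u ⟨(tagged 17 t).pair K, V, out, mode, work, tok, tab⟩
      ⟨K, V, out, mode, work, tok, tab⟩ := by
  refine ⟨by simp, ?_⟩
  rw [run_body rfl rfl]
  simp [taskProg, run, Expr.eval, Val.fst, Val.snd, h]

theorem step_task_lit_holds (q R a k : Val)
    (h : tab (tagged 4 (tok.pair ((tagged 0 (q.pair (R.pair a))).pair k))) ≠ .atom 1)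
    (hf : tab (tagged 3 R) = q)
    (hr : tab (tagged 2 (R.pair a)) = .atom 1) :
    Step u ⟨(tagged 17 ((tagged 0 (q.pair (R.pair a))).pair k)).pair K, V, out, mode, work, tok, tab⟩
      ⟨(tagged 17 k).pair K, V, out, mode, work, tok,
        Function.update tab (tagged 4 (tok.pair ((tagged 0 (q.pair (R.pair a))).pair k))) (.atom 1)⟩ := by
  refine ⟨by simp, ?_⟩
  rw [run_body rfl rfl, taskProg, run, if_neg (by simpa [Expr.eval, Val.fst, Val.snd] using h), run,
    run_switch _ _ 0 _ 0 _ (by simp [run, Expr.eval, Val.fst, Val.snd]) rfl]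
  simp [hf, hr, run, Expr.eval, Val.fst, Val.snd]

theorem step_task_lit_wait (q R a k : Val)
    (h : tab (tagged 4 (tok.pair ((tagged 0 (q.pair (R.pair a))).pair k))) ≠ .atom 1)
    (hf : tab (tagged 3 R) = q)
    (hr : tab (tagged 2 (R.pair a)) ≠ .atom 1) :
    Step u ⟨(tagged 17 ((tagged 0 (q.pair (R.pair a))).pair k)).pair K, V, out, mode, work, tok, tab⟩
      ⟨K, V, out, mode, work, tok,
        Function.update (Function.update tab (tagged 4 (tok.pair ((tagged 0 (q.pair (R.pair a))).pair k))) (.atom 1))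
          (tagged 5 (tok.pair (R.pair a))) (k.pair (tab (tagged 5 (tok.pair (R.pair a)))))⟩ := by
  refine ⟨by simp, ?_⟩
  rw [run_body rfl rfl, taskProg, run, if_neg (by simpa [Expr.eval, Val.fst, Val.snd] using h), run,
    run_switch _ _ 0 _ 0 _ (by simp [run, Expr.eval, Val.fst, Val.snd]) rfl]
  simp [hf, hr, run, Expr.eval, Val.fst, Val.snd]

theorem step_task_lit_fails (q R a k : Val)
    (h : tab (tagged 4 (tok.pair ((tagged 0 (q.pair (R.pair a))).pair k))) ≠ .atom 1)
    (hf : tab (tagged 3 R) ≠ q)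
    (hr : tab (tagged 2 (R.pair a)) = .atom 1) :
    Step u ⟨(tagged 17 ((tagged 0 (q.pair (R.pair a))).pair k)).pair K, V, out, mode, work, tok, tab⟩
      ⟨K, V, out, mode, work, tok,
        Function.update tab (tagged 4 (tok.pair ((tagged 0 (q.pair (R.pair a))).pair k))) (.atom 1)⟩ := by
  refine ⟨by simp, ?_⟩
  rw [run_body rfl rfl, taskProg, run, if_neg (by simpa [Expr.eval, Val.fst, Val.snd] using h), run,
    run_switch _ _ 0 _ 0 _ (by simp [run, Expr.eval, Val.fst, Val.snd]) rfl]
  simp [hf, hr, run, Expr.eval, Val.fst, Val.snd]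

theorem step_task_lit_lacks (q R a k : Val)
    (h : tab (tagged 4 (tok.pair ((tagged 0 (q.pair (R.pair a))).pair k))) ≠ .atom 1)
    (hf : tab (tagged 3 R) ≠ q)
    (hr : tab (tagged 2 (R.pair a)) ≠ .atom 1) :
    Step u ⟨(tagged 17 ((tagged 0 (q.pair (R.pair a))).pair k)).pair K, V, out, mode, work, tok, tab⟩
      ⟨(tagged 17 k).pair K, V, out, mode, work, tok,
        Function.update tab (tagged 4 (tok.pair ((tagged 0 (q.pair (R.pair a))).pair k))) (.atom 1)⟩ := by
  refine ⟨by simp, ?_⟩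
  rw [run_body rfl rfl, taskProg, run, if_neg (by simpa [Expr.eval, Val.fst, Val.snd] using h), run,
    run_switch _ _ 0 _ 0 _ (by simp [run, Expr.eval, Val.fst, Val.snd]) rfl]
  simp [hf, hr, run, Expr.eval, Val.fst, Val.snd]

theorem step_task_and (c d k : Val)
    (h : tab (tagged 4 (tok.pair ((tagged 1 ((bit false).pair (c.pair d))).pair k))) ≠ .atom 1) :
    Step u ⟨(tagged 17 ((tagged 1 ((bit false).pair (c.pair d))).pair k)).pair K, V, out, mode, work, tok, tab⟩
      ⟨(tagged 17 (c.pair (d.pair k))).pair K, V, out, mode, work, tok,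
        Function.update tab (tagged 4 (tok.pair ((tagged 1 ((bit false).pair (c.pair d))).pair k))) (.atom 1)⟩ := by
  refine ⟨by simp, ?_⟩
  rw [run_body rfl rfl, taskProg, run, if_neg (by simpa [Expr.eval, Val.fst, Val.snd] using h), run,
    run_switch _ _ 1 _ 0 _ (by simp [run, Expr.eval, Val.fst, Val.snd]) rfl]
  simp [run, Expr.eval, Val.fst, Val.snd]

theorem step_task_or (c d k : Val)
    (h : tab (tagged 4 (tok.pair ((tagged 1 ((bit true).pair (c.pair d))).pair k))) ≠ .atom 1) :
    Step u ⟨(tagged 17 ((tagged 1 ((bit true).pair (c.pair d))).pair k)).pair K, V, out, mode, work, tok, tab⟩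
      ⟨(tagged 17 (c.pair k)).pair ((tagged 17 (d.pair k)).pair K), V, out, mode, work, tok,
        Function.update tab (tagged 4 (tok.pair ((tagged 1 ((bit true).pair (c.pair d))).pair k))) (.atom 1)⟩ := by
  refine ⟨by simp, ?_⟩
  rw [run_body rfl rfl, taskProg, run, if_neg (by simpa [Expr.eval, Val.fst, Val.snd] using h), run,
    run_switch _ _ 1 _ 0 _ (by simp [run, Expr.eval, Val.fst, Val.snd]) rfl]
  simp [run, Expr.eval, Val.fst, Val.snd]

theorem step_task_true (k : Val)
    (h : tab (tagged 4 (tok.pair ((tagged 2 (bit false)).pair k))) ≠ .atom 1) :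
    Step u ⟨(tagged 17 ((tagged 2 (bit false)).pair k)).pair K, V, out, mode, work, tok, tab⟩
      ⟨(tagged 17 k).pair K, V, out, mode, work, tok,
        Function.update tab (tagged 4 (tok.pair ((tagged 2 (bit false)).pair k))) (.atom 1)⟩ := by
  refine ⟨by simp, ?_⟩
  rw [run_body rfl rfl, taskProg, run, if_neg (by simpa [Expr.eval, Val.fst, Val.snd] using h), run,
    run_switch _ _ 2 _ 0 _ (by simp [run, Expr.eval, Val.fst, Val.snd]) rfl]
  simp [run, Expr.eval, Val.fst, Val.snd]

theorem step_task_false (k : Val)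
    (h : tab (tagged 4 (tok.pair ((tagged 2 (bit true)).pair k))) ≠ .atom 1) :
    Step u ⟨(tagged 17 ((tagged 2 (bit true)).pair k)).pair K, V, out, mode, work, tok, tab⟩
      ⟨K, V, out, mode, work, tok,
        Function.update tab (tagged 4 (tok.pair ((tagged 2 (bit true)).pair k))) (.atom 1)⟩ := by
  refine ⟨by simp, ?_⟩
  rw [run_body rfl rfl, taskProg, run, if_neg (by simpa [Expr.eval, Val.fst, Val.snd] using h), run,
    run_switch _ _ 2 _ 0 _ (by simp [run, Expr.eval, Val.fst, Val.snd]) rfl]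
  simp [run, Expr.eval, Val.fst, Val.snd]

theorem step_task_assert_old (A k : Val)
    (h : tab (tagged 4 (tok.pair ((tagged 3 A).pair k))) ≠ .atom 1)
    (hr : tab (tagged 2 A) = .atom 1) :
    Step u ⟨(tagged 17 ((tagged 3 A).pair k)).pair K, V, out, mode, work, tok, tab⟩
      ⟨K, V, out, mode, work, tok,
        Function.update tab (tagged 4 (tok.pair ((tagged 3 A).pair k))) (.atom 1)⟩ := by
  refine ⟨by simp, ?_⟩
  rw [run_body rfl rfl, taskProg, run, if_neg (by simpa [Expr.eval, Val.fst, Val.snd] using h), run,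
    run_switch _ _ 3 _ 0 _ (by simp [run, Expr.eval, Val.fst, Val.snd]) rfl]
  simp [hr, run, Expr.eval, Val.fst, Val.snd]

theorem step_task_assert_new (A k : Val)
    (h : tab (tagged 4 (tok.pair ((tagged 3 A).pair k))) ≠ .atom 1)
    (hr : tab (tagged 2 A) ≠ .atom 1) :
    Step u ⟨(tagged 17 ((tagged 3 A).pair k)).pair K, V, out, mode, work, tok, tab⟩
      ⟨(tagged 16 (tab (tagged 5 (tok.pair A)))).pair K, V, A.pair out, mode, work, tok,
        Function.update (Function.update tab (tagged 4 (tok.pair ((tagged 3 A).pair k))) (.atom 1))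
          (tagged 2 A) (.atom 1)⟩ := by
  refine ⟨by simp, ?_⟩
  rw [run_body rfl rfl, taskProg, run, if_neg (by simpa [Expr.eval, Val.fst, Val.snd] using h), run,
    run_switch _ _ 3 _ 0 _ (by simp [run, Expr.eval, Val.fst, Val.snd]) rfl]
  simp [hr, run, Expr.eval, Val.fst, Val.snd]

end Steps

end Solver

end LFP

namespace LFP

namespace Solver

open Prog

/-! ## Ground conditions -/

/-- Ground conditions. The literal `lit q A` says that `A` is recorded if the flag of its predicate
is `q`, and that `A` is not recorded otherwise. `bin` is conjunction for `false` and disjunction for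
`true`, and `unit` is the neutral element. -/
inductive GF (S : Signature) (U : Type*) : Type _
  | lit (q : Bool) (A : GroundAtom S U) : GF S U
  | bin (b : Bool) (g h : GF S U) : GF S U
  | unit (b : Bool) : GF S U

variable {S : Signature} {U : Type*} {n : ℕ}

def GF.code (e : U ≃ Fin n) : GF S U → Val
  | .lit q A => tagged 0 ((bit q).pair (A.code e))
  | .bin b g h => tagged 1 ((bit b).pair ((g.code e).pair (h.code e)))
  | .unit b => tagged 2 (bit b)

def GF.size : GF S U → ℕ
  | .lit _ _ => 1
  | .bin _ g h => 1 + g.size + h.size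
  | .unit _ => 1

/-- The ground condition for a condition (`m = false`) or for its negation (`m = true`). -/
def ground (us : List U) (m : Bool) : (ℕ → U) → Cond S → GF S U
  | ς, .pos R xs => .lit m ⟨R, fun i => ς (xs i)⟩
  | ς, .neg R xs => .lit (!m) ⟨R, fun i => ς (xs i)⟩
  | ς, .and c d => .bin m (ground us m ς d) (ground us m ς c)
  | ς, .or c d => .bin (!m) (ground us m ς d) (ground us m ς c)
  | ς, .ex x c =>
    us.foldl (fun g a => .bin (!m) (ground us m (Function.update ς x a) c) g) (.unit (!m))
  | ς, .all x c => us.foldl (fun g a => .bin m (ground us m (Function.update ς x a) c) g) (.unit m)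
  | _, .tru => .unit m
  | _, .fls => .unit (!m)

/-- The instances of a definition or (for `m = true`) constrain, in front of `W`. -/
def instances (us : List U) (m : Bool) (ζ : FnInterp S U) :
    (ℕ → U) → Defn S → List (GF S U × GroundAtom S U) → List (GF S U × GroundAtom S U)
  | ς, .imp c R ts, W => (ground us m ς c, ⟨R, fun i => (ts i).eval ζ ς⟩) :: W
  | ς, .all x d, W => us.foldl (fun W a => instances us m ζ (Function.update ς x a) d W) W
  | ς, .and d d₂, W => instances us m ζ ς d₂ (instances us m ζ ς d W)

def instCode (e : U ≃ Fin n) (p : GF S U × GroundAtom S U) : Val :=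
  (p.1.code e).pair ((tagged 3 (p.2.code e)).pair .nil)

/-- The list of the universe as a value. -/
def univCode (e : U ≃ Fin n) (us : List U) : Val := Val.list (us.map (elemCode e))

def flagKey (R : Fin S.numPred) : Val := tagged 3 (.atom R)

open Classical in
/-- The table with the flags of the predicates asserted by `W` set to `m`. -/
noncomputable def flagged (m : Bool) (W : List (GF S U × GroundAtom S U)) (tab : Val → Val) :
    Val → Val :=
  fun k => if ∃ p ∈ W, k = flagKey p.2.1 then bit m else tab k

theorem flagged_nil (m : Bool) (tab : Val → Val) :
    flagged m ([] : List (GF S U × GroundAtom S U)) tab = tab := by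
  funext k; simp [flagged]

theorem update_flagged_flagKey (m : Bool) (W : List (GF S U × GroundAtom S U)) (tab : Val → Val)
    (p : GF S U × GroundAtom S U) :
    Function.update (flagged m W tab) (flagKey p.2.1) (bit m) = flagged m (p :: W) tab := by
  funext k
  by_cases h : k = flagKey p.2.1
  · simp [flagged, h]
  · rw [Function.update_of_ne h]
    simp only [flagged, List.mem_cons, exists_eq_or_imp, h, false_or]

/-- Flags and variables have disjoint keys, so a quantifier may rebind its variable in the
underlying table while the flags set so far stay outermost. -/
theorem update_flagged_varKey (m : Bool) (W : List (GF S U × GroundAtom S U)) (tab : Val → Val)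
    (x : ℕ) (v : Val) :
    Function.update (flagged m W tab) (varKey x) v =
      flagged m W (Function.update tab (varKey x) v) := by
  funext k
  by_cases h : k = varKey x
  · subst h
    simp [flagged, varKey, flagKey]
  · rw [Function.update_of_ne h]
    simp only [flagged, Function.update_of_ne h]

/-! ### Environments stored in the hash table -/

/-- The table provides the values of the variables in `X`. -/
def EnvOK (e : U ≃ Fin n) (tab : Val → Val) (ς : ℕ → U) (X : Set ℕ) : Prop :=
  ∀ x ∈ X, tab (varKey x) = elemCode e (ς x)

/-- The table provides the interpretation of the function symbols. -/
def FnOK (e : U ≃ Fin n) (tab : Val → Val) (ζ : FnInterp S U) : Prop :=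
  ∀ p, tab (fnKey e p) = elemCode e (ζ p.1 p.2)

/-- The tables agree except for the value of the variable `x`. -/
def AgreeOff (x : ℕ) (tab tab' : Val → Val) : Prop :=
  ∀ v, Function.update tab (varKey x) v = Function.update tab' (varKey x) v

theorem AgreeOff.refl (x : ℕ) (tab : Val → Val) : AgreeOff x tab tab := fun _ => rfl

theorem AgreeOff.update {x : ℕ} {tab tab' : Val → Val} (h : AgreeOff x tab tab') (v : Val) :
    AgreeOff x (Function.update tab (varKey x) v) tab' := fun w => by
  rw [Function.update_idem, h]

theorem AgreeOff.apply {x : ℕ} {tab tab' : Val → Val} (h : AgreeOff x tab tab') {k : Val}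
    (hk : k ≠ varKey x) : tab k = tab' k := by
  have := congrFun (h .nil) k
  rwa [Function.update_of_ne hk, Function.update_of_ne hk] at this

/-- Writing back the saved value recovers the old table exactly, whatever the loop has left at `x`.
So quantifiers may be nested and may shadow each other. -/
theorem AgreeOff.restore {x : ℕ} {tab tab' : Val → Val} (h : AgreeOff x tab tab') :
    Function.update tab (varKey x) (tab' (varKey x)) = tab' := by
  rw [h, Function.update_eq_self]

theorem varKey_injective : Function.Injective varKey := fun x y h => by
  simpa [varKey] using h

theorem EnvOK.mono {e : U ≃ Fin n} {tab : Val → Val} {ς : ℕ → U} {X Y : Set ℕ}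
    (h : EnvOK e tab ς X) (hY : Y ⊆ X) : EnvOK e tab ς Y := fun x hx => h x (hY hx)

theorem EnvOK.update {e : U ≃ Fin n} {tab tab' : Val → Val} {ς : ℕ → U} {x : ℕ} {X : Set ℕ}
    (h : EnvOK e tab' ς (X \ {x})) (hx : AgreeOff x tab tab') (a : U) :
    EnvOK e (Function.update tab (varKey x) (elemCode e a)) (Function.update ς x a) X := by
  intro y hy
  by_cases hyx : y = x
  · subst hyx; simp
  · have hk : varKey y ≠ varKey x := fun h => hyx (varKey_injective h)
    rw [Function.update_of_ne hk, Function.update_of_ne hyx, hx.apply hk]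
    exact h y ⟨hy, hyx⟩

theorem FnOK.update {e : U ≃ Fin n} {tab tab' : Val → Val} {ζ : FnInterp S U} {x : ℕ}
    (h : FnOK e tab' ζ) (hx : AgreeOff x tab tab') (v : Val) :
    FnOK e (Function.update tab (varKey x) v) ζ := by
  intro p
  have hk : fnKey e p ≠ varKey x := by simp [fnKey, varKey]
  rw [Function.update_of_ne hk, hx.apply hk, h]

theorem EnvOK.flagged {e : U ≃ Fin n} {tab : Val → Val} {ς : ℕ → U} {X : Set ℕ}
    (h : EnvOK e tab ς X) (m : Bool) (W : List (GF S U × GroundAtom S U)) :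
    EnvOK e (flagged m W tab) ς X := by
  intro x hx
  rw [← h x hx, Solver.flagged, if_neg]
  simp [varKey, flagKey]

theorem FnOK.flagged {e : U ≃ Fin n} {tab : Val → Val} {ζ : FnInterp S U}
    (h : FnOK e tab ζ) (m : Bool) (W : List (GF S U × GroundAtom S U)) :
    FnOK e (flagged m W tab) ζ := by
  intro p
  rw [← h p, Solver.flagged, if_neg]
  simp [fnKey, flagKey]

/-! ## Grounding by the solver -/

section Runs

variable (e : U ≃ Fin n) (us : List U) (out work tok : Val) (mode : Bool)

theorem runs_tuple (u : Val) (tab : Val → Val) (ς : ℕ → U) (xs : List ℕ)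
    (h : EnvOK e tab ς {x | x ∈ xs}) (K V : Val) :
    Runs u (1 + 2 * xs.length)
      ⟨(tagged 1 (Val.list (xs.map .atom))).pair K, V, out, mode, work, tok, tab⟩
      ⟨K, (Val.list (xs.map fun x => elemCode e (ς x))).pair V, out, mode, work, tok, tab⟩ := by
  induction xs generalizing K V with
  | nil => exact (step_tuple_nil ..).runs
  | cons x xs ih =>
    have H := (step_var u K V out work tok mode tab (.atom x)
      (Val.list (xs.map fun x => elemCode e (ς x)))).runs
    rw [show tab (tagged 1 (.atom x)) = elemCode e (ς x) from h x (by simp)] at H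
    refine ((step_tuple_cons ..).runs.trans <|
      (ih (h.mono fun y hy => List.mem_cons_of_mem _ hy) _ _).trans H).mono ?_
    simp only [List.length_cons]; omega

/-- The two rounds by which each term undercuts `5 * size` pay for unfolding the list cell and for
the final cons. -/
theorem runs_args (u : Val) (tab : Val → Val) (ζ : FnInterp S U) (ς : ℕ → U) (ts : List (Term S))
    (h : ∀ t ∈ ts, ∀ K V, Runs u (5 * t.size - 2)
      ⟨(tagged 7 t.code).pair K, V, out, mode, work, tok, tab⟩
      ⟨K, (elemCode e (t.eval ζ ς)).pair V, out, mode, work, tok, tab⟩)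
    (hs : ∀ t ∈ ts, 1 ≤ t.size) (K V : Val) :
    Runs u (1 + 5 * (ts.map Term.size).sum)
      ⟨(tagged 8 (Val.list (ts.map Term.code))).pair K, V, out, mode, work, tok, tab⟩
      ⟨K, (Val.list (ts.map fun t => elemCode e (t.eval ζ ς))).pair V, out, mode, work, tok,
        tab⟩ := by
  induction ts generalizing K V with
  | nil => exact (step_args_nil ..).runs
  | cons t ts ih =>
    refine ((step_args_cons ..).runs.trans <| (h t (by simp) _ _).trans <|
      (ih (fun t ht => h t (by simp [ht])) (fun t ht => hs t (by simp [ht])) _ _).trans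
      (step_cons ..).runs).mono ?_
    have := hs t (by simp)
    simp only [List.map_cons, List.sum_cons]; omega

theorem one_le_size (t : Term S) : 1 ≤ t.size := by
  cases t <;> simp [Term.size]

theorem runs_tuple_term {k : ℕ} (u : Val) (tab : Val → Val) (ζ : FnInterp S U) (ς : ℕ → U)
    (ts : Fin k → Term S)
    (h : ∀ i, ∀ K V, Runs u (5 * (ts i).size - 2)
      ⟨(tagged 7 (ts i).code).pair K, V, out, mode, work, tok, tab⟩
      ⟨K, (elemCode e ((ts i).eval ζ ς)).pair V, out, mode, work, tok, tab⟩) (K V : Val) :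
    Runs u (1 + 5 * ∑ i, (ts i).size)
      ⟨(tagged 8 (Val.tuple fun i => (ts i).code)).pair K, V, out, mode, work, tok, tab⟩
      ⟨K, (Val.tuple fun i => elemCode e ((ts i).eval ζ ς)).pair V, out, mode, work, tok,
        tab⟩ := by
  have := runs_args e out work tok mode u tab ζ ς (List.ofFn ts)
    (fun t ht => by obtain ⟨i, rfl⟩ := List.mem_ofFn.1 ht; exact h i)
    (fun t _ => one_le_size t) K V
  simpa only [List.map_ofFn, List.sum_ofFn, Function.comp_def, Val.tuple] using this

theorem runs_term (u : Val) (tab : Val → Val) (ζ : FnInterp S U) (ς : ℕ → U) (hζ : FnOK e tab ζ)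
    (t : Term S) (h : EnvOK e tab ς t.free) (K V : Val) :
    Runs u (5 * t.size - 2) ⟨(tagged 7 t.code).pair K, V, out, mode, work, tok, tab⟩
      ⟨K, (elemCode e (t.eval ζ ς)).pair V, out, mode, work, tok, tab⟩ := by
  induction t generalizing K V with
  | var x =>
    have H := (step_term_var u K V out work tok mode tab (.atom x)).runs
    rw [show tab (tagged 1 (.atom x)) = elemCode e (ς x) from h x rfl] at H
    exact H.mono (by simp [Term.size])
  | app f ts ih =>
    have h₁ := runs_tuple_term e out work tok mode u tab ζ ς ts
      (fun i => ih i (h.mono (Set.subset_iUnion (fun i => (ts i).free) i)))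
      ((tagged 10 (.atom f)).pair K) V
    have h₂ := (step_app u K V out work tok mode tab (.atom f)
      (Val.tuple fun i => elemCode e ((ts i).eval ζ ς))).runs
    rw [show tab (tagged 0 _) = _ from hζ ⟨f, fun i => (ts i).eval ζ ς⟩] at h₂
    refine ((step_term_app ..).runs.trans <| h₁.trans h₂).mono ?_
    simp only [Term.size]; omega

theorem runs_terms {k : ℕ} (u : Val) (tab : Val → Val) (ζ : FnInterp S U) (ς : ℕ → U)
    (hζ : FnOK e tab ζ) (ts : Fin k → Term S) (h : EnvOK e tab ς (⋃ i, (ts i).free)) (K V : Val) :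
    Runs u (1 + 5 * ∑ i, (ts i).size)
      ⟨(tagged 8 (Val.tuple fun i => (ts i).code)).pair K, V, out, mode, work, tok, tab⟩
      ⟨K, (Val.tuple fun i => elemCode e ((ts i).eval ζ ς)).pair V, out, mode, work, tok,
        tab⟩ :=
  runs_tuple_term e out work tok mode u tab ζ ς ts
    (fun i => runs_term e out work tok mode u tab ζ ς hζ (ts i)
      (h.mono (Set.subset_iUnion (fun i => (ts i).free) i))) K V

/-- The partial result is kept on the value stack. Each element costs two extra rounds, one for the
loop and one for the connective; the exhausted loop and the restoration of `x` cost two more at the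
end. -/
theorem runs_quant (x : ℕ) (c : Val) (b : Bool) (g : U → GF S U) (B : ℕ) (tab : Val → Val)
    (h : ∀ a tab' K V, AgreeOff x tab' tab → Runs (univCode e us) B
      ⟨(tagged 0 c).pair K, V, out, mode, work, tok,
        Function.update tab' (varKey x) (elemCode e a)⟩
      ⟨K, ((g a).code e).pair V, out, mode, work, tok,
        Function.update tab' (varKey x) (elemCode e a)⟩)
    (K V : Val) (l : List U) (acc : GF S U) (tab' : Val → Val) (htab : AgreeOff x tab' tab) :
    Runs (univCode e us) (2 + l.length * (2 + B))
      ⟨(tagged 5 ((Val.atom x).pair ((tagged 0 c).pair ((tagged 4 (bit b)).pair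
          (univCode e l))))).pair ((tagged 6 ((Val.atom x).pair (tab (varKey x)))).pair K),
        (acc.code e).pair V, out, mode, work, tok, tab'⟩
      ⟨K, ((l.foldl (fun acc a => .bin b (g a) acc) acc).code e).pair V, out, mode, work, tok,
        tab⟩ := by
  induction l generalizing acc tab' with
  | nil =>
    have H := (step_loop_nil (univCode e us) ((tagged 6 ((Val.atom x).pair (tab (varKey x)))).pair K)
      ((acc.code e).pair V) out work tok mode tab' (.atom x) (tagged 0 c)
      (tagged 4 (bit b))).runs.trans (step_restore ..).runs
    rw [show Function.update tab' (tagged 1 (.atom x)) _ = _ from htab.restore] at H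
    exact H.mono (by simp)
  | cons a l ih =>
    refine ((step_loop_cons ..).runs.trans <| (h a tab' _ _ htab).trans <|
      (step_bin ..).runs.trans <| ih (.bin b (g a) acc) _ (htab.update _)).mono ?_
    simp only [List.length_cons, Nat.succ_mul]; omega

/-- The overhead `3 + 2n` is absorbed by `5 n ^ (1 + d)`. For `n = 1` there is no slack, which fixes
the constant 5. -/
theorem quant_bound (s d n : ℕ) (hn : 1 ≤ n) :
    1 + (2 + n * (2 + 5 * s * n ^ d)) ≤ 5 * (1 + s) * n ^ (1 + d) := by
  have h : n ≤ n ^ (1 + d) := Nat.le_self_pow (by omega) n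
  have h' : n * (5 * s * n ^ d) = 5 * s * n ^ (1 + d) := by rw [pow_add]; ring
  have h'' : 5 * (1 + s) * n ^ (1 + d) = 5 * n ^ (1 + d) + 5 * s * n ^ (1 + d) := by ring
  rw [h'', Nat.mul_add, h']
  omega

theorem conn_bound (s s' d d' n : ℕ) (hn : 1 ≤ n) :
    2 + 5 * s * n ^ d + 5 * s' * n ^ d' ≤ 5 * (1 + s + s') * n ^ max d d' := by
  have h : n ^ d ≤ n ^ max d d' := Nat.pow_le_pow_right hn (le_max_left _ _)
  have h' : n ^ d' ≤ n ^ max d d' := Nat.pow_le_pow_right hn (le_max_right _ _)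
  have h₁ : 1 ≤ n ^ max d d' := Nat.one_le_pow _ _ hn
  have h₂ := Nat.mul_le_mul_left (5 * s) h
  have h₃ := Nat.mul_le_mul_left (5 * s') h'
  have h'' : 5 * (1 + s + s') * n ^ max d d' =
      5 * n ^ max d d' + 5 * s * n ^ max d d' + 5 * s' * n ^ max d d' := by ring
  rw [h'']
  omega

/-- Each symbol takes a bounded number of rounds for each assignment to the quantifiers above it.
The table must provide only the free variables, since loops write the bound ones before their bodies
run. -/
theorem runs_ground (hus : 1 ≤ us.length) (c : Cond S) (ς : ℕ → U) (tab : Val → Val)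
    (h : EnvOK e tab ς c.free) (K V : Val) :
    Runs (univCode e us) (5 * c.size * us.length ^ c.depth)
      ⟨(tagged 0 c.code).pair K, V, out, mode, work, tok, tab⟩
      ⟨K, ((ground us mode ς c).code e).pair V, out, mode, work, tok, tab⟩ := by
  induction c generalizing ς tab K V with
  | pos R xs =>
    have H := runs_tuple e out work tok mode (univCode e us) tab ς (List.ofFn xs)
      (h.mono fun x hx => List.mem_ofFn.1 hx)
      ((tagged 3 ((bit mode).pair (.atom R))).pair K) V
    simp only [List.map_ofFn, List.length_ofFn, Function.comp_def] at H
    refine ((step_pos ..).runs.trans <| H.trans (step_mkLit ..).runs).mono ?_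
    simp only [Cond.size, Cond.depth, pow_zero]; omega
  | neg R xs =>
    have H := runs_tuple e out work tok mode (univCode e us) tab ς (List.ofFn xs)
      (h.mono fun x hx => List.mem_ofFn.1 hx)
      ((tagged 3 ((bit !mode).pair (.atom R))).pair K) V
    simp only [List.map_ofFn, List.length_ofFn, Function.comp_def] at H
    refine ((step_neg ..).runs.trans <| H.trans (step_mkLit ..).runs).mono ?_
    simp only [Cond.size, Cond.depth, pow_zero]; omega
  | and c d ihc ihd =>
    refine ((step_and ..).runs.trans <| (ihc ς tab (h.mono fun _ => .inl) _ _).trans <|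
      (ihd ς tab (h.mono fun _ => .inr) _ _).trans (step_bin ..).runs).mono ?_
    have := conn_bound c.size d.size c.depth d.depth us.length hus
    simp only [Cond.size, Cond.depth]; omega
  | or c d ihc ihd =>
    refine ((step_or ..).runs.trans <| (ihc ς tab (h.mono fun _ => .inl) _ _).trans <|
      (ihd ς tab (h.mono fun _ => .inr) _ _).trans (step_bin ..).runs).mono ?_
    have := conn_bound c.size d.size c.depth d.depth us.length hus
    simp only [Cond.size, Cond.depth]; omega
  | ex x c ih =>
    have H := runs_quant e us out work tok mode x c.code (!mode)
      (fun a => ground us mode (Function.update ς x a) c) _ tab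
      (fun a tab' K V ht => ih (Function.update ς x a) _ (EnvOK.update h ht a) K V) K V us
      (.unit (!mode)) tab (.refl x tab)
    exact ((step_ex ..).runs.trans H).mono (quant_bound c.size c.depth us.length hus)
  | all x c ih =>
    have H := runs_quant e us out work tok mode x c.code mode
      (fun a => ground us mode (Function.update ς x a) c) _ tab
      (fun a tab' K V ht => ih (Function.update ς x a) _ (EnvOK.update h ht a) K V) K V us
      (.unit mode) tab (.refl x tab)
    exact ((step_all ..).runs.trans H).mono (quant_bound c.size c.depth us.length hus)
  | tru => exact (step_tru ..).runs.mono (by simp [Cond.size, Cond.depth])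
  | fls => exact (step_fls ..).runs.mono (by simp [Cond.size, Cond.depth])

/-- The collected instances as a value. -/
def workCode (W : List (GF S U × GroundAtom S U)) : Val := Val.list (W.map (instCode e))

/-- The same loop as in `runs_quant`, but the results accumulate in the list of instances and in the
flags, not on the value stack. -/
theorem runs_clause_quant (x : ℕ) (d : Val)
    (f : U → List (GF S U × GroundAtom S U) → List (GF S U × GroundAtom S U)) (B : ℕ)
    (tab : Val → Val)
    (h : ∀ a tab' W K V, AgreeOff x tab' tab → Runs (univCode e us) B
      ⟨(tagged 11 d).pair K, V, out, mode, workCode e W, tok,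
        flagged mode W (Function.update tab' (varKey x) (elemCode e a))⟩
      ⟨K, V, out, mode, workCode e (f a W), tok,
        flagged mode (f a W) (Function.update tab' (varKey x) (elemCode e a))⟩)
    (K V : Val) (l : List U) (W : List (GF S U × GroundAtom S U)) (tab' : Val → Val)
    (htab : AgreeOff x tab' tab) :
    Runs (univCode e us) (2 + l.length * (2 + B))
      ⟨(tagged 5 ((Val.atom x).pair ((tagged 11 d).pair ((tagged 13 .nil).pair
          (univCode e l))))).pair ((tagged 6 ((Val.atom x).pair (tab (varKey x)))).pair K),
        V, out, mode, workCode e W, tok, flagged mode W tab'⟩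
      ⟨K, V, out, mode, workCode e (l.foldl (fun W a => f a W) W), tok,
        flagged mode (l.foldl (fun W a => f a W) W) tab⟩ := by
  induction l generalizing W tab' with
  | nil =>
    have H := (step_loop_nil (univCode e us) ((tagged 6 ((Val.atom x).pair (tab (varKey x)))).pair K)
      V out (workCode e W) tok mode (flagged mode W tab') (.atom x) (tagged 11 d)
      (tagged 13 .nil)).runs.trans (step_restore ..).runs
    rw [show Function.update (flagged mode W tab') (tagged 1 (.atom x)) _ = _ from
      update_flagged_varKey .., htab.restore] at H
    exact H.mono (by simp)
  | cons a l ih =>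
    have H := (step_loop_cons (univCode e us)
      ((tagged 6 ((Val.atom x).pair (tab (varKey x)))).pair K)
      V out (workCode e W) tok mode (flagged mode W tab') (.atom x) (tagged 11 d)
      (tagged 13 .nil) (elemCode e a) (univCode e l)).runs
    rw [show Function.update (flagged mode W tab') (tagged 1 (.atom x)) _ = _ from
      update_flagged_varKey ..] at H
    refine (H.trans <| (h a tab' W _ _ htab).trans <|
      (step_nop ..).runs.trans <| ih (f a W) _ (htab.update _)).mono ?_
    simp only [List.length_cons, Nat.succ_mul]; omega

theorem runs_instances (hus : 1 ≤ us.length) (ζ : FnInterp S U) (d : Defn S) (ς : ℕ → U)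
    (tab : Val → Val) (hζ : FnOK e tab ζ) (h : EnvOK e tab ς d.free)
    (W : List (GF S U × GroundAtom S U)) (K V : Val) :
    Runs (univCode e us) (5 * d.size * us.length ^ d.depth)
      ⟨(tagged 11 d.code).pair K, V, out, mode, workCode e W, tok, flagged mode W tab⟩
      ⟨K, V, out, mode, workCode e (instances us mode ζ ς d W), tok,
        flagged mode (instances us mode ζ ς d W) tab⟩ := by
  induction d generalizing ς tab W K V with
  | imp c R ts =>
    have h₁ := runs_ground e us out (workCode e W) tok mode hus c ς (flagged mode W tab)
      ((h.mono fun _ => .inl).flagged mode W)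
      ((tagged 8 (Val.tuple fun i => (ts i).code)).pair ((tagged 12 (.atom R)).pair K)) V
    have h₂ := runs_terms e out (workCode e W) tok mode (univCode e us) (flagged mode W tab) ζ ς
      (hζ.flagged mode W) ts ((h.mono fun _ => .inr).flagged mode W)
      ((tagged 12 (.atom R)).pair K) (((ground us mode ς c).code e).pair V)
    have h₃ := (step_init (univCode e us) K V out (workCode e W) tok mode (flagged mode W tab)
      (.atom R) (Val.tuple fun i => elemCode e ((ts i).eval ζ ς))
      ((ground us mode ς c).code e)).runs
    rw [show Function.update (flagged mode W tab) (tagged 3 (.atom R)) _ = _ from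
      update_flagged_flagKey mode W tab (ground us mode ς c, ⟨R, fun i => (ts i).eval ζ ς⟩)] at h₃
    refine ((step_imp ..).runs.trans <| h₁.trans <| h₂.trans h₃).mono ?_
    have hp : 1 ≤ us.length ^ c.depth := Nat.one_le_pow _ _ hus
    have := Nat.mul_le_mul_left (5 * (2 + ∑ i, (ts i).size)) hp
    have h'' : 5 * (1 + c.size + (1 + ∑ i, (ts i).size)) * us.length ^ c.depth =
      5 * c.size * us.length ^ c.depth +
        5 * (2 + ∑ i, (ts i).size) * us.length ^ c.depth := by ring
    simp only [Defn.size, Defn.depth, h'']; omega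
  | all x d ih =>
    have H := runs_clause_quant e us out tok mode x d.code
      (fun a W => instances us mode ζ (Function.update ς x a) d W) _ tab
      (fun a tab' W K V ht => ih (Function.update ς x a) _ (hζ.update ht _)
        (EnvOK.update h ht a) W K V) K V us W tab (.refl x tab)
    have hx : flagged mode W tab (tagged 1 (.atom x)) = tab (varKey x) := by
      rw [flagged, if_neg (by simp [flagKey])]; rfl
    have H' := (step_clause_all (univCode e us) K V out (workCode e W) tok mode
      (flagged mode W tab) (.atom x) d.code).runs
    rw [hx] at H'
    exact (H'.trans H).mono (quant_bound d.size d.depth us.length hus)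
  | and d d₂ ih ih₂ =>
    refine ((step_clause_and ..).runs.trans <|
      (ih ς tab hζ (h.mono fun _ => .inl) W _ _).trans <|
      ih₂ ς tab hζ (h.mono fun _ => .inr) _ _ _).mono ?_
    have := conn_bound d.size d₂.size d.depth d₂.depth us.length hus
    simp only [Defn.size, Defn.depth]; omega

end Runs

/-! ## The size of the ground instances -/

theorem size_foldl (b : Bool) (g : U → GF S U) (B : ℕ) (hg : ∀ a, (g a).size ≤ B) (l : List U)
    (acc : GF S U) :
    (l.foldl (fun acc a => .bin b (g a) acc) acc).size ≤ acc.size + l.length * (1 + B) := by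
  induction l generalizing acc with
  | nil => simp
  | cons a l ih =>
    refine (ih _).trans ?_
    have := hg a
    simp only [GF.size, List.length_cons, Nat.succ_mul]; omega

theorem size_quant_bound (s d n : ℕ) (hn : 1 ≤ n) :
    1 + n * (1 + 2 * s * n ^ d) ≤ 2 * (1 + s) * n ^ (1 + d) := by
  have h : n ≤ n ^ (1 + d) := Nat.le_self_pow (by omega) n
  have h' : n * (2 * s * n ^ d) = 2 * s * n ^ (1 + d) := by rw [pow_add]; ring
  have h'' : 2 * (1 + s) * n ^ (1 + d) = 2 * n ^ (1 + d) + 2 * s * n ^ (1 + d) := by ring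
  rw [h'', Nat.mul_add, h']
  omega

theorem size_conn_bound (s s' d d' n : ℕ) (hn : 1 ≤ n) :
    1 + 2 * s * n ^ d + 2 * s' * n ^ d' ≤ 2 * (1 + s + s') * n ^ max d d' := by
  have h : n ^ d ≤ n ^ max d d' := Nat.pow_le_pow_right hn (le_max_left _ _)
  have h' : n ^ d' ≤ n ^ max d d' := Nat.pow_le_pow_right hn (le_max_right _ _)
  have h₁ : 1 ≤ n ^ max d d' := Nat.one_le_pow _ _ hn
  have h₂ := Nat.mul_le_mul_left (2 * s) h
  have h₃ := Nat.mul_le_mul_left (2 * s') h'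
  have h'' : 2 * (1 + s + s') * n ^ max d d' =
      2 * n ^ max d d' + 2 * s * n ^ max d d' + 2 * s' * n ^ max d d' := by ring
  rw [h'']
  omega

theorem size_ground (us : List U) (hus : 1 ≤ us.length) (m : Bool) (c : Cond S) (ς : ℕ → U) :
    (ground us m ς c).size ≤ 2 * c.size * us.length ^ c.depth := by
  induction c generalizing ς with
  | pos R xs => simp [ground, GF.size, Cond.size, Cond.depth]; omega
  | neg R xs => simp [ground, GF.size, Cond.size, Cond.depth]; omega
  | and c d ihc ihd =>
    have := size_conn_bound c.size d.size c.depth d.depth us.length hus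
    have := ihc ς
    have := ihd ς
    simp only [ground, GF.size, Cond.size, Cond.depth]; omega
  | or c d ihc ihd =>
    have := size_conn_bound c.size d.size c.depth d.depth us.length hus
    have := ihc ς
    have := ihd ς
    simp only [ground, GF.size, Cond.size, Cond.depth]; omega
  | ex x c ih =>
    exact (size_foldl _ _ _ (fun a => ih _) us _).trans
      (size_quant_bound c.size c.depth us.length hus)
  | all x c ih =>
    exact (size_foldl _ _ _ (fun a => ih _) us _).trans
      (size_quant_bound c.size c.depth us.length hus)
  | tru => simp [ground, GF.size, Cond.size, Cond.depth]
  | fls => simp [ground, GF.size, Cond.size, Cond.depth]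

/-- The number of symbols of the instances. -/
def weight (W : List (GF S U × GroundAtom S U)) : ℕ := (W.map fun p => p.1.size + 1).sum

theorem weight_foldl (f : U → List (GF S U × GroundAtom S U) → List (GF S U × GroundAtom S U))
    (B : ℕ) (hf : ∀ a W, weight (f a W) ≤ weight W + B) (l : List U)
    (W : List (GF S U × GroundAtom S U)) :
    weight (l.foldl (fun W a => f a W) W) ≤ weight W + l.length * B := by
  induction l generalizing W with
  | nil => simp
  | cons a l ih =>
    refine (ih _).trans ?_
    have := hf a W
    simp only [List.length_cons, Nat.succ_mul]; omega

/-- By `length_allTasks` the weight is the length of the list of all possible tasks, so this bounds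
the work of the propositional solver on a layer. -/
theorem weight_instances (us : List U) (hus : 1 ≤ us.length) (m : Bool) (ζ : FnInterp S U)
    (d : Defn S) (ς : ℕ → U) (W : List (GF S U × GroundAtom S U)) :
    weight (instances us m ζ ς d W) ≤ weight W + 2 * d.size * us.length ^ d.depth := by
  induction d generalizing ς W with
  | imp c R ts =>
    have := size_ground us hus m c ς
    have hp : 1 ≤ us.length ^ c.depth := Nat.one_le_pow _ _ hus
    have := Nat.mul_le_mul_left (2 * (2 + ∑ i, (ts i).size)) hp
    have h'' : 2 * (1 + c.size + (1 + ∑ i, (ts i).size)) * us.length ^ c.depth =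
      2 * c.size * us.length ^ c.depth +
        2 * (2 + ∑ i, (ts i).size) * us.length ^ c.depth := by ring
    simp only [instances, weight, List.map_cons, List.sum_cons, Defn.size, Defn.depth, h'']
    omega
  | all x d ih =>
    refine (weight_foldl (fun a W => instances us m ζ (Function.update ς x a) d W) _
      (fun a W => ih (Function.update ς x a) W) us W).trans ?_
    have := size_quant_bound d.size d.depth us.length hus
    rw [Nat.mul_add] at this
    simp only [Defn.size, Defn.depth]; omega
  | and d d₂ ih ih₂ =>
    have := size_conn_bound d.size d₂.size d.depth d₂.depth us.length hus
    have := ih ς W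
    have := ih₂ ς (instances us m ζ ς d W)
    simp only [instances, Defn.size, Defn.depth]; omega

theorem length_le_weight (W : List (GF S U × GroundAtom S U)) : W.length ≤ weight W := by
  induction W with
  | nil => simp [weight]
  | cons p W ih => simp [weight] at ih ⊢; omega

end Solver

end LFP

namespace LFP

namespace Solver

open Prog

variable {S : Signature} {U : Type*} {n : ℕ}

/-! ## Tasks -/

/-- Truth of a ground condition, for the flags `f` and the set `T` of recorded ground atoms. -/
def GF.Holds (f : Fin S.numPred → Bool) (T : Set (GroundAtom S U)) : GF S U → Prop
  | .lit q A => if f A.1 = q then A ∈ T else A ∉ T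
  | .bin false g h => g.Holds f T ∧ h.Holds f T
  | .bin true g h => g.Holds f T ∨ h.Holds f T
  | .unit b => b = false

/-- The atoms that must not be recorded according to some literal are in `M` only if they are
in `T`. -/
def GF.Stable (f : Fin S.numPred → Bool) (T M : Set (GroundAtom S U)) : GF S U → Prop
  | .lit q A => f A.1 ≠ q → A ∈ M → A ∈ T
  | .bin _ g h => g.Stable f T M ∧ h.Stable f T M
  | .unit _ => True

/-- A task: a ground atom and the conditions that remain to be established before it is
recorded. -/
abbrev Task (S : Signature) (U : Type*) := List (GF S U) × GroundAtom S U

def Task.code (e : U ≃ Fin n) (t : Task S U) : Val :=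
  t.1.foldr (fun g k => (g.code e).pair k) ((tagged 3 (t.2.code e)).pair .nil)

/-! ### Injectivity of the encodings -/

theorem list_injective : Function.Injective Val.list := by
  intro l
  induction l with
  | nil => rintro (_ | ⟨w, l'⟩) h <;> simp [Val.list] at h ⊢
  | cons v l ih =>
    rintro (_ | ⟨w, l'⟩) h
    · simp [Val.list] at h
    · simp only [Val.list, Val.pair.injEq] at h
      rw [h.1, ih h.2]

theorem groundAtom_code_injective (e : U ≃ Fin n) :
    Function.Injective (GroundAtom.code (S := S) e) := by
  rintro ⟨R, a⟩ ⟨R', a'⟩ h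
  simp only [GroundAtom.code, Val.tuple, Val.pair.injEq, Val.atom.injEq] at h
  obtain rfl : R = R' := Fin.ext h.1
  have := List.ofFn_injective (list_injective h.2)
  congr 1
  funext i
  have := congrFun this i
  simpa [elemCode, Fin.val_inj] using this

theorem bit_injective : Function.Injective bit := by
  rintro (_ | _) (_ | _) h <;> simp [bit] at h ⊢

theorem gf_code_injective (e : U ≃ Fin n) : Function.Injective (GF.code (S := S) e) := by
  intro g
  induction g with
  | lit q A =>
    rintro (⟨q', A'⟩ | ⟨b, g, h⟩ | b) H <;> simp only [GF.code, Val.pair.injEq, Val.atom.injEq] at H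
    · rw [bit_injective (congrArg Val.atom H.2.1), groundAtom_code_injective e H.2.2]
    · omega
    · omega
  | bin b g h ihg ihh =>
    rintro (⟨q', A'⟩ | ⟨b, g, h⟩ | b) H <;> simp only [GF.code, Val.pair.injEq, Val.atom.injEq] at H
    · omega
    · rw [bit_injective (congrArg Val.atom H.2.1), ihg H.2.2.1, ihh H.2.2.2]
    · omega
  | unit b =>
    rintro (⟨q', A'⟩ | ⟨b, g, h⟩ | b) H <;> simp only [GF.code, Val.pair.injEq, Val.atom.injEq] at H
    · omega
    · omega
    · rw [bit_injective (congrArg Val.atom H.2)]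

theorem gf_code_ne (e : U ≃ Fin n) (g : GF S U) (v : Val) : g.code e ≠ tagged 3 v := by
  cases g <;> simp [GF.code]

/-- The end of a continuation is recognizable because tag 3 is never the tag of a ground condition.
Injectivity is needed because the marks in the table are attached to codes. -/
theorem task_code_injective (e : U ≃ Fin n) : Function.Injective (Task.code (S := S) e) := by
  rintro ⟨l, A⟩
  induction l with
  | nil =>
    rintro ⟨_ | ⟨g, l'⟩, A'⟩ h
    · simp only [Task.code, List.foldr_nil, Val.pair.injEq, and_true, true_and] at h
      rw [groundAtom_code_injective e h]
    · simp only [Task.code, List.foldr_nil, List.foldr_cons, Val.pair.injEq] at h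
      exact absurd h.1.symm (gf_code_ne e g _)
  | cons g l ih =>
    rintro ⟨_ | ⟨g', l'⟩, A'⟩ h
    · simp only [Task.code, List.foldr_nil, List.foldr_cons, Val.pair.injEq] at h
      exact absurd h.1 (gf_code_ne e g _)
    · simp only [Task.code, List.foldr_cons, Val.pair.injEq] at h
      have := ih (a₂ := (l', A')) h.2
      simp only [Prod.mk.injEq] at this
      rw [gf_code_injective e h.1, this.1, this.2]

/-- The tasks into which a task may develop in one step. -/
inductive Task.Succ : Task S U → Task S U → Prop
  | lit (q A k B) : Succ (.lit q A :: k, B) (k, B)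
  | and (g h k B) : Succ (.bin false g h :: k, B) (g :: h :: k, B)
  | or_left (g h k B) : Succ (.bin true g h :: k, B) (g :: k, B)
  | or_right (g h k B) : Succ (.bin true g h :: k, B) (h :: k, B)
  | unit (b k B) : Succ (.unit b :: k, B) (k, B)

def Closed (D : List (Task S U)) : Prop := ∀ t ∈ D, ∀ t', Task.Succ t t' → t' ∈ D

/-- The tasks that arise from `g :: k` before `k` is reached. -/
def unfold (B : GroundAtom S U) : GF S U → List (GF S U) → List (Task S U)
  | .lit q A, k => [(.lit q A :: k, B)]
  | .bin false g h, k => (.bin false g h :: k, B) :: (unfold B g (h :: k) ++ unfold B h k)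
  | .bin true g h, k => (.bin true g h :: k, B) :: (unfold B g k ++ unfold B h k)
  | .unit b, k => [(.unit b :: k, B)]

/-- The length does not depend on `k`: each position of `g` contributes one task, whose continuation
is determined by the position. Both branches of a disjunction lead to the same `k`, which is not
expanded twice; this is the source of linearity. -/
theorem length_unfold (B : GroundAtom S U) (g : GF S U) (k : List (GF S U)) :
    (unfold B g k).length = g.size := by
  induction g generalizing k with
  | lit => rfl
  | bin b g h ihg ihh => cases b <;> simp [unfold, GF.size, ihg, ihh] <;> omega
  | unit => rfl

theorem mem_unfold (B : GroundAtom S U) (g : GF S U) (k : List (GF S U)) :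
    (g :: k, B) ∈ unfold B g k := by
  rcases g with _ | ⟨_ | _, g, h⟩ | _ <;> simp [unfold]

theorem Closed.cons {D : List (Task S U)} (hD : Closed D) (t : Task S U)
    (ht : ∀ t', Task.Succ t t' → t' ∈ D) : Closed (t :: D) := by
  intro t₁ h₁ t' h'
  rcases List.mem_cons.1 h₁ with rfl | h₁
  · exact List.mem_cons_of_mem _ (ht _ h')
  · exact List.mem_cons_of_mem _ (hD _ h₁ _ h')

/-- In a conjunction the unfolding of `g` ends in `h :: k`, which is the first task in the unfolding
of `h`. In a disjunction both unfoldings end in `k`. -/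
theorem Closed.unfold {B : GroundAtom S U} (g : GF S U) {k : List (GF S U)}
    {D : List (Task S U)} (hD : Closed D) (hk : (k, B) ∈ D) : Closed (unfold B g k ++ D) := by
  induction g generalizing k D with
  | lit q A => exact hD.cons _ fun t' h => by cases h; exact hk
  | bin b g h ihg ihh =>
    cases b with
    | false =>
      have h₁ := ihh hD hk
      have h₂ := ihg h₁ (List.mem_append_left _ (mem_unfold B h k))
      simp only [Solver.unfold, List.cons_append, List.append_assoc]
      exact h₂.cons _ fun t' h => by
        cases h; exact List.mem_append_left _ (mem_unfold B _ _)
    | true =>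
      have h₁ := ihh hD hk
      have h₂ := ihg h₁ (List.mem_append_right _ hk)
      simp only [Solver.unfold, List.cons_append, List.append_assoc]
      exact h₂.cons _ fun t' h => by
        cases h
        · exact List.mem_append_left _ (mem_unfold B _ _)
        · exact List.mem_append_right _ (List.mem_append_left _ (mem_unfold B _ _))
  | unit b => exact hD.cons _ fun t' h => by cases h; exact hk

/-- All tasks that may arise from the instances `W`. -/
def allTasks (W : List (GF S U × GroundAtom S U)) : List (Task S U) :=
  W.flatMap fun p => unfold p.2 p.1 [] ++ [([], p.2)]

theorem length_allTasks (W : List (GF S U × GroundAtom S U)) :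
    (allTasks W).length = weight W := by
  induction W with
  | nil => rfl
  | cons p W ih =>
    simp only [allTasks, weight, List.flatMap_cons, List.length_append, List.map_cons,
      List.sum_cons, length_unfold, List.length_cons, List.length_nil] at ih ⊢
    omega

theorem closed_allTasks (W : List (GF S U × GroundAtom S U)) : Closed (allTasks W) := by
  intro t ht t' h
  obtain ⟨p, hp, ht⟩ := List.mem_flatMap.1 ht
  refine List.mem_flatMap.2 ⟨p, hp, ?_⟩
  refine Closed.unfold (B := p.2) p.1 (D := [([], p.2)]) ?_ (by simp) t ht t' h
  intro t₁ h₁ t₂ h₂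
  obtain rfl := List.mem_singleton.1 h₁
  cases h₂

theorem mem_allTasks {W : List (GF S U × GroundAtom S U)} {p : GF S U × GroundAtom S U}
    (hp : p ∈ W) : ([p.1], p.2) ∈ allTasks W :=
  List.mem_flatMap.2 ⟨p, hp, List.mem_append_left _ (mem_unfold _ _ _)⟩

/-! ## The propositional solver -/

inductive Item (S : Signature) (U : Type*) : Type _
  | task (t : Task S U) : Item S U
  | wake (ts : List (Task S U)) : Item S U

def Item.tasks : Item S U → List (Task S U)
  | .task t => [t]
  | .wake ts => ts

/-- States of the propositional solver: the recorded atoms, the tasks worked on so far, the tasks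
that wait for an atom, the pending tasks, and the list of the recorded atoms. -/
structure Sol (S : Signature) (U : Type*) where
  facts : Set (GroundAtom S U)
  seen : Set (Task S U)
  wait : GroundAtom S U → List (Task S U)
  items : List (Item S U)
  out : List (GroundAtom S U)

def Sol.pending (s : Sol S U) : List (Task S U) := s.items.flatMap Item.tasks

open Classical in
/-- The steps of the propositional solver. -/
inductive Sol.Step (f : Fin S.numPred → Bool) : Sol S U → Sol S U → Prop
  | wake_nil (T Z w I o) : Step f ⟨T, Z, w, .wake [] :: I, o⟩ ⟨T, Z, w, I, o⟩
  | wake_cons (T Z w I o t ts) :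
      Step f ⟨T, Z, w, .wake (t :: ts) :: I, o⟩ ⟨T, Z, w, .task t :: .wake ts :: I, o⟩
  | visited (T Z w I o t) (h : t ∈ Z) : Step f ⟨T, Z, w, .task t :: I, o⟩ ⟨T, Z, w, I, o⟩
  | lit_holds (T Z w I o q A k B) (h : (.lit q A :: k, B) ∉ Z) (hf : f A.1 = q) (hA : A ∈ T) :
      Step f ⟨T, Z, w, .task (.lit q A :: k, B) :: I, o⟩
        ⟨T, insert (.lit q A :: k, B) Z, w, .task (k, B) :: I, o⟩
  | lit_wait (T Z w I o q A k B) (h : (.lit q A :: k, B) ∉ Z) (hf : f A.1 = q) (hA : A ∉ T) :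
      Step f ⟨T, Z, w, .task (.lit q A :: k, B) :: I, o⟩
        ⟨T, insert (.lit q A :: k, B) Z, Function.update w A ((k, B) :: w A), I, o⟩
  | lit_fails (T Z w I o q A k B) (h : (.lit q A :: k, B) ∉ Z) (hf : f A.1 ≠ q) (hA : A ∈ T) :
      Step f ⟨T, Z, w, .task (.lit q A :: k, B) :: I, o⟩
        ⟨T, insert (.lit q A :: k, B) Z, w, I, o⟩
  | lit_lacks (T Z w I o q A k B) (h : (.lit q A :: k, B) ∉ Z) (hf : f A.1 ≠ q) (hA : A ∉ T) :
      Step f ⟨T, Z, w, .task (.lit q A :: k, B) :: I, o⟩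
        ⟨T, insert (.lit q A :: k, B) Z, w, .task (k, B) :: I, o⟩
  | and (T Z w I o c d k B) (h : (.bin false c d :: k, B) ∉ Z) :
      Step f ⟨T, Z, w, .task (.bin false c d :: k, B) :: I, o⟩
        ⟨T, insert (.bin false c d :: k, B) Z, w, .task (c :: d :: k, B) :: I, o⟩
  | or (T Z w I o c d k B) (h : (.bin true c d :: k, B) ∉ Z) :
      Step f ⟨T, Z, w, .task (.bin true c d :: k, B) :: I, o⟩
        ⟨T, insert (.bin true c d :: k, B) Z, w, .task (c :: k, B) :: .task (d :: k, B) :: I, o⟩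
  | tru (T Z w I o k B) (h : (.unit false :: k, B) ∉ Z) :
      Step f ⟨T, Z, w, .task (.unit false :: k, B) :: I, o⟩
        ⟨T, insert (.unit false :: k, B) Z, w, .task (k, B) :: I, o⟩
  | fls (T Z w I o k B) (h : (.unit true :: k, B) ∉ Z) :
      Step f ⟨T, Z, w, .task (.unit true :: k, B) :: I, o⟩
        ⟨T, insert (.unit true :: k, B) Z, w, I, o⟩
  | assert_old (T Z w I o B) (h : ([], B) ∉ Z) (hB : B ∈ T) :
      Step f ⟨T, Z, w, .task ([], B) :: I, o⟩ ⟨T, insert ([], B) Z, w, I, o⟩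
  | assert_new (T Z w I o B) (h : ([], B) ∉ Z) (hB : B ∉ T) :
      Step f ⟨T, Z, w, .task ([], B) :: I, o⟩
        ⟨insert B T, insert ([], B) Z, w, .wake (w B) :: I, B :: o⟩

theorem Sol.exists_step (f : Fin S.numPred → Bool) (s : Sol S U) (h : s.items ≠ []) :
    ∃ s', Sol.Step f s s' := by
  obtain ⟨T, Z, w, _ | ⟨⟨⟨l, B⟩⟩ | ⟨_ | ⟨t, ts⟩⟩, I⟩, o⟩ := s
  · exact absurd rfl h
  · by_cases hZ : (l, B) ∈ Z
    · exact ⟨_, .visited _ _ _ _ _ _ hZ⟩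
    rcases l with _ | ⟨⟨q, A⟩ | ⟨_ | _, c, d⟩ | ⟨_ | _⟩, k⟩
    · by_cases hB : B ∈ T
      · exact ⟨_, .assert_old _ _ _ _ _ _ hZ hB⟩
      · exact ⟨_, .assert_new _ _ _ _ _ _ hZ hB⟩
    · by_cases hf : f A.1 = q <;> by_cases hA : A ∈ T
      · exact ⟨_, .lit_holds _ _ _ _ _ _ _ _ _ hZ hf hA⟩
      · exact ⟨_, .lit_wait _ _ _ _ _ _ _ _ _ hZ hf hA⟩
      · exact ⟨_, .lit_fails _ _ _ _ _ _ _ _ _ hZ hf hA⟩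
      · exact ⟨_, .lit_lacks _ _ _ _ _ _ _ _ _ hZ hf hA⟩
    · exact ⟨_, .and _ _ _ _ _ _ _ _ _ hZ⟩
    · exact ⟨_, .or _ _ _ _ _ _ _ _ _ hZ⟩
    · exact ⟨_, .tru _ _ _ _ _ _ _ hZ⟩
    · exact ⟨_, .fls _ _ _ _ _ _ _ hZ⟩
  · exact ⟨_, .wake_nil _ _ _ _ _⟩
  · exact ⟨_, .wake_cons _ _ _ _ _ _ _⟩

/-! ### Termination -/

def Item.cost : Item S U → ℕ
  | .task _ => 1
  | .wake ts => 1 + 2 * ts.length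

open Classical in
/-- The steps that are left, for a list `D` of all possible tasks. -/
noncomputable def Sol.potential [Fintype U] (D : List (Task S U)) (s : Sol S U) : ℕ :=
  (s.items.map Item.cost).sum + 2 * (D.toFinset.filter (· ∉ s.seen)).card +
    ∑ A, if A ∈ s.facts then 0 else 2 * (s.wait A).length

/-- The tasks that occur are in `D`. -/
def Sol.Within (D : List (Task S U)) (s : Sol S U) : Prop :=
  (∀ t ∈ s.pending, t ∈ D) ∧ ∀ A, ∀ t ∈ s.wait A, t ∈ D

theorem Sol.Step.within {f : Fin S.numPred → Bool} {D : List (Task S U)} (hD : Closed D)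
    {s s' : Sol S U} (h : Sol.Step f s s') (hs : s.Within D) : s'.Within D := by
  classical
  obtain ⟨h₁, h₂⟩ := hs
  cases h <;>
    simp only [Sol.Within, Sol.pending, List.flatMap_cons, Item.tasks, List.mem_append,
      List.mem_cons, forall_eq_or_imp,
      List.nil_append, List.cons_append] at h₁ h₂ ⊢
  case wake_nil => exact ⟨h₁, h₂⟩
  case wake_cons => exact ⟨h₁, h₂⟩
  case visited => exact ⟨h₁.2, h₂⟩
  case lit_holds => exact ⟨⟨hD _ h₁.1 _ (.lit ..), h₁.2⟩, h₂⟩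
  case lit_wait w I o q A k B h hf hA =>
    refine ⟨h₁.2, fun A' t ht => ?_⟩
    by_cases hA' : A' = A
    · subst hA'
      rw [Function.update_self] at ht
      rcases List.mem_cons.1 ht with rfl | ht
      · exact hD _ h₁.1 _ (.lit ..)
      · exact h₂ _ _ ht
    · rw [Function.update_of_ne hA'] at ht
      exact h₂ _ _ ht
  case lit_fails => exact ⟨h₁.2, h₂⟩
  case lit_lacks => exact ⟨⟨hD _ h₁.1 _ (.lit ..), h₁.2⟩, h₂⟩
  case and => exact ⟨⟨hD _ h₁.1 _ (.and ..), h₁.2⟩, h₂⟩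
  case or => exact ⟨⟨hD _ h₁.1 _ (.or_left ..), hD _ h₁.1 _ (.or_right ..), h₁.2⟩, h₂⟩
  case tru => exact ⟨⟨hD _ h₁.1 _ (.unit ..), h₁.2⟩, h₂⟩
  case fls => exact ⟨h₁.2, h₂⟩
  case assert_old => exact ⟨h₁.2, h₂⟩
  case assert_new => exact ⟨fun t ht => ht.elim (h₂ _ t) (h₁.2 t), h₂⟩

/-- The additive form of a change in one summand avoids truncated subtraction. -/
theorem sum_exchange {ι : Type*} [Fintype ι] (g g' : ι → ℕ) (i : ι) (h : ∀ j, j ≠ i → g' j = g j) :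
    ∑ j, g' j + g i = ∑ j, g j + g' i := by
  classical
  have h' : ∑ j ∈ Finset.univ.erase i, g' j = ∑ j ∈ Finset.univ.erase i, g j :=
    Finset.sum_congr rfl fun j hj => h j (Finset.ne_of_mem_erase hj)
  rw [← Finset.add_sum_erase _ g (Finset.mem_univ i),
    ← Finset.add_sum_erase _ g' (Finset.mem_univ i), h']
  omega

open Classical in
theorem card_unseen {D : List (Task S U)} {Z : Set (Task S U)} {t : Task S U} (hD : t ∈ D)
    (hZ : t ∉ Z) : (D.toFinset.filter (· ∉ insert t Z)).card + 1 =
      (D.toFinset.filter (· ∉ Z)).card := by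
  have : D.toFinset.filter (· ∉ insert t Z) = (D.toFinset.filter (· ∉ Z)).erase t := by
    ext t'
    simp only [Finset.mem_filter, Finset.mem_erase, Set.mem_insert_iff, not_or]
    tauto
  rw [this, Finset.card_erase_add_one]
  simp [hD, hZ]

/-- An unexpanded task has credit 2. A literal passes this credit to the suspended task; a
disjunction spends it on its two new items, whose cost is 1 each. Recording an atom moves the credit
of its waiting tasks into the wake item, whose own cost 1 is paid by the assertion. Each task taken
out of a wake item uses one of its two credits, and the other is the cost of the new item. -/
theorem Sol.Step.potential_lt [Fintype U] {f : Fin S.numPred → Bool} {D : List (Task S U)}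
    {s s' : Sol S U} (h : Sol.Step f s s') (hs : s.Within D) :
    s'.potential D < s.potential D := by
  classical
  obtain ⟨h₁, -⟩ := hs
  cases h <;>
    simp only [Sol.pending, Sol.potential, List.flatMap_cons, Item.tasks, List.cons_append,
      List.nil_append, List.mem_cons, List.map_cons, List.sum_cons, Item.cost,
      List.length_cons, List.length_nil, forall_eq_or_imp] at h₁ ⊢
  case wake_nil => omega
  case wake_cons => omega
  case visited => omega
  case lit_wait T Z w I o q A k B h hf hA =>
    have := card_unseen h₁.1 h
    have := sum_exchange (fun A' => if A' ∈ T then 0 else 2 * (w A').length)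
      (fun A' => if A' ∈ T then 0 else 2 * (Function.update w A ((k, B) :: w A) A').length) A
      (fun A' hA' => by simp only [Function.update_of_ne hA'])
    simp only [if_neg hA, Function.update_self, List.length_cons] at this
    omega
  case assert_new T Z w I o B h hB =>
    have := card_unseen h₁.1 h
    have := sum_exchange (fun A' => if A' ∈ T then 0 else 2 * (w A').length)
      (fun A' => if A' ∈ insert B T then 0 else 2 * (w A').length) B
      (fun A' hA' => by simp only [Set.mem_insert_iff, hA', false_or])
    simp only [if_neg hB, Set.mem_insert, if_true] at this
    omega
  all_goals
    have := card_unseen h₁.1 ‹_›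
    omega

/-! ### Correctness -/

/-- What it means that a task has been worked on. -/
def Sol.Done (f : Fin S.numPred → Bool) (s : Sol S U) : Task S U → Prop
  | ([], B) => B ∈ s.facts
  | (.lit q A :: k, B) =>
    if f A.1 = q then
      (A ∈ s.facts → (k, B) ∈ s.seen ∨ (k, B) ∈ s.pending) ∧ (A ∉ s.facts → (k, B) ∈ s.wait A)
    else A ∉ s.facts → (k, B) ∈ s.seen ∨ (k, B) ∈ s.pending
  | (.bin false g h :: k, B) => (g :: h :: k, B) ∈ s.seen ∨ (g :: h :: k, B) ∈ s.pending
  | (.bin true g h :: k, B) =>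
    ((g :: k, B) ∈ s.seen ∨ (g :: k, B) ∈ s.pending) ∧
      ((h :: k, B) ∈ s.seen ∨ (h :: k, B) ∈ s.pending)
  | (.unit false :: k, B) => (k, B) ∈ s.seen ∨ (k, B) ∈ s.pending
  | (.unit true :: _, _) => True

/-- Facts only grow. So a literal that demands absence and is true later was true before, and its
continuation was not lost; a literal that demands presence may become true, but then its waiting
task is woken. -/
theorem Sol.Done.mono {f : Fin S.numPred → Bool} {s s' : Sol S U} {t : Task S U}
    (h : s.Done f t) (hT : s.facts ⊆ s'.facts)
    (hR : ∀ t, t ∈ s.seen ∨ t ∈ s.pending → t ∈ s'.seen ∨ t ∈ s'.pending)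
    (hw : ∀ A ∉ s'.facts, ∀ t ∈ s.wait A, t ∈ s'.wait A)
    (hw' : ∀ A ∈ s'.facts, A ∉ s.facts → ∀ t ∈ s.wait A, t ∈ s'.pending) : s'.Done f t := by
  obtain ⟨_ | ⟨⟨q, A⟩ | ⟨_ | _, c, d⟩ | ⟨_ | _⟩, k⟩, B⟩ := t
  · exact hT h
  · simp only [Sol.Done] at h ⊢
    split_ifs with hf
    · rw [if_pos hf] at h
      refine ⟨fun hA => ?_, fun hA => hw A hA _ (h.2 fun hA' => hA (hT hA'))⟩
      by_cases hA' : A ∈ s.facts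
      · exact hR _ (h.1 hA')
      -- `A` is newly recorded, so the task that waited for it is pending.
      · exact .inr (hw' A hA hA' _ (h.2 hA'))
    · rw [if_neg hf] at h
      exact fun hA => hR _ (h fun hA' => hA (hT hA'))
  · exact hR _ h
  · exact ⟨hR _ h.1, hR _ h.2⟩
  · exact hR _ h
  · trivial

/-- Everything that must be recorded is still pending or recorded. -/
def Sol.Complete (f : Fin S.numPred → Bool) (s : Sol S U) : Prop := ∀ t ∈ s.seen, s.Done f t

theorem Sol.Step.mono {f : Fin S.numPred → Bool} {s s' : Sol S U} (h : Sol.Step f s s') :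
    s.facts ⊆ s'.facts ∧
      (∀ t, t ∈ s.seen ∨ t ∈ s.pending → t ∈ s'.seen ∨ t ∈ s'.pending) ∧
      (∀ A ∉ s'.facts, ∀ t ∈ s.wait A, t ∈ s'.wait A) ∧
      (∀ A ∈ s'.facts, A ∉ s.facts → ∀ t ∈ s.wait A, t ∈ s'.pending) := by
  refine ⟨?_, ?_, ?_, ?_⟩
  · cases h <;> simp
  · intro t
    cases h <;>
      simp only [Sol.pending, List.flatMap_cons, Item.tasks, List.cons_append,
        List.nil_append, List.mem_cons, Set.mem_insert_iff, List.mem_append]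
    case visited h => rintro (ht | rfl | ht) <;> tauto
    all_goals tauto
  · cases h
    case lit_wait w I o q A k B h hf hA =>
      classical
      intro A' _ t ht
      change t ∈ Function.update w A ((k, B) :: w A) A'
      rw [Function.update_apply]
      split_ifs with hA'
      · subst hA'
        exact List.mem_cons_of_mem _ ht
      · exact ht
    all_goals exact fun _ _ _ h => h
  · cases h
    case assert_new =>
      intro A hA hA' t ht
      obtain rfl := hA.resolve_right hA'
      exact List.mem_append_left _ ht
    all_goals exact fun _ h h' => absurd h h'

theorem Sol.Step.complete {f : Fin S.numPred → Bool} {s s' : Sol S U} (h : Sol.Step f s s')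
    (hs : s.Complete f) : s'.Complete f := by
  have hm := h.mono
  have hold : ∀ t ∈ s.seen, s'.Done f t := fun t ht =>
    (hs t ht).mono hm.1 hm.2.1 hm.2.2.1 hm.2.2.2
  cases h
  case wake_nil => exact hold
  case wake_cons => exact hold
  case visited => exact hold
  -- The other steps mark one more task; what `Done` demands of it has just been made pending, put
  -- on a waiting list or recorded.
  all_goals
    intro t ht
    refine ht.elim ?_ (hold t)
    rintro rfl
    simp only [Sol.Done, Sol.pending, List.flatMap_cons, Item.tasks, List.mem_append,
      List.mem_cons, Function.update_self, true_or, or_true, and_self, Set.mem_insert_iff]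
  case lit_holds hf hA => simp [hf, hA]
  case lit_wait hf hA => simp [hf, hA]
  case lit_fails hf hA => simp [hf, hA]
  case lit_lacks hf hA => simp [hf]
  case assert_old hB => exact hB

/-- The validity of a task, for a set `M` of ground atoms that satisfies the instances. -/
def Task.Valid (f : Fin S.numPred → Bool) (T M : Set (GroundAtom S U)) (t : Task S U) : Prop :=
  (∀ g ∈ t.1, g.Stable f T M) ∧ ((∀ g ∈ t.1, g.Holds f M) → t.2 ∈ M)

/-- Every pending task is a rule obeyed by `M`. A waiting task has lost the literal it waits for, so
its validity is claimed only if the awaited atom is in `M`. -/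
def Sol.Sound (f : Fin S.numPred → Bool) (T M : Set (GroundAtom S U)) (s : Sol S U) : Prop :=
  T ⊆ s.facts ∧ s.facts ⊆ M ∧ (∀ t ∈ s.pending, t.Valid f T M) ∧
    ∀ A ∈ M, ∀ t ∈ s.wait A, t.Valid f T M

theorem Sol.Step.sound {f : Fin S.numPred → Bool} {T M : Set (GroundAtom S U)} {s s' : Sol S U}
    (h : Sol.Step f s s') (hs : s.Sound f T M) : s'.Sound f T M := by
  classical
  obtain ⟨h₀, h₁, h₂, h₃⟩ := hs
  cases h <;>
    simp only [Sol.Sound, Sol.pending, List.flatMap_cons, Item.tasks, List.mem_append,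
      List.mem_cons, forall_eq_or_imp, List.nil_append, List.cons_append] at h₀ h₁ h₂ h₃ ⊢
  case wake_nil => exact ⟨h₀, h₁, h₂, h₃⟩
  case wake_cons => exact ⟨h₀, h₁, h₂, h₃⟩
  case visited => exact ⟨h₀, h₁, h₂.2, h₃⟩
  case lit_holds q A k B h hf hA =>
    refine ⟨h₀, h₁, ⟨?_, h₂.2⟩, h₃⟩
    simp only [Task.Valid, List.mem_cons, forall_eq_or_imp, GF.Holds, if_pos hf] at h₂ ⊢
    exact ⟨h₂.1.1.2, fun h => h₂.1.2 ⟨h₁ hA, h⟩⟩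
  case lit_wait w I o q A k B h hf hA =>
    refine ⟨h₀, h₁, h₂.2, fun A' hA' t ht => ?_⟩
    by_cases hAA : A' = A
    · subst hAA
      rw [Function.update_self] at ht
      rcases List.mem_cons.1 ht with rfl | ht
      · simp only [Task.Valid, List.mem_cons, forall_eq_or_imp, GF.Holds, if_pos hf] at h₂ ⊢
        exact ⟨h₂.1.1.2, fun h => h₂.1.2 ⟨hA', h⟩⟩
      · exact h₃ _ hA' _ ht
    · rw [Function.update_of_ne hAA] at ht
      exact h₃ _ hA' _ ht
  case lit_fails => exact ⟨h₀, h₁, h₂.2, h₃⟩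
  case lit_lacks q A k B h hf hA =>
    refine ⟨h₀, h₁, ⟨?_, h₂.2⟩, h₃⟩
    simp only [Task.Valid, List.mem_cons, forall_eq_or_imp, GF.Holds, if_neg hf] at h₂ ⊢
    -- If `A` were in `M`, it would be in `T` by stability, hence among the current facts. So
    -- absence now implies absence from `M`, although more atoms may still be recorded.
    exact ⟨h₂.1.1.2, fun h => h₂.1.2 ⟨fun hM => hA (h₀ (h₂.1.1.1 hf hM)), h⟩⟩
  case and =>
    refine ⟨h₀, h₁, ⟨?_, h₂.2⟩, h₃⟩
    simp only [Task.Valid, List.mem_cons, forall_eq_or_imp, GF.Holds, GF.Stable] at h₂ ⊢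
    tauto
  case or =>
    refine ⟨h₀, h₁, ⟨?_, ?_, h₂.2⟩, h₃⟩ <;>
      simp only [Task.Valid, List.mem_cons, forall_eq_or_imp, GF.Holds, GF.Stable] at h₂ ⊢ <;>
      tauto
  case tru =>
    refine ⟨h₀, h₁, ⟨?_, h₂.2⟩, h₃⟩
    simp only [Task.Valid, List.mem_cons, forall_eq_or_imp, GF.Holds, GF.Stable] at h₂ ⊢
    tauto
  case fls => exact ⟨h₀, h₁, h₂.2, h₃⟩
  case assert_old => exact ⟨h₀, h₁, h₂.2, h₃⟩
  case assert_new B h hB =>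
    have hM : B ∈ M := h₂.1.2 (by simp)
    refine ⟨h₀.trans (Set.subset_insert _ _), Set.insert_subset hM h₁, ?_, h₃⟩
    exact fun t ht => ht.elim (h₃ B hM t) (h₂.2 t)

/-- The list of the recorded atoms is correct. -/
def Sol.Listed (s : Sol S U) : Prop := s.out.Nodup ∧ ∀ A, A ∈ s.out ↔ A ∈ s.facts

theorem Sol.Step.listed {f : Fin S.numPred → Bool} {s s' : Sol S U} (h : Sol.Step f s s')
    (hs : s.Listed) : s'.Listed := by
  obtain ⟨h₁, h₂⟩ := hs
  cases h
  case assert_new B h hB =>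
    refine ⟨List.nodup_cons.2 ⟨fun h => hB ((h₂ _).1 h), h₁⟩, fun A => ?_⟩
    simp [← h₂ A]
  all_goals exact ⟨h₁, h₂⟩

/-- With nothing pending, expanded tasks are closed under discharging a condition that is true of
the final facts. The induction on `g` must leave `k` arbitrary, since a conjunction passes its
second part through the continuation. Stability plays no role here. -/
theorem Sol.Complete.pop {f : Fin S.numPred → Bool} {s : Sol S U} (hs : s.Complete f)
    (hi : s.items = []) (g : GF S U) (k : List (GF S U)) (B : GroundAtom S U)
    (hg : g.Holds f s.facts) (h : (g :: k, B) ∈ s.seen) : (k, B) ∈ s.seen := by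
  have hp : s.pending = [] := by rw [Sol.pending, hi]; rfl
  induction g generalizing k with
  | lit q A =>
    have := hs _ h
    simp only [Sol.Done, hp, List.not_mem_nil, or_false] at this
    simp only [GF.Holds] at hg
    split_ifs at this hg with hf
    · exact this.1 hg
    · exact this hg
  | bin b c d ihc ihd =>
    have := hs _ h
    cases b with
    | false =>
      simp only [Sol.Done, hp, List.not_mem_nil, or_false] at this
      exact ihd k hg.2 (ihc _ hg.1 this)
    | true =>
      simp only [Sol.Done, hp, List.not_mem_nil, or_false] at this
      exact hg.elim (fun hg => ihc k hg this.1) fun hg => ihd k hg this.2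
  | unit b =>
    have := hs _ h
    obtain rfl : b = false := hg
    simpa only [Sol.Done, hp, List.not_mem_nil, or_false] using this

/-- `T'` is the least extension of `T` that satisfies the instances `W`. -/
structure LeastExt (f : Fin S.numPred → Bool) (W : List (GF S U × GroundAtom S U))
    (T T' : Set (GroundAtom S U)) : Prop where
  subset : T ⊆ T'
  closed : ∀ p ∈ W, p.1.Holds f T' → p.2 ∈ T'
  least : ∀ M, T ⊆ M → (∀ p ∈ W, p.1.Stable f T M) → (∀ p ∈ W, p.1.Holds f M → p.2 ∈ M) → T' ⊆ M

/-- The initial state of the propositional solver. -/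
def Sol.start (W : List (GF S U × GroundAtom S U)) (T : Set (GroundAtom S U))
    (L : List (GroundAtom S U)) : Sol S U :=
  ⟨T, ∅, fun _ => [], [.wake (W.map fun p => ([p.1], p.2))], L⟩

/-- The properties of the states that are reached from the initial one. -/
structure Sol.Inv (f : Fin S.numPred → Bool) (W : List (GF S U × GroundAtom S U))
    (T : Set (GroundAtom S U)) (s : Sol S U) : Prop where
  within : s.Within (allTasks W)
  complete : s.Complete f
  started : ∀ p ∈ W, ([p.1], p.2) ∈ s.seen ∨ ([p.1], p.2) ∈ s.pending
  subset : T ⊆ s.facts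
  sound : ∀ M, T ⊆ M → (∀ p ∈ W, p.1.Stable f T M) → (∀ p ∈ W, p.1.Holds f M → p.2 ∈ M) →
    s.Sound f T M
  listed : s.Listed

theorem Sol.Step.inv {f : Fin S.numPred → Bool} {W : List (GF S U × GroundAtom S U)}
    {T : Set (GroundAtom S U)} {s s' : Sol S U} (h : Sol.Step f s s') (hs : s.Inv f W T) :
    s'.Inv f W T where
  within := h.within (closed_allTasks W) hs.within
  complete := h.complete hs.complete
  started p hp := h.mono.2.1 _ (hs.started p hp)
  subset := hs.subset.trans h.mono.1
  sound M h₁ h₂ h₃ := h.sound (hs.sound M h₁ h₂ h₃)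
  listed := h.listed hs.listed

theorem Sol.inv_start (f : Fin S.numPred → Bool) (W : List (GF S U × GroundAtom S U))
    (T : Set (GroundAtom S U)) (L : List (GroundAtom S U)) (hL : L.Nodup)
    (hT : ∀ A, A ∈ L ↔ A ∈ T) : (Sol.start W T L).Inv f W T where
  within := by
    refine ⟨fun t ht => ?_, fun _ _ h => by simp [Sol.start] at h⟩
    simp only [Sol.start, Sol.pending, List.flatMap_cons, Item.tasks, List.flatMap_nil,
      List.append_nil] at ht
    obtain ⟨p, hp, rfl⟩ := List.mem_map.1 ht
    exact mem_allTasks hp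
  complete := fun _ h => h.elim
  started p hp := by
    refine .inr ?_
    simp only [Sol.start, Sol.pending, List.flatMap_cons, Item.tasks, List.flatMap_nil,
      List.append_nil]
    exact List.mem_map_of_mem (f := fun p => ([p.1], p.2)) hp
  subset := subset_rfl
  sound M h₁ h₂ h₃ := by
    refine ⟨subset_rfl, h₁, fun t ht => ?_, fun _ _ _ h => by simp [Sol.start] at h⟩
    simp only [Sol.start, Sol.pending, List.flatMap_cons, Item.tasks, List.flatMap_nil,
      List.append_nil] at ht
    obtain ⟨p, hp, rfl⟩ := List.mem_map.1 ht
    exact ⟨by simpa using h₂ p hp, by simpa using h₃ p hp⟩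
  listed := ⟨hL, hT⟩

theorem Sol.Inv.leastExt {f : Fin S.numPred → Bool} {W : List (GF S U × GroundAtom S U)}
    {T : Set (GroundAtom S U)} {s : Sol S U} (hs : s.Inv f W T) (hi : s.items = []) :
    LeastExt f W T s.facts where
  subset := hs.subset
  closed p hp hg := by
    have hp' : s.pending = [] := by rw [Sol.pending, hi]; rfl
    have h := hs.started p hp
    rw [hp'] at h
    have h' := hs.complete.pop hi p.1 [] p.2 hg (h.resolve_right List.not_mem_nil)
    -- For an empty continuation, `Done` says that the head of the rule is recorded.
    exact hs.complete _ h'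
  least M h₁ h₂ h₃ := (hs.sound M h₁ h₂ h₃).2.1

/-- The unexpanded tasks contribute at most `2 * weight W`, and the initial wake item `1 + 2 *
W.length`. -/
theorem Sol.potential_start [Fintype U] (W : List (GF S U × GroundAtom S U))
    (T : Set (GroundAtom S U)) (L : List (GroundAtom S U)) :
    (Sol.start W T L).potential (allTasks W) ≤ 1 + 4 * weight W := by
  classical
  have h₁ : ((allTasks W).toFinset.filter (· ∉ (Sol.start W T L).seen)).card ≤ weight W := by
    rw [← length_allTasks]
    exact (Finset.card_filter_le _ _).trans (List.toFinset_card_le _)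
  have h₂ := length_le_weight W
  have h₃ : ((Sol.start W T L).items.map Item.cost).sum = 1 + 2 * W.length := by
    simp [Sol.start, Item.cost]
  have h₄ : (∑ A, if A ∈ (Sol.start W T L).facts then 0
      else 2 * ((Sol.start W T L).wait A).length) = 0 :=
    Finset.sum_eq_zero fun A _ => by simp [Sol.start]
  rw [Sol.potential, h₃, h₄]
  omega

end Solver

end LFP

namespace LFP

namespace Solver

open Prog

variable {S : Signature} {U : Type*} {n : ℕ}

/-! ## Simulation of the propositional solver by the machine -/

def Item.code (e : U ≃ Fin n) : Item S U → Val
  | .task t => tagged 17 (t.code e)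
  | .wake ts => tagged 16 (Val.list (ts.map (Task.code e)))

def itemsCode (e : U ≃ Fin n) (I : List (Item S U)) (K : Val) : Val :=
  I.foldr (fun i K => (i.code e).pair K) K

def atomsCode (e : U ≃ Fin n) (L : List (GroundAtom S U)) : Val :=
  Val.list (L.map (GroundAtom.code e))

def seenKey (e : U ≃ Fin n) (tok : Val) (t : Task S U) : Val := tagged 4 (tok.pair (t.code e))

def waitKey (e : U ≃ Fin n) (tok : Val) (A : GroundAtom S U) : Val :=
  tagged 5 (tok.pair (A.code e))

/-- The table records exactly the ground atoms in `T`. -/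
def Records (e : U ≃ Fin n) (tab : Val → Val) (T : Set (GroundAtom S U)) : Prop :=
  ∀ A, (A ∈ T → tab (atomKey e A) = .atom 1) ∧ (A ∉ T → tab (atomKey e A) = .atom 0)

/-- The table has been changed only where the propositional solver is allowed to do so. -/
def Frame (tok : Val) (tab tab' : Val → Val) : Prop :=
  ∀ k, (∀ v, k ≠ tagged 2 v) → (∀ v, k ≠ tagged 4 (tok.pair v)) →
    (∀ v, k ≠ tagged 5 (tok.pair v)) → tab' k = tab k

theorem Frame.trans {tok : Val} {tab tab' tab'' : Val → Val} (h : Frame tok tab tab')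
    (h' : Frame tok tab' tab'') : Frame tok tab tab'' :=
  fun k h₁ h₂ h₃ => (h' k h₁ h₂ h₃).trans (h k h₁ h₂ h₃)

/-- The table represents a state of the propositional solver. -/
structure Repr (e : U ≃ Fin n) (f : Fin S.numPred → Bool) (tok : Val) (s : Sol S U)
    (tab : Val → Val) : Prop where
  records : Records e tab s.facts
  flags : ∀ R, tab (flagKey R) = bit (f R)
  seen : ∀ t, tab (seenKey e tok t) = .atom 1 ↔ t ∈ s.seen
  wait : ∀ A, tab (waitKey e tok A) = Val.list ((s.wait A).map (Task.code e))

section Tables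

variable {e : U ≃ Fin n} {f : Fin S.numPred → Bool} {tok : Val} {s : Sol S U} {tab : Val → Val}

theorem atomKey_injective (e : U ≃ Fin n) : Function.Injective (atomKey (S := S) e) :=
  fun A B h => groundAtom_code_injective e (by simpa [atomKey] using h)

theorem seenKey_injective (e : U ≃ Fin n) (tok : Val) :
    Function.Injective (seenKey (S := S) e tok) :=
  fun A B h => task_code_injective e (by simpa [seenKey] using h)

theorem waitKey_injective (e : U ≃ Fin n) (tok : Val) :
    Function.Injective (waitKey (S := S) e tok) :=
  fun A B h => groundAtom_code_injective e (by simpa [waitKey] using h)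

theorem Repr.mark (h : Repr e f tok s tab) (t : Task S U) (I : List (Item S U)) :
    Repr e f tok ⟨s.facts, insert t s.seen, s.wait, I, s.out⟩
      (Function.update tab (seenKey e tok t) (.atom 1)) where
  records A := by
    rw [Function.update_of_ne (by simp [atomKey, seenKey])]
    exact h.records A
  flags R := by
    rw [Function.update_of_ne (by simp [flagKey, seenKey])]
    exact h.flags R
  seen t' := by
    by_cases ht : t' = t
    · subst ht; simp
    · rw [Function.update_of_ne fun h => ht (seenKey_injective e tok h), h.seen]
      simp [ht]
  wait A := by
    rw [Function.update_of_ne (by simp [waitKey, seenKey])]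
    exact h.wait A

open Classical in
theorem Repr.suspend (h : Repr e f tok s tab) (t : Task S U) (A : GroundAtom S U) :
    Repr e f tok ⟨s.facts, s.seen, Function.update s.wait A (t :: s.wait A), s.items, s.out⟩
      (Function.update tab (waitKey e tok A) ((t.code e).pair (tab (waitKey e tok A)))) where
  records B := by
    rw [Function.update_of_ne (by simp [atomKey, waitKey])]
    exact h.records B
  flags R := by
    rw [Function.update_of_ne (by simp [flagKey, waitKey])]
    exact h.flags R
  seen t' := by
    rw [Function.update_of_ne (by simp [seenKey, waitKey])]
    exact h.seen t'
  wait B := by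
    by_cases hB : B = A
    · subst hB
      simp [h.wait, Val.list]
    · rw [Function.update_of_ne fun h => hB (waitKey_injective e tok h), h.wait]
      simp [hB]

theorem Repr.record (h : Repr e f tok s tab) (B : GroundAtom S U) (I : List (Item S U))
    (L : List (GroundAtom S U)) :
    Repr e f tok ⟨insert B s.facts, s.seen, s.wait, I, L⟩
      (Function.update tab (atomKey e B) (.atom 1)) where
  records A := by
    by_cases hA : A = B
    · subst hA; simp
    · rw [Function.update_of_ne fun h => hA (atomKey_injective e h)]
      simpa [hA] using h.records A
  flags R := by
    rw [Function.update_of_ne (by simp [flagKey, atomKey])]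
    exact h.flags R
  seen t' := by
    rw [Function.update_of_ne (by simp [seenKey, atomKey])]
    exact h.seen t'
  wait A := by
    rw [Function.update_of_ne (by simp [waitKey, atomKey])]
    exact h.wait A

theorem Frame.refl (tok : Val) (tab : Val → Val) : Frame tok tab tab := fun _ _ _ _ => rfl

theorem frame_seen {e : U ≃ Fin n} {tok : Val} {tab : Val → Val} {t : Task S U} {v : Val} :
    Frame tok tab (Function.update tab (seenKey e tok t) v) :=
  fun _ _ h _ => Function.update_of_ne (h _) _ _

theorem frame_wait {e : U ≃ Fin n} {tok : Val} {tab : Val → Val} {A : GroundAtom S U} {v : Val} :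
    Frame tok tab (Function.update tab (waitKey e tok A) v) :=
  fun _ _ _ h => Function.update_of_ne (h _) _ _

theorem frame_atom {e : U ≃ Fin n} {tok : Val} {tab : Val → Val} {A : GroundAtom S U} {v : Val} :
    Frame tok tab (Function.update tab (atomKey e A) v) :=
  fun _ h _ _ => Function.update_of_ne (h _) _ _

end Tables

/-- Each step of the propositional solver is one round of the loop. The sets and functions of its
state are spread over disjoint families of table keys, so the entries written in a round affect only
the intended components. -/
theorem Sol.Step.simulate (e : U ≃ Fin n) {f : Fin S.numPred → Bool} {s s' : Sol S U}
    (hs : Sol.Step f s s') (u K V work tok : Val) (mode : Bool) (tab : Val → Val)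
    (h : Repr e f tok s tab) :
    ∃ tab', Repr e f tok s' tab' ∧ Frame tok tab tab' ∧
      Solver.Step u ⟨itemsCode e s.items K, V, atomsCode e s.out, mode, work, tok, tab⟩
        ⟨itemsCode e s'.items K, V, atomsCode e s'.out, mode, work, tok, tab'⟩ := by
  have hunseen : ∀ t, t ∉ s.seen → tab (seenKey e tok t) ≠ .atom 1 := fun t ht h' =>
    ht ((h.seen t).1 h')
  have hlacks : ∀ A, A ∉ s.facts → tab (atomKey e A) ≠ .atom 1 := fun A hA => by
    rw [(h.records A).2 hA]; simp
  have hflag : ∀ R q, f R ≠ q → tab (flagKey R) ≠ bit q := fun R q hq h' =>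
    hq (bit_injective ((h.flags R).symm.trans h'))
  cases hs
  case wake_nil =>
    exact ⟨tab, ⟨h.1, h.2, h.3, h.4⟩, .refl _ _, step_wake_nil ..⟩
  case wake_cons =>
    exact ⟨tab, ⟨h.1, h.2, h.3, h.4⟩, .refl _ _, step_wake_cons ..⟩
  case visited t ht =>
    exact ⟨tab, ⟨h.1, h.2, h.3, h.4⟩, .refl _ _, step_task_visited (h := (h.seen t).2 ht) ..⟩
  case lit_holds T Z w I o q A k B hZ hf hA =>
    exact ⟨_, h.mark (.lit q A :: k, B) _, frame_seen, step_task_lit_holds (h := hunseen _ hZ)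
      (hf := by rw [← hf]; exact h.flags A.1) (hr := (h.records A).1 hA) ..⟩
  case lit_wait T Z w I o q A k B hZ hf hA =>
    have H := (h.mark (.lit q A :: k, B) I).suspend (k, B) A
    refine ⟨_, H, frame_seen.trans frame_wait, ?_⟩
    -- Marking the task does not change the waiting list, so it may be read from the original table.
    rw [Function.update_of_ne (by simp [waitKey, seenKey])]
    exact step_task_lit_wait (h := hunseen _ hZ)
      (hf := by rw [← hf]; exact h.flags A.1) (hr := hlacks A hA) ..
  case lit_fails T Z w I o q A k B hZ hf hA =>
    exact ⟨_, h.mark (.lit q A :: k, B) _, frame_seen, step_task_lit_fails (h := hunseen _ hZ)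
      (hf := hflag _ _ hf) (hr := (h.records A).1 hA) ..⟩
  case lit_lacks T Z w I o q A k B hZ hf hA =>
    exact ⟨_, h.mark (.lit q A :: k, B) _, frame_seen, step_task_lit_lacks (h := hunseen _ hZ)
      (hf := hflag _ _ hf) (hr := hlacks A hA) ..⟩
  case and T Z w I o c d k B hZ =>
    exact ⟨_, h.mark (.bin false c d :: k, B) _, frame_seen,
      step_task_and (h := hunseen _ hZ) ..⟩
  case or T Z w I o c d k B hZ =>
    exact ⟨_, h.mark (.bin true c d :: k, B) _, frame_seen,
      step_task_or (h := hunseen _ hZ) ..⟩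
  case tru T Z w I o k B hZ =>
    exact ⟨_, h.mark (.unit false :: k, B) _, frame_seen,
      step_task_true (h := hunseen _ hZ) ..⟩
  case fls T Z w I o k B hZ =>
    exact ⟨_, h.mark (.unit true :: k, B) _, frame_seen,
      step_task_false (h := hunseen _ hZ) ..⟩
  case assert_old T Z w I o B hZ hB =>
    exact ⟨_, h.mark ([], B) _, frame_seen,
      step_task_assert_old (h := hunseen _ hZ) (hr := (h.records B).1 hB) ..⟩
  case assert_new T Z w I o B hZ hB =>
    refine ⟨_, (h.mark ([], B) []).record B _ _, frame_seen.trans frame_atom, ?_⟩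
    have H := step_task_assert_new u (itemsCode e I K) V (atomsCode e o) work tok mode tab
      (B.code e) .nil (h := hunseen _ hZ) (hr := hlacks B hB)
    rw [show tab (tagged 5 (tok.pair (B.code e))) = _ from h.wait B] at H
    exact H

/-- The table has not been used with the token `tok`. -/
def Fresh (tab : Val → Val) (tok : Val) : Prop :=
  ∀ v, tab (tagged 4 (tok.pair v)) = .nil ∧ tab (tagged 5 (tok.pair v)) = .nil

/-- Induction on a bound for the potential, which thereby also bounds the rounds. -/
theorem runs_items [Fintype U] (e : U ≃ Fin n) {f : Fin S.numPred → Bool}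
    {W : List (GF S U × GroundAtom S U)} {T : Set (GroundAtom S U)}
    (u K V work tok : Val) (mode : Bool) (N : ℕ) (s : Sol S U) (tab : Val → Val)
    (hN : s.potential (allTasks W) ≤ N) (hs : s.Inv f W T) (h : Repr e f tok s tab) :
    ∃ s' tab', s'.Inv f W T ∧ s'.items = [] ∧ Repr e f tok s' tab' ∧ Frame tok tab tab' ∧
      Runs u N ⟨itemsCode e s.items K, V, atomsCode e s.out, mode, work, tok, tab⟩
        ⟨K, V, atomsCode e s'.out, mode, work, tok, tab'⟩ := by
  induction N generalizing s tab with
  | zero =>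
    by_cases hi : s.items = []
    · refine ⟨s, tab, hs, hi, h, .refl _ _, ?_⟩
      rw [hi]
      exact .refl _ _
    · obtain ⟨s', hs'⟩ := s.exists_step f hi
      have := hs'.potential_lt hs.within
      omega
  | succ N ih =>
    by_cases hi : s.items = []
    · refine ⟨s, tab, hs, hi, h, .refl _ _, ?_⟩
      rw [hi]
      exact .refl _ _
    · obtain ⟨s', hs'⟩ := s.exists_step f hi
      have := hs'.potential_lt hs.within
      obtain ⟨tab', h', hf, hstep⟩ := hs'.simulate e u K V work tok mode tab h
      obtain ⟨s'', tab'', h₁, h₂, h₃, h₄, h₅⟩ := ih s' tab' (by omega) (hs'.inv hs) h'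
      exact ⟨s'', tab'', h₁, h₂, h₃, hf.trans h₄, .step hstep h₅⟩

theorem runs_solve [Fintype U] (e : U ≃ Fin n) (f : Fin S.numPred → Bool)
    (W : List (GF S U × GroundAtom S U)) (T : Set (GroundAtom S U)) (L : List (GroundAtom S U))
    (hL : L.Nodup) (hT : ∀ A, A ∈ L ↔ A ∈ T) (u K V tok : Val) (mode : Bool) (tab : Val → Val)
    (htab : Records e tab T) (hf : ∀ R, tab (flagKey R) = bit (f R)) (htok : Fresh tab tok) :
    ∃ T' L' tab', LeastExt f W T T' ∧ L'.Nodup ∧ (∀ A, A ∈ L' ↔ A ∈ T') ∧ Records e tab' T' ∧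
      Frame tok tab tab' ∧
      Runs u (2 + 4 * weight W)
        ⟨(tagged 15 .nil).pair K, V, atomsCode e L, mode, workCode e W, tok, tab⟩
        ⟨K, V, atomsCode e L', mode, .nil, tok, tab'⟩ := by
  obtain ⟨s', tab', h₁, h₂, h₃, h₄, h₅⟩ := runs_items e (f := f) (W := W) (T := T) u K V .nil tok
    mode (1 + 4 * weight W) (Sol.start W T L) tab (Sol.potential_start W T L)
    -- For a fresh token the default `nil` reads both as "not marked" and as an empty waiting list.
    (Sol.inv_start f W T L hL hT) ⟨htab, hf, fun t => by
      rw [seenKey, (htok _).1]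
      simp [Sol.start], fun A => (htok _).2⟩
  refine ⟨s'.facts, s'.out, tab', h₁.leastExt h₂, h₁.listed.1, h₁.listed.2, h₃.records, h₄, ?_⟩
  have H := (step_solve u K V (atomsCode e L) (workCode e W) tok mode tab).runs
  have hw : itemsCode e (Sol.start W T L).items K = (tagged 16 (workCode e W)).pair K := by
    simp [itemsCode, Sol.start, Item.code, workCode, Function.comp_def, Task.code]
    rfl
  rw [hw] at h₅
  exact (H.trans h₅).mono (by omega)

end Solver

end LFP

namespace LFP

/-! ### Constrains as definitions of complements -/

/-- A constrain as a definition of the complement. -/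
def Constr.toDefn {S : Signature} : Constr S → Defn S
  | .imp R us c => .imp c R us
  | .all x d => .all x d.toDefn
  | .and d d₂ => .and d.toDefn d₂.toDefn

namespace Clause

variable {S : Signature}

/-- Whether the clause is a constrain. -/
def kind : Clause S → Bool
  | .define _ => false
  | .constrain _ => true

def defn : Clause S → Defn S
  | .define d => d
  | .constrain d => d.toDefn

/-- Constrains are encoded with the condition first, as definitions are. So one grounding routine
serves both, and only the bit `kind` distinguishes them. -/
theorem code_eq (cl : Clause S) : cl.code = (Solver.bit cl.kind).pair cl.defn.code := by
  cases cl with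
  | define d => rfl
  | constrain d =>
    have : d.code = d.toDefn.code := by
      induction d with
      | imp => rfl
      | all x d ih => simp [Constr.code, Constr.toDefn, Defn.code, ih]
      | and d d₂ ih ih₂ => simp [Constr.code, Constr.toDefn, Defn.code, ih, ih₂]
    simp [Clause.code, kind, defn, this]

theorem size_eq (cl : Clause S) : cl.size = 1 + cl.defn.size := by
  cases cl with
  | define d => rfl
  | constrain d =>
    have : d.size = d.toDefn.size := by
      induction d with
      | imp => simp only [Constr.size, Constr.toDefn, Defn.size]; omega
      | all x d ih => simp [Constr.size, Constr.toDefn, Defn.size, ih]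
      | and d d₂ ih ih₂ => simp [Constr.size, Constr.toDefn, Defn.size, ih, ih₂]
    simp [Clause.size, defn, this]

theorem depth_eq (cl : Clause S) : cl.depth = cl.defn.depth := by
  cases cl with
  | define d => rfl
  | constrain d =>
    simp only [Clause.depth, defn]
    induction d with
    | imp => rfl
    | all x d ih => simp [Constr.depth, Constr.toDefn, Defn.depth, ih]
    | and d d₂ ih ih₂ => simp [Constr.depth, Constr.toDefn, Defn.depth, ih, ih₂]

theorem free_eq (cl : Clause S) : cl.free = cl.defn.free := by
  cases cl with
  | define d => rfl
  | constrain d =>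
    simp only [Clause.free, defn]
    induction d with
    | imp => simp only [Constr.free, Constr.toDefn, Defn.free, Set.union_comm]
    | all x d ih => simp [Constr.free, Constr.toDefn, Defn.free, ih]
    | and d d₂ ih ih₂ => simp [Constr.free, Constr.toDefn, Defn.free, ih, ih₂]

theorem asserted_eq (cl : Clause S) : cl.asserted = cl.defn.asserted := by
  cases cl with
  | define d => rfl
  | constrain d =>
    simp only [Clause.asserted, defn]
    induction d with
    | imp => rfl
    | all x d ih => simp [Constr.asserted, Constr.toDefn, Defn.asserted, ih]
    | and d d₂ ih ih₂ => simp [Constr.asserted, Constr.toDefn, Defn.asserted, ih, ih₂]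

theorem posUsed_eq (cl : Clause S) : cl.posUsed = cl.defn.posUsed := by
  cases cl with
  | define d => rfl
  | constrain d =>
    simp only [Clause.posUsed, defn]
    induction d with
    | imp => rfl
    | all x d ih => simp [Constr.posUsed, Constr.toDefn, Defn.posUsed, ih]
    | and d d₂ ih ih₂ => simp [Constr.posUsed, Constr.toDefn, Defn.posUsed, ih, ih₂]

theorem negUsed_eq (cl : Clause S) : cl.negUsed = cl.defn.negUsed := by
  cases cl with
  | define d => rfl
  | constrain d =>
    simp only [Clause.negUsed, defn]
    induction d with
    | imp => rfl
    | all x d ih => simp [Constr.negUsed, Constr.toDefn, Defn.negUsed, ih]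
    | and d d₂ ih ih₂ => simp [Constr.negUsed, Constr.toDefn, Defn.negUsed, ih, ih₂]

end Clause

namespace Solver

variable {S : Signature} {U : Type*}

/-! ## The meaning of the ground instances -/

/-- Satisfaction of a definition or (for `m = true`) constrain. -/
def KindSat (m : Bool) (ϱ : Interp S U) (ζ : FnInterp S U) : (ℕ → U) → Defn S → Prop
  | ς, .imp c R us =>
    if m then (fun i => (us i).eval ζ ς) ∈ ϱ R → c.Sat ϱ ς
    else c.Sat ϱ ς → (fun i => (us i).eval ζ ς) ∈ ϱ R
  | ς, .all x d => ∀ a : U, KindSat m ϱ ζ (Function.update ς x a) d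
  | ς, .and d d₂ => KindSat m ϱ ζ ς d ∧ KindSat m ϱ ζ ς d₂

theorem sat_iff_kindSat (ϱ : Interp S U) (ζ : FnInterp S U) (ς : ℕ → U) (cl : Clause S) :
    cl.Sat ϱ ζ ς ↔ KindSat cl.kind ϱ ζ ς cl.defn := by
  cases cl with
  | define d =>
    simp only [Clause.Sat, Clause.kind, Clause.defn]
    induction d generalizing ς with
    | imp => simp [Defn.Sat, KindSat]
    | all x d ih => simp [Defn.Sat, KindSat, ih]
    | and d d₂ ih ih₂ => simp [Defn.Sat, KindSat, ih, ih₂]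
  | constrain d =>
    simp only [Clause.Sat, Clause.kind, Clause.defn]
    induction d generalizing ς with
    | imp => simp [Constr.Sat, KindSat, Constr.toDefn]
    | all x d ih => simp [Constr.Sat, KindSat, Constr.toDefn, ih]
    | and d d₂ ih ih₂ => simp [Constr.Sat, KindSat, Constr.toDefn, ih, ih₂]

/-- The flags `f` and the recorded atoms `M` describe `ϱ R`. -/
def Describes (f : Fin S.numPred → Bool) (M : Set (GroundAtom S U)) (ϱ : Interp S U)
    (R : Fin S.numPred) : Prop :=
  ∀ a, a ∈ ϱ R ↔ if f R then (⟨R, a⟩ : GroundAtom S U) ∉ M else ⟨R, a⟩ ∈ M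

theorem holds_foldl (f : Fin S.numPred → Bool) (M : Set (GroundAtom S U)) (b : Bool)
    (g : U → GF S U) (l : List U) (acc : GF S U) :
    (l.foldl (fun acc a => .bin b (g a) acc) acc).Holds f M ↔
      if b then acc.Holds f M ∨ ∃ a ∈ l, (g a).Holds f M
      else acc.Holds f M ∧ ∀ a ∈ l, (g a).Holds f M := by
  induction l generalizing acc with
  | nil => cases b <;> simp
  | cons a l ih =>
    rw [List.foldl_cons, ih]
    cases b <;> simp [GF.Holds] <;> tauto

/-- Negation by `m` is pushed to the literals by duality. There it meets the complementation
recorded in the flag, and the two cancel if they agree. -/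
theorem holds_ground (f : Fin S.numPred → Bool) (M : Set (GroundAtom S U)) (ϱ : Interp S U)
    (us : List U) (hus : ∀ a, a ∈ us) (m : Bool) (c : Cond S) (ς : ℕ → U)
    (hp : ∀ R ∈ c.posUsed, Describes f M ϱ R) (hn : ∀ R ∈ c.negUsed, Describes f M ϱ R) :
    (ground us m ς c).Holds f M ↔ if m then ¬ c.Sat ϱ ς else c.Sat ϱ ς := by
  induction c generalizing ς with
  | pos R xs =>
    have := hp R rfl fun i => ς (xs i)
    cases m <;> cases hf : f R <;> simp [ground, GF.Holds, Cond.Sat, hf, this]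
  | neg R xs =>
    have := hn R rfl fun i => ς (xs i)
    cases m <;> cases hf : f R <;> simp [ground, GF.Holds, Cond.Sat, hf, this]
  | and c d ihc ihd =>
    have h₁ := ihc ς (fun R hR => hp R (.inl hR)) (fun R hR => hn R (.inl hR))
    have h₂ := ihd ς (fun R hR => hp R (.inr hR)) (fun R hR => hn R (.inr hR))
    cases m <;> simp [ground, GF.Holds, Cond.Sat] at h₁ h₂ ⊢ <;> tauto
  | or c d ihc ihd =>
    have h₁ := ihc ς (fun R hR => hp R (.inl hR)) (fun R hR => hn R (.inl hR))
    have h₂ := ihd ς (fun R hR => hp R (.inr hR)) (fun R hR => hn R (.inr hR))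
    cases m <;> simp [ground, GF.Holds, Cond.Sat] at h₁ h₂ ⊢ <;> tauto
  | ex x c ih =>
    rw [ground, holds_foldl]
    cases m <;> simp [ih _ hp hn, hus, GF.Holds, Cond.Sat]
  | all x c ih =>
    rw [ground, holds_foldl]
    cases m <;> simp [ih _ hp hn, hus, GF.Holds, Cond.Sat]
  | tru => cases m <;> simp [ground, GF.Holds, Cond.Sat]
  | fls => cases m <;> simp [ground, GF.Holds, Cond.Sat]

theorem stable_foldl {f : Fin S.numPred → Bool} {T M : Set (GroundAtom S U)} (b : Bool)
    {g : U → GF S U} (hg : ∀ a, (g a).Stable f T M) (l : List U) {acc : GF S U}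
    (h : acc.Stable f T M) : (l.foldl (fun acc a => .bin b (g a) acc) acc).Stable f T M := by
  induction l generalizing acc with
  | nil => exact h
  | cons a l ih => exact ih ⟨hg a, h⟩

/-- A positive query yields a literal with `q = m`, which demands absence only if the flag differs
from `m`. This exempts the recursive queries, whose predicates have the flag of the current clause.
For negative queries nothing can be exempted. -/
theorem stable_ground {f : Fin S.numPred → Bool} {T M : Set (GroundAtom S U)} (us : List U)
    (m : Bool) (c : Cond S) (ς : ℕ → U)
    (hp : ∀ R ∈ c.posUsed, f R ≠ m → ∀ a, (⟨R, a⟩ : GroundAtom S U) ∈ M → ⟨R, a⟩ ∈ T)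
    (hn : ∀ R ∈ c.negUsed, ∀ a, (⟨R, a⟩ : GroundAtom S U) ∈ M → ⟨R, a⟩ ∈ T) :
    (ground us m ς c).Stable f T M := by
  induction c generalizing ς with
  | pos R xs => exact fun hf => hp R rfl hf _
  | neg R xs => exact fun _ => hn R rfl _
  | and c d ihc ihd =>
    exact ⟨ihd ς (fun R hR => hp R (.inr hR)) (fun R hR => hn R (.inr hR)),
      ihc ς (fun R hR => hp R (.inl hR)) (fun R hR => hn R (.inl hR))⟩
  | or c d ihc ihd =>
    exact ⟨ihd ς (fun R hR => hp R (.inr hR)) (fun R hR => hn R (.inr hR)),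
      ihc ς (fun R hR => hp R (.inl hR)) (fun R hR => hn R (.inl hR))⟩
  | ex x c ih => exact stable_foldl _ (fun a => ih _ hp hn) us trivial
  | all x c ih => exact stable_foldl _ (fun a => ih _ hp hn) us trivial
  | tru => trivial
  | fls => trivial

/-- All instances satisfy `P`. -/
def ForallInst (us : List U) (m : Bool) (ζ : FnInterp S U) (P : GF S U × GroundAtom S U → Prop) :
    (ℕ → U) → Defn S → Prop
  | ς, .imp c R ts => P (ground us m ς c, ⟨R, fun i => (ts i).eval ζ ς⟩)
  | ς, .all x d => ∀ a : U, ForallInst us m ζ P (Function.update ς x a) d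
  | ς, .and d d₂ => ForallInst us m ζ P ς d ∧ ForallInst us m ζ P ς d₂

/-- This replaces the accumulator of `instances` by a structural recursion; later facts about
instances go through it. -/
theorem forall_mem_instances {us : List U} (hus : ∀ a, a ∈ us) {m : Bool} {ζ : FnInterp S U}
    {P : GF S U × GroundAtom S U → Prop} (d : Defn S) (ς : ℕ → U)
    (W : List (GF S U × GroundAtom S U)) :
    (∀ p ∈ instances us m ζ ς d W, P p) ↔ (∀ p ∈ W, P p) ∧ ForallInst us m ζ P ς d := by
  induction d generalizing ς W with
  | imp c R ts => simp only [instances, List.forall_mem_cons, ForallInst, and_comm]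
  | all x d ih =>
    have : ∀ (l : List U) W, (∀ p ∈ l.foldl (fun W a =>
        instances us m ζ (Function.update ς x a) d W) W, P p) ↔
        (∀ p ∈ W, P p) ∧ ∀ a ∈ l, ForallInst us m ζ P (Function.update ς x a) d := by
      intro l
      induction l with
      | nil => simp
      | cons a l ihl =>
        intro W
        rw [List.foldl_cons, ihl, ih, List.forall_mem_cons, and_assoc]
    rw [instances, this]
    simp only [ForallInst, hus, forall_true_left]
  | and d d₂ ih ih₂ => simp only [instances, ih, ih₂, ForallInst, and_assoc]

theorem forallInst_holds {f : Fin S.numPred → Bool} {M : Set (GroundAtom S U)} {ϱ : Interp S U}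
    {us : List U} (hus : ∀ a, a ∈ us) {m : Bool} {ζ : FnInterp S U} (d : Defn S) (ς : ℕ → U)
    (hp : ∀ R ∈ d.posUsed, Describes f M ϱ R) (hn : ∀ R ∈ d.negUsed, Describes f M ϱ R)
    (ha : ∀ R ∈ d.asserted, Describes f M ϱ R) (hf : ∀ R ∈ d.asserted, f R = m) :
    ForallInst us m ζ (fun p => p.1.Holds f M → p.2 ∈ M) ς d ↔ KindSat m ϱ ζ ς d := by
  induction d generalizing ς with
  | imp c R ts =>
    have h₁ := holds_ground f M ϱ us hus m c ς hp hn
    have h₂ := ha R rfl fun i => (ts i).eval ζ ς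
    rw [hf R rfl] at h₂
    simp only [ForallInst, KindSat, h₁]
    -- For `m = true` the rule is the contrapositive of the constrain, as being recorded means
    -- failing.
    cases m <;> simp at h₂ ⊢ <;> tauto
  | all x d ih => simp only [ForallInst, KindSat, ih _ hp hn ha hf]
  | and d d₂ ih ih₂ =>
    simp only [ForallInst, KindSat]
    rw [ih ς (fun R hR => hp R (.inl hR)) (fun R hR => hn R (.inl hR))
        (fun R hR => ha R (.inl hR)) (fun R hR => hf R (.inl hR)),
      ih₂ ς (fun R hR => hp R (.inr hR)) (fun R hR => hn R (.inr hR))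
        (fun R hR => ha R (.inr hR)) (fun R hR => hf R (.inr hR))]

theorem forallInst_stable {f : Fin S.numPred → Bool} {T M : Set (GroundAtom S U)} {us : List U}
    {m : Bool} {ζ : FnInterp S U} (d : Defn S) (ς : ℕ → U)
    (hp : ∀ R ∈ d.posUsed, f R ≠ m → ∀ a, (⟨R, a⟩ : GroundAtom S U) ∈ M → ⟨R, a⟩ ∈ T)
    (hn : ∀ R ∈ d.negUsed, ∀ a, (⟨R, a⟩ : GroundAtom S U) ∈ M → ⟨R, a⟩ ∈ T) :
    ForallInst us m ζ (fun p => p.1.Stable f T M) ς d := by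
  induction d generalizing ς with
  | imp c R ts => exact stable_ground us m c ς hp hn
  | all x d ih => exact fun a => ih _ hp hn
  | and d d₂ ih ih₂ =>
    exact ⟨ih ς (fun R hR => hp R (.inl hR)) (fun R hR => hn R (.inl hR)),
      ih₂ ς (fun R hR => hp R (.inr hR)) (fun R hR => hn R (.inr hR))⟩

theorem forallInst_asserted {us : List U} {m : Bool} {ζ : FnInterp S U} (d : Defn S) (ς : ℕ → U)
    (X : Set (Fin S.numPred)) (hX : d.asserted ⊆ X) :
    ForallInst us m ζ (fun p => p.2.1 ∈ X) ς d := by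
  induction d generalizing ς with
  | imp c R ts => exact hX rfl
  | all x d ih => exact fun a => ih _ hX
  | and d d₂ ih ih₂ =>
    exact ⟨ih ς fun R hR => hX (.inl hR), ih₂ ς fun R hR => hX (.inr hR)⟩

/-- Over an empty universe a quantified clause would have no instances; here each asserted predicate
occurs in some instance, so its flag is really set. -/
theorem forallInst_ne [Nonempty U] {us : List U} {m : Bool} {ζ : FnInterp S U} (d : Defn S)
    (ς : ℕ → U) (R : Fin S.numPred) :
    ForallInst us m ζ (fun p => p.2.1 ≠ R) ς d ↔ R ∉ d.asserted := by
  induction d generalizing ς with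
  | imp c R' ts => simp [ForallInst, Defn.asserted, eq_comm]
  | all x d ih => simp [ForallInst, Defn.asserted, ih]
  | and d d₂ ih ih₂ => simp [ForallInst, Defn.asserted, ih, ih₂]

theorem exists_mem_instances [Nonempty U] {us : List U} (hus : ∀ a, a ∈ us) {m : Bool}
    {ζ : FnInterp S U} (d : Defn S) (ς : ℕ → U) (R : Fin S.numPred) :
    (∃ p ∈ instances us m ζ ς d [], p.2.1 = R) ↔ R ∈ d.asserted := by
  have h := forall_mem_instances hus (m := m) (ζ := ζ) (P := fun p => p.2.1 ≠ R) d ς []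
  rw [forallInst_ne] at h
  simp only [List.not_mem_nil, false_imp_iff, implies_true, true_and] at h
  rw [← not_iff_not, ← h]
  simp only [not_exists, not_and]

end Solver

end LFP

namespace LFP

namespace Solver

variable {S : Signature} {U : Type*} {s : ℕ}

/-! ## The best solution -/

/-- Ranks count layers from 1 and `Fin s` from 0: clause `j` gives rank `j + 1`, so rank at most `i`
excludes the clauses from `i` on. -/
theorem rank_le_iff (cls : Fin s → Clause S) (R : Fin S.numPred) (i : ℕ) :
    rank cls R ≤ i ↔ ∀ j : Fin s, i ≤ j → R ∉ (cls j).asserted := by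
  simp only [rank, Finset.sup_le_iff, Finset.mem_univ, forall_true_left]
  refine forall_congr' fun j => ?_
  split_ifs with h
  · simp only [h, not_true, imp_false]; omega
  · simp [h]

theorem lt_rank {cls : Fin s → Clause S} {R : Fin S.numPred} {j : Fin s}
    (h : R ∈ (cls j).asserted) : (j : ℕ) < rank cls R := by
  by_contra! hj
  exact (rank_le_iff cls R j).1 hj j le_rfl h

theorem rank_le (cls : Fin s → Clause S) (R : Fin S.numPred) : rank cls R ≤ s :=
  (rank_le_iff cls R s).2 fun j hj => absurd j.2 (by omega)

theorem Stratified.eq {cls : Fin s → Clause S} (hs : Stratified cls) {R : Fin S.numPred}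
    {i j : Fin s} (hi : R ∈ (cls i).asserted) (hj : R ∈ (cls j).asserted) : i = j := by
  rcases lt_trichotomy i j with h | h | h
  · exact absurd hj ((hs i).1 R hi j h)
  · exact h
  · exact absurd hi ((hs j).1 R hj i h)

theorem isConstrained_iff (cls : Fin s → Clause S) (R : Fin S.numPred) :
    IsConstrained cls R ↔ ∃ i, (cls i).kind = true ∧ R ∈ (cls i).asserted := by
  constructor
  · rintro ⟨i, d, hi, hR⟩
    exact ⟨i, by rw [hi]; rfl, by rw [hi]; exact hR⟩
  · rintro ⟨i, hk, hR⟩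
    cases hi : cls i with
    | define d => rw [hi] at hk; cases hk
    | constrain d => rw [hi] at hR; exact ⟨i, d, hi, hR⟩

theorem isDefined_iff (cls : Fin s → Clause S) (R : Fin S.numPred) :
    IsDefined cls R ↔ ∃ i, (cls i).kind = false ∧ R ∈ (cls i).asserted := by
  constructor
  · rintro ⟨i, d, hi, hR⟩
    exact ⟨i, by rw [hi]; rfl, by rw [hi]; exact hR⟩
  · rintro ⟨i, hk, hR⟩
    cases hi : cls i with
    | define d => rw [hi] at hR; exact ⟨i, d, hi, hR⟩
    | constrain d => rw [hi] at hk; cases hk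

open Classical in
/-- The predicates constrained by the first `i` clauses. -/
noncomputable def flags (cls : Fin s → Clause S) (i : ℕ) (R : Fin S.numPred) : Bool :=
  decide (∃ j : Fin s, (j : ℕ) < i ∧ (cls j).kind = true ∧ R ∈ (cls j).asserted)

theorem flags_iff (cls : Fin s → Clause S) (i : ℕ) (R : Fin S.numPred) :
    flags cls i R = true ↔
      ∃ j : Fin s, (j : ℕ) < i ∧ (cls j).kind = true ∧ R ∈ (cls j).asserted := by
  simp [flags]

/-- By stratification only one clause asserts `R`, so no clause of the other kind interferes. -/
theorem flags_asserted {cls : Fin s → Clause S} (hs : Stratified cls) {i : Fin s}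
    {R : Fin S.numPred} (hR : R ∈ (cls i).asserted) : flags cls (i + 1) R = (cls i).kind := by
  rw [Bool.eq_iff_iff, flags_iff]
  constructor
  · rintro ⟨j, -, hk, hj⟩
    rwa [Stratified.eq hs hR hj]
  · exact fun hk => ⟨i, by omega, hk, hR⟩

theorem flags_succ {cls : Fin s → Clause S} {i : Fin s} {R : Fin S.numPred}
    (hR : R ∉ (cls i).asserted) : flags cls (i + 1) R = flags cls i R := by
  rw [Bool.eq_iff_iff, flags_iff, flags_iff]
  refine exists_congr fun j => and_congr_left fun ⟨_, hj⟩ => ?_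
  have : j ≠ i := by rintro rfl; exact hR hj
  have : (j : ℕ) ≠ i := fun h => this (Fin.ext h)
  omega

/-- The layers of the solution: `T i` is the set of the ground atoms that are recorded after the
first `i` clauses. -/
structure Layers (cls : Fin s → Clause S) (ζ : FnInterp S U) (ς : ℕ → U) (us : List U)
    (T : ℕ → Set (GroundAtom S U)) (k : ℕ) : Prop where
  layer : ∀ i : Fin s, (i : ℕ) < k → LeastExt (flags cls (i + 1))
    (instances us (cls i).kind ζ ς (cls i).defn []) (T i) (T (i + 1))

/-- The interpretation described by the recorded ground atoms. -/
def solution (cls : Fin s → Clause S) (T : Set (GroundAtom S U)) : Interp S U :=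
  fun R => {a | (¬ IsConstrained cls R ∧ (⟨R, a⟩ : GroundAtom S U) ∈ T) ∨
    (IsConstrained cls R ∧ (⟨R, a⟩ : GroundAtom S U) ∉ T)}

theorem recorded_solution (cls : Fin s → Clause S) (T : Set (GroundAtom S U))
    (A : GroundAtom S U) : Recorded cls (solution cls T) A ↔ A ∈ T := by
  obtain ⟨R, a⟩ := A
  simp only [Recorded, solution, Set.mem_ofPred_eq]
  tauto

/-- The recorded ground atoms of an interpretation. -/
def recordedSet (cls : Fin s → Clause S) (ϱ : Interp S U) : Set (GroundAtom S U) :=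
  {A | Recorded cls ϱ A}

section

variable {cls : Fin s → Clause S} {ζ : FnInterp S U} {ς : ℕ → U} {us : List U}
  {T : ℕ → Set (GroundAtom S U)}

theorem flags_eq {i : Fin s} {R : Fin S.numPred} (h : ∀ j, i < j → R ∉ (cls j).asserted) :
    flags cls (i + 1) R = true ↔ IsConstrained cls R := by
  rw [flags_iff, isConstrained_iff]
  refine exists_congr fun j => ⟨And.right, fun hj => ⟨?_, hj⟩⟩
  by_contra! hij
  exact h j (by rw [Fin.lt_def]; omega) hj.2

theorem describes_recordedSet (ϱ : Interp S U) {i : Fin s} {R : Fin S.numPred}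
    (h : ∀ j, i < j → R ∉ (cls j).asserted) :
    Describes (flags cls (i + 1)) (recordedSet cls ϱ) ϱ R := by
  intro a
  have := flags_eq h
  simp only [recordedSet, Recorded, Set.mem_ofPred_eq]
  split_ifs with hf <;> tauto

/-- Stratification ensures that all predicates of clause `i` have their final flags after it, so
describing `ϱ` correctly at these predicates suffices. -/
theorem sat_iff_closed (hs : Stratified cls) (hus : ∀ a, a ∈ us) (i : Fin s)
    {M : Set (GroundAtom S U)} {ϱ : Interp S U}
    (h : ∀ R, (∀ j, i < j → R ∉ (cls j).asserted) → Describes (flags cls (i + 1)) M ϱ R) :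
    (cls i).Sat ϱ ζ ς ↔ ∀ p ∈ instances us (cls i).kind ζ ς (cls i).defn [],
      p.1.Holds (flags cls (i + 1)) M → p.2 ∈ M := by
  obtain ⟨h₁, h₂, h₃⟩ := hs i
  rw [Clause.asserted_eq] at h₁
  rw [Clause.posUsed_eq] at h₂
  rw [Clause.negUsed_eq] at h₃
  rw [sat_iff_kindSat, forall_mem_instances hus, forallInst_holds (ϱ := ϱ) hus]
  · simp
  · exact fun R hR => h R (h₂ R hR)
  · exact fun R hR => h R fun j hj => h₃ R hR j hj.le
  · exact fun R hR => h R (h₁ R hR)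
  · exact fun R hR => flags_asserted hs (by rwa [Clause.asserted_eq])

/-- A literal that demands absence belongs to a predicate asserted neither here nor later: a
positively queried one asserted here has the flag of this clause, and negatively queried ones are
excluded by stratification. -/
theorem stable_instances (hs : Stratified cls) (hus : ∀ a, a ∈ us) (i : Fin s)
    {T M : Set (GroundAtom S U)}
    (h : ∀ R, (∀ j, i ≤ j → R ∉ (cls j).asserted) →
      ∀ a, (⟨R, a⟩ : GroundAtom S U) ∈ M → ⟨R, a⟩ ∈ T) :
    ∀ p ∈ instances us (cls i).kind ζ ς (cls i).defn [],
      p.1.Stable (flags cls (i + 1)) T M := by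
  obtain ⟨h₁, h₂, h₃⟩ := hs i
  rw [Clause.posUsed_eq] at h₂
  rw [Clause.negUsed_eq] at h₃
  rw [forall_mem_instances hus]
  refine ⟨by simp, forallInst_stable _ _ (fun R hR hf => h R fun j hj hRj => ?_)
    fun R hR => h R (h₃ R hR)⟩
  rcases hj.lt_or_eq with hj | rfl
  · exact h₂ R hR j hj hRj
  · exact hf (flags_asserted hs hRj)

/-- Leastness is compared with `T i` enlarged by all atoms of the asserted predicates. This set is
trivially closed, and it is stable because absence is demanded only for other predicates. -/
theorem Layers.subset_union (hT : Layers cls ζ ς us T s) (hs : Stratified cls)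
    (hus : ∀ a, a ∈ us) (i : Fin s) :
    T (i + 1) ⊆ T i ∪ {A | A.1 ∈ (cls i).asserted} := by
  refine (hT.layer i i.2).least _ Set.subset_union_left ?_ ?_
  · refine stable_instances hs hus i fun R hR a ha => ha.resolve_right (hR i le_rfl)
  · have : ∀ p ∈ instances us (cls i).kind ζ ς (cls i).defn [], p.2.1 ∈ (cls i).asserted := by
      rw [forall_mem_instances hus, Clause.asserted_eq]
      exact ⟨by simp, forallInst_asserted _ _ _ subset_rfl⟩
    exact fun p hp _ => .inr (this p hp)

theorem Layers.mono (hT : Layers cls ζ ς us T s) {i k : ℕ} (hik : i ≤ k) (hk : k ≤ s) :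
    T i ⊆ T k := by
  induction k, hik using Nat.le_induction with
  | base => exact subset_rfl
  | succ k hik ih => exact (ih (by omega)).trans (hT.layer ⟨k, hk⟩ hk).subset

theorem Layers.mem_of_mem (hT : Layers cls ζ ς us T s) (hs : Stratified cls) (hus : ∀ a, a ∈ us)
    {i k : ℕ} (hik : i ≤ k) (hk : k ≤ s) {A : GroundAtom S U}
    (hA : ∀ j : Fin s, i ≤ j → A.1 ∉ (cls j).asserted) (h : A ∈ T k) : A ∈ T i := by
  induction k, hik using Nat.le_induction with
  | base => exact h
  | succ k hik ih =>
    exact ih (by omega) ((hT.subset_union hs hus ⟨k, hk⟩ h).resolve_right (hA ⟨k, hk⟩ hik))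

theorem Layers.rank_le_of_mem (hT : Layers cls ζ ς us T s) (hs : Stratified cls)
    (hus : ∀ a, a ∈ us) (h₀ : ∀ A ∈ T 0, rank cls A.1 = 0) {i : ℕ} (hi : i ≤ s)
    {A : GroundAtom S U} (h : A ∈ T i) : rank cls A.1 ≤ i := by
  induction i with
  | zero => exact (h₀ A h).le
  | succ i ih =>
    rcases hT.subset_union hs hus ⟨i, hi⟩ h with h | h
    · exact (ih (by omega) h).trans (by omega)
    · refine (rank_le_iff cls _ _).2 fun j hj hAj => ?_
      have := Stratified.eq hs h hAj
      rw [← this] at hj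
      simp at hj

theorem recordedSet_solution (cls : Fin s → Clause S) (M : Set (GroundAtom S U)) :
    recordedSet cls (solution cls M) = M :=
  Set.ext (recorded_solution cls M)

/-- Later layers do not touch these predicates, so `T (i + 1)` and `T s` agree on them. -/
theorem Layers.describes (hT : Layers cls ζ ς us T s) (hs : Stratified cls) (hus : ∀ a, a ∈ us)
    (i : Fin s) (R : Fin S.numPred) (h : ∀ j, i < j → R ∉ (cls j).asserted) :
    Describes (flags cls (i + 1)) (T (i + 1)) (solution cls (T s)) R := by
  intro a
  have h' := describes_recordedSet (solution cls (T s)) h a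
  rw [recordedSet_solution] at h'
  have : (⟨R, a⟩ : GroundAtom S U) ∈ T (i + 1) ↔ ⟨R, a⟩ ∈ T s :=
    ⟨fun h => hT.mono (by omega) le_rfl h, fun hA =>
      hT.mem_of_mem hs hus (by omega) le_rfl (fun j hj => h j (by rw [Fin.lt_def]; omega)) hA⟩
  rw [h', this]

theorem Layers.mem_models (hT : Layers cls ζ ς us T s) (hs : Stratified cls) (hus : ∀ a, a ∈ us)
    {ϱ₀ : Interp S U} (h₀ : ∀ A, A ∈ T 0 ↔ rank cls A.1 = 0 ∧ A.2 ∈ ϱ₀ A.1) :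
    solution cls (T s) ∈ models cls ζ ς ϱ₀ := by
  refine ⟨fun i => ?_, fun R hR a ha => .inl ⟨?_, ?_⟩⟩
  · rw [sat_iff_closed hs hus i (hT.describes hs hus i)]
    exact (hT.layer i i.2).closed
  · rw [isConstrained_iff]
    rintro ⟨i, -, hi⟩
    have := lt_rank hi
    omega
  · exact hT.mono (Nat.zero_le _) le_rfl ((h₀ ⟨R, a⟩).2 ⟨hR, ha⟩)

theorem Layers.lexLE (hT : Layers cls ζ ς us T s) (hs : Stratified cls) (hus : ∀ a, a ∈ us)
    {ϱ₀ : Interp S U} (h₀ : ∀ A, A ∈ T 0 ↔ rank cls A.1 = 0 ∧ A.2 ∈ ϱ₀ A.1)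
    {ϱ : Interp S U} (hϱ : ϱ ∈ models cls ζ ς ϱ₀) : LexLE cls (solution cls (T s)) ϱ := by
  classical
  by_cases heq : ∀ R, solution cls (T s) R = ϱ R
  -- Equal interpretations are compared at `j = s`, the only place where no strict difference is
  -- required.
  · exact ⟨s, le_rfl, fun R _ => heq R, fun R _ _ => (heq R).subset,
      fun R _ _ => (heq R).symm.subset, .inl rfl⟩
  push Not at heq
  have hex : ∃ j, ∃ R, rank cls R = j ∧ solution cls (T s) R ≠ ϱ R := by
    obtain ⟨R, hR⟩ := heq
    exact ⟨_, R, rfl, hR⟩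
  have hbelow : ∀ R, rank cls R < Nat.find hex → solution cls (T s) R = ϱ R := fun R hR => by
    by_contra hne
    exact Nat.find_min hex hR ⟨R, rfl, hne⟩
  obtain ⟨R₀, hR₀, hne⟩ := Nat.find_spec hex
  set j := Nat.find hex
  have hj : j ≤ s := hR₀ ▸ rank_le cls R₀
  -- the recorded atoms of the solution with rank `j` are recorded in `ϱ`
  have key : ∀ A : GroundAtom S U, rank cls A.1 = j → A ∈ T s → A ∈ recordedSet cls ϱ := by
    intro A hA hAs
    have hbelow' : ∀ B : GroundAtom S U, rank cls B.1 < j →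
        (B ∈ recordedSet cls ϱ ↔ B ∈ T s) := fun B hB => by
      rw [← recorded_solution cls (T s)]
      simp only [recordedSet, Set.mem_ofPred_eq, Recorded, hbelow B.1 hB]
    have hAj : A ∈ T j := hT.mem_of_mem hs hus hj le_rfl ((rank_le_iff cls _ _).1 hA.le) hAs
    rcases Nat.eq_zero_or_pos j with hj0 | hj0
    · rw [hj0] at hAj hA
      refine .inl ⟨?_, hϱ.2 A.1 hA ((h₀ A).1 hAj).2⟩
      rw [isConstrained_iff]
      rintro ⟨i, -, hi⟩
      have := lt_rank hi
      omega
    · obtain ⟨i, hi⟩ : ∃ i : Fin s, (i : ℕ) + 1 = j := ⟨⟨j - 1, by omega⟩, by simp; omega⟩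
      rw [← hi] at hAj
      -- Layer `i` is the one of rank `j`. The recorded atoms of `ϱ` contain `T i` by agreement
      -- below `j`, are stable for the same reason, and are closed because `ϱ` satisfies the clause.
      refine (hT.layer i i.2).least (recordedSet cls ϱ) ?_ ?_ ?_ hAj
      · intro B hB
        have := hT.rank_le_of_mem hs hus (fun A hA => ((h₀ A).1 hA).1) i.2.le hB
        exact (hbelow' B (by omega)).2 (hT.mono i.2.le le_rfl hB)
      · refine stable_instances hs hus i fun R hR a ha => ?_
        have := (rank_le_iff cls R i).2 hR
        exact hT.mem_of_mem hs hus i.2.le le_rfl hR ((hbelow' ⟨R, a⟩ (by simp only; omega)).1 ha)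
      · exact (sat_iff_closed hs hus i fun R hR => describes_recordedSet ϱ hR).1 (hϱ.1 i)
  refine ⟨j, hj, hbelow, fun R hR hd a ha => ?_, fun R hR hc a ha => ?_, .inr ⟨R₀, hR₀, hne⟩⟩
  · have hnc : ¬ IsConstrained cls R := by
      rw [isConstrained_iff]
      rintro ⟨i, hk, hi⟩
      rcases hd with h0 | hd
      · have := lt_rank hi
        omega
      · obtain ⟨i', hk', hi'⟩ := (isDefined_iff cls R).1 hd
        rw [Stratified.eq hs hi hi', hk'] at hk
        cases hk
    have h := ha.resolve_right fun h => hnc h.1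
    exact ((key ⟨R, a⟩ hR h.2).resolve_right fun h => hnc h.1).2
  · refine .inr ⟨hc, fun hA => ?_⟩
    exact ((key ⟨R, a⟩ hR hA).resolve_left fun h => h.1 hc).2 ha

theorem Layers.isBestSolution (hT : Layers cls ζ ς us T s) (hs : Stratified cls)
    (hus : ∀ a, a ∈ us) {ϱ₀ : Interp S U}
    (h₀ : ∀ A, A ∈ T 0 ↔ rank cls A.1 = 0 ∧ A.2 ∈ ϱ₀ A.1) :
    IsBestSolution cls ζ ς ϱ₀ (solution cls (T s)) :=
  ⟨hT.mem_models hs hus h₀, fun _ hϱ => hT.lexLE hs hus h₀ hϱ⟩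

end

end Solver

end LFP

namespace LFP

namespace Solver

open Prog

variable {S : Signature} {U : Type*} {n s : ℕ}

/-! ## The layers on the machine -/

/-- The clauses from number `j` on (counted from `0`) as a value. -/
def restCode (cls : Fin s → Clause S) (j : ℕ) : Val :=
  Val.list ((List.ofFn fun i => (cls i).code).drop j)

theorem restCode_lt (cls : Fin s → Clause S) (i : Fin s) :
    restCode cls i = (cls i).code.pair (restCode cls (i + 1)) := by
  rw [restCode, List.drop_eq_getElem_cons (by simp), List.getElem_ofFn]
  rfl

theorem restCode_self (cls : Fin s → Clause S) : restCode cls s = .nil := by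
  rw [restCode, List.drop_of_length_le (by simp)]
  rfl

/-- Suffixes of different lengths are different, even if clauses repeat. So the remaining clauses
serve as a token for the layer without any counter. -/
theorem restCode_ne (cls : Fin s → Clause S) {i j : ℕ} (hij : i < j) (hj : j ≤ s) :
    restCode cls i ≠ restCode cls j := fun h => by
  have := congrArg List.length (list_injective h)
  simp only [List.length_drop, List.length_ofFn] at this
  omega

/-- The situation of the machine before clause number `i` (counted from `0`). -/
structure Stage (e : U ≃ Fin n) (cls : Fin s → Clause S) (ζ : FnInterp S U) (ς : ℕ → U)
    (T : Set (GroundAtom S U)) (L : List (GroundAtom S U)) (tab : Val → Val) (i : ℕ) : Prop where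
  nodup : L.Nodup
  mem : ∀ A, A ∈ L ↔ A ∈ T
  records : Records e tab T
  flags : ∀ R, tab (flagKey R) = bit (flags cls i R)
  fn : FnOK e tab ζ
  env : EnvOK e tab ς {x | ∃ i, x ∈ (cls i).free}
  fresh : ∀ j, i < j → j ≤ s → Fresh tab (restCode cls j)

/-- The factor is `13 = 5 + 4 * 2`: 5 for grounding, and 4 rounds per unit of weight, which is at
most twice size times power. The symbol `define` or `constrain` itself pays for the remaining
constant. -/
theorem runs_layer [Fintype U] [Nonempty U] (e : U ≃ Fin n) {cls : Fin s → Clause S}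
    (hs : Stratified cls) {ζ : FnInterp S U} {ς : ℕ → U} {us : List U} (hus : ∀ a, a ∈ us)
    (i : Fin s) {T : Set (GroundAtom S U)} {L : List (GroundAtom S U)} {tab : Val → Val}
    (h : Stage e cls ζ ς T L tab i) (K V tok : Val) (mode : Bool) :
    ∃ T' L' tab', LeastExt (Solver.flags cls (i + 1))
        (instances us (cls i).kind ζ ς (cls i).defn []) T T' ∧
      Stage e cls ζ ς T' L' tab' (i + 1) ∧
      Runs (univCode e us) (13 * ((cls i).size * us.length ^ (cls i).depth))
        ⟨(tagged 14 (restCode cls i)).pair K, V, atomsCode e L, mode, .nil, tok, tab⟩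
        ⟨(tagged 14 (restCode cls (i + 1))).pair K, V, atomsCode e L', (cls i).kind, .nil,
          restCode cls (i + 1), tab'⟩ := by
  have hlen : 1 ≤ us.length := List.length_pos_of_mem (hus (Classical.arbitrary U))
  set W := instances us (cls i).kind ζ ς (cls i).defn [] with hW
  set tab₁ := flagged (cls i).kind W tab with htab₁
  have hflag : ∀ k : Val, (∀ R : Fin S.numPred, k ≠ flagKey R) → tab₁ k = tab k := fun k hk => by
    rw [htab₁, flagged, if_neg]
    rintro ⟨p, -, hp⟩
    exact hk _ hp
  have hflags : ∀ R, tab₁ (flagKey R) = bit (Solver.flags cls (i + 1) R) := fun R => by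
    have hR := exists_mem_instances hus (m := (cls i).kind) (ζ := ζ) (cls i).defn ς R
    have hk : (∃ p ∈ W, flagKey R = flagKey p.2.1) ↔ R ∈ (cls i).asserted := by
      rw [Clause.asserted_eq, ← hR]
      refine exists_congr fun p => and_congr_right fun _ => ?_
      simp only [flagKey, Val.pair.injEq, Val.atom.injEq, true_and, Fin.val_inj]
      exact eq_comm
    rw [htab₁, flagged]
    split_ifs with h'
    · rw [flags_asserted hs (hk.1 h')]
    · rw [flags_succ fun h => h' (hk.2 h), h.flags]
  have hfresh : ∀ j, (i : ℕ) < j → j ≤ s → Fresh tab₁ (restCode cls j) := fun j hj hjs v => by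
    rw [hflag _ (by simp [flagKey]), hflag _ (by simp [flagKey])]
    exact h.fresh j hj hjs v
  obtain ⟨T', L', tab', h₁, h₂, h₃, h₄, h₅, h₆⟩ := runs_solve e (Solver.flags cls (i + 1)) W T L
    h.nodup h.mem (univCode e us) ((tagged 14 (restCode cls (i + 1))).pair K) V
    (restCode cls (i + 1)) (cls i).kind tab₁
    (fun A => by rw [hflag _ (by simp [flagKey, atomKey])]; exact h.records A) hflags
    (hfresh (i + 1) (by omega) i.2)
  refine ⟨T', L', tab', h₁, ⟨h₂, h₃, h₄, fun R => ?_, fun p => ?_, fun x hx => ?_,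
    fun j hj hjs v => ?_⟩, ?_⟩
  · rw [h₅ _ (by simp [flagKey]) (by simp [flagKey]) (by simp [flagKey]), hflags]
  · rw [h₅ _ (by simp [fnKey]) (by simp [fnKey]) (by simp [fnKey]),
      hflag _ (by simp [flagKey, fnKey]), h.fn]
  · rw [h₅ _ (by simp [varKey]) (by simp [varKey]) (by simp [varKey]),
      hflag _ (by simp [flagKey, varKey]), h.env x hx]
  -- Solving the layer writes marks and waiting lists only under its own token, so later tokens stay
  -- fresh.
  · have hne := restCode_ne cls hj hjs
    have := hfresh j (by omega) hjs v
    rw [h₅ _ (by simp) (by simp [hne.symm]) (by simp), h₅ _ (by simp) (by simp) (by simp [hne.symm])]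
    exact this
  · have H₁ := (step_layer_cons (univCode e us) K V (atomsCode e L) .nil tok mode tab (cls i).kind
      (cls i).defn.code (restCode cls (i + 1))).runs
    rw [← Clause.code_eq, ← restCode_lt] at H₁
    have H₂ := runs_instances e us (atomsCode e L) (restCode cls (i + 1)) (cls i).kind hlen ζ
      (cls i).defn ς tab h.fn (h.env.mono fun x hx => ⟨i, by rwa [Clause.free_eq]⟩) []
      ((tagged 15 .nil).pair ((tagged 14 (restCode cls (i + 1))).pair K)) V
    rw [flagged_nil] at H₂
    refine (H₁.trans (H₂.trans h₆)).mono ?_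
    have hw := weight_instances us hlen (cls i).kind ζ (cls i).defn ς []
    rw [← hW] at hw
    have hp : 1 ≤ us.length ^ (cls i).defn.depth := Nat.one_le_pow _ _ hlen
    rw [Clause.size_eq, Clause.depth_eq]
    simp only [weight, List.map_nil, List.sum_nil] at hw ⊢
    simp only [Nat.add_mul, Nat.mul_assoc, one_mul] at hw ⊢
    omega

/-- The cost of a clause, up to a constant factor. -/
def layerCost (cls : Fin s → Clause S) (n i : ℕ) : ℕ :=
  if h : i < s then (cls ⟨i, h⟩).size * n ^ (cls ⟨i, h⟩).depth else 0

theorem runs_layers [Fintype U] [Nonempty U] (e : U ≃ Fin n) {cls : Fin s → Clause S}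
    (hs : Stratified cls) {ζ : FnInterp S U} {ς : ℕ → U} {us : List U} (hus : ∀ a, a ∈ us)
    {T₀ : Set (GroundAtom S U)} {L : List (GroundAtom S U)} {tab : Val → Val}
    (h : Stage e cls ζ ς T₀ L tab 0) (K V tok : Val) (mode : Bool) (k : ℕ) (hk : k ≤ s) :
    ∃ T L' tab' tok' mode', T 0 = T₀ ∧ Layers cls ζ ς us T k ∧
      Stage e cls ζ ς (T k) L' tab' k ∧
      Runs (univCode e us) (13 * ∑ i ∈ Finset.range k, layerCost cls us.length i)
        ⟨(tagged 14 (restCode cls 0)).pair K, V, atomsCode e L, mode, .nil, tok, tab⟩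
        ⟨(tagged 14 (restCode cls k)).pair K, V, atomsCode e L', mode', .nil, tok', tab'⟩ := by
  induction k with
  | zero =>
    exact ⟨fun _ => T₀, L, tab, tok, mode, rfl, ⟨fun i hi => absurd hi (by omega)⟩, h, .refl _ _⟩
  | succ k ih =>
    obtain ⟨T, L', tab', tok', mode', h₀, h₁, h₂, h₃⟩ := ih (by omega)
    obtain ⟨T', L'', tab'', h₄, h₅, h₆⟩ := runs_layer e hs hus ⟨k, hk⟩ h₂ K V tok' mode'
    refine ⟨Function.update T (k + 1) T', L'', tab'', _, _, ?_, ⟨fun i hi => ?_⟩, ?_,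
      (h₃.trans h₆).mono ?_⟩
    · rw [Function.update_of_ne (by omega), h₀]
    · rw [Function.update_of_ne (by omega)]
      rcases Nat.lt_succ_iff_lt_or_eq.1 hi with hi | hi
      · rw [Function.update_of_ne (by omega)]
        exact h₁.layer i hi
      · obtain rfl : i = ⟨k, hk⟩ := Fin.ext hi
        rw [Function.update_self]
        exact h₄
    · rw [Function.update_self]
      exact h₅
    · rw [Finset.sum_range_succ, layerCost, dif_pos (show k < s from hk), Nat.mul_add]

/-! ## The given facts -/

theorem runs_facts (e : U ≃ Fin n) (u K V out work tok : Val) (mode : Bool)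
    (L : List (GroundAtom S U)) (tab : Val → Val) :
    ∃ tab', (∀ k, (∀ v, k ≠ tagged 2 v) → tab' k = tab k) ∧
      (∀ A ∈ L, tab' (atomKey e A) = .atom 1) ∧
      (∀ A ∉ L, tab' (atomKey e A) = tab (atomKey e A)) ∧
      Runs u (1 + L.length) ⟨(tagged 18 (atomsCode e L)).pair K, V, out, mode, work, tok, tab⟩
        ⟨K, V, out, mode, work, tok, tab'⟩ := by
  induction L generalizing tab with
  | nil =>
    exact ⟨tab, fun _ _ => rfl, by simp, fun _ _ => rfl, (step_facts_nil ..).runs⟩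
  | cons B L ih =>
    obtain ⟨tab', h₁, h₂, h₃, h₄⟩ := ih (Function.update tab (atomKey e B) (.atom 1))
    refine ⟨tab', fun k hk => ?_, fun A hA => ?_, fun A hA => ?_,
      ((step_facts_cons ..).runs.trans h₄).mono ?_⟩
    · rw [h₁ k hk]
      exact Function.update_of_ne (hk _) _ _
    · by_cases hAL : A ∈ L
      · exact h₂ A hAL
      · obtain rfl := (List.mem_cons.1 hA).resolve_right hAL
        rw [h₃ _ hAL, Function.update_self]
    · rw [List.mem_cons, not_or] at hA
      rw [h₃ A hA.2, Function.update_of_ne fun h => hA.1 (atomKey_injective e h)]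
    · simp only [List.length_cons]; omega

theorem length_le_factCount [Fintype U] (cls : Fin s → Clause S) (ϱ₀ : Interp S U)
    (L : List (GroundAtom S U)) (hL : L.Nodup)
    (h : ∀ A : GroundAtom S U, A ∈ L ↔ rank cls A.1 = 0 ∧ A.2 ∈ ϱ₀ A.1) :
    L.length ≤ factCount cls ϱ₀ := by
  classical
  have : L.toFinset = Finset.univ.sigma fun R =>
      if rank cls R = 0 then (ϱ₀ R).toFinset else ∅ := by
    ext A
    simp only [List.mem_toFinset, h, Finset.mem_sigma, Finset.mem_univ, true_and]
    split_ifs with h' <;> simp [h']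
  rw [← List.toFinset_card_of_nodup hL, this, Finset.card_sigma, factCount]
  refine Finset.sum_le_sum fun R _ => ?_
  split_ifs
  · rw [Set.ncard_eq_toFinset_card']
  · simp

theorem fnKey_injective (e : U ≃ Fin n) : Function.Injective (fnKey (S := S) e) := by
  rintro ⟨R, a⟩ ⟨R', a'⟩ h
  simp only [fnKey, Val.tuple, Val.pair.injEq, Val.atom.injEq, true_and] at h
  obtain rfl : R = R' := Fin.ext h.1
  have := List.ofFn_injective (list_injective h.2)
  congr 1
  funext i
  have := congrFun this i
  simpa [elemCode, Fin.val_inj] using this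

/-! ### The initial state and the total time -/

section Initial

variable (e : U ≃ Fin n) (cls : Fin s → Clause S) (ζ : FnInterp S U) (ς : ℕ → U)
  (L : List (GroundAtom S U))

theorem initialState_tab : (initialState e cls ζ ς L).tab =
    Function.extend (fnKey (S := S) e) (fun p => elemCode e (ζ p.1 p.2))
      (Function.extend (fun x : {x : ℕ // ∃ i, x ∈ (cls i).free} => varKey x)
        (fun x => elemCode e (ς x)) fun _ => .nil) := rfl

theorem initialState_fn : FnOK e (initialState e cls ζ ς L).tab ζ := fun p => by
  rw [initialState_tab, (fnKey_injective e).extend_apply]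

theorem initialState_env :
    EnvOK e (initialState e cls ζ ς L).tab ς {x | ∃ i, x ∈ (cls i).free} := fun x hx => by
  rw [initialState_tab, Function.extend_apply' _ _ _ (by rintro ⟨p, hp⟩; simp [fnKey, varKey] at hp)]
  exact (varKey_injective.comp Subtype.val_injective).extend_apply
    (fun x : {x : ℕ // ∃ i, x ∈ (cls i).free} => elemCode e (ς x)) _ ⟨x, hx⟩

/-- The input occupies only the keys with tags 0 and 1, so all tables of the solver start empty. -/
theorem initialState_nil (k : ℕ) (hk : 2 ≤ k) (v : Val) :
    (initialState e cls ζ ς L).tab (tagged k v) = .nil := by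
  rw [initialState_tab, Function.extend_apply' _ _ _ ?_, Function.extend_apply' _ _ _ ?_]
  · rintro ⟨x, hx⟩
    simp only [varKey, Val.pair.injEq, Val.atom.injEq] at hx
    omega
  · rintro ⟨p, hp⟩
    simp only [fnKey, Val.pair.injEq, Val.atom.injEq] at hp
    omega

theorem run_prologue : prologue.run (initialState e cls ζ ς L) =
    conc (univCode e (List.ofFn e.symm))
      ⟨(tagged 18 (atomsCode e L)).pair ((tagged 14 (restCode cls 0)).pair .nil), .nil,
        atomsCode e L, false, .nil, .nil, (initialState e cls ζ ς L).tab⟩ := by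
  simp only [prologue, run, conc, State.mk.injEq, and_true]
  funext r
  by_cases h8 : r = 8
  · subst h8; rfl
  rw [Function.update_of_ne h8]
  by_cases h0 : r = 0
  · subst h0; rfl
  rw [Function.update_of_ne h0]
  by_cases h3 : r = 3
  · subst h3; rfl
  rw [Function.update_of_ne h3]
  by_cases h1 : r = 1
  · subst h1
    simp [initialState, univCode, Val.tuple, List.map_ofFn, Function.comp_def]
  by_cases h2 : r = 2
  · subst h2; rfl
  obtain ⟨r, rfl⟩ : ∃ r', r = r' + 4 := ⟨r - 4, by omega⟩
  obtain _ | _ | _ | _ | _ | r := r <;> first | rfl | contradiction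

end Initial

/-- `P` and `E` are the costs of prologue and epilogue, `B` that of a round with its test. The
rounds are `1 + l` for the facts, `13 * N` for the layers and 1 for the exhausted list of clauses,
together at most `13 * (F + N + 1)`. -/
theorem time_bound {P E B l F N t t₁ t₂ : ℕ} (h₁ : t₁ ≤ P) (h₂ : t₂ ≤ E)
    (h : t ≤ B * (1 + l + (13 * N + 1)) + 3) (hl : l ≤ F) :
    t₁ + (t + t₂) ≤ (P + E + 3 + B * 13) * (F + N + 1) := by
  have h₃ : B * (1 + l + (13 * N + 1)) ≤ B * 13 * (F + N + 1) := by
    rw [Nat.mul_assoc]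
    exact Nat.mul_le_mul_left B (by omega)
  have h₄ : P + E + 3 ≤ (P + E + 3) * (F + N + 1) := Nat.le_mul_of_pos_right _ (by omega)
  rw [Nat.add_mul]
  omega

end Solver

end LFP

/-! ### The theorem -/

theorem proposition2 :
    ∃ (prog : LFP.Prog) (C : ℕ),
      ∀ (S : LFP.Signature) (U : Type*) [Fintype U] [Nonempty U] (e : U ≃ Fin (Fintype.card U))
        (s : ℕ) (cls : Fin s → LFP.Clause S), LFP.Stratified cls →
      ∀ (ζ : LFP.FnInterp S U) (ς : ℕ → U) (ϱ₀ : LFP.Interp S U)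
        (L : List (LFP.GroundAtom S U)), L.Nodup →
        (∀ A : LFP.GroundAtom S U, A ∈ L ↔ LFP.rank cls A.1 = 0 ∧ A.2 ∈ ϱ₀ A.1) →
      ∃ (ϱ : LFP.Interp S U) (t : ℕ) (σ : LFP.State),
        LFP.IsBestSolution cls ζ ς ϱ₀ ϱ ∧
        LFP.Exec prog (LFP.initialState e cls ζ ς L) t σ ∧
        t ≤ C * (LFP.factCount cls ϱ₀ +
          (∑ i, (cls i).size * Fintype.card U ^ (cls i).depth) + 1) ∧
        LFP.Delivers e cls ϱ σ := by
  open LFP LFP.Solver in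
  refine ⟨program, prologue.maxCost + epilogue.maxCost + 3 + (body.maxCost + 3) * 13, ?_⟩
  intro S U _ _ e s cls hs ζ ς ϱ₀ L hL hA
  set us := List.ofFn e.symm with hus_def
  have hus : ∀ a, a ∈ us := fun a => List.mem_ofFn.2 ⟨e a, by simp⟩
  have hlen : us.length = Fintype.card U := List.length_ofFn
  obtain ⟨tab, h₁, h₂, h₃, hfacts⟩ := runs_facts e (univCode e us)
    ((tagged 14 (restCode cls 0)).pair .nil) .nil (atomsCode e L) .nil .nil false L
    (initialState e cls ζ ς L).tab
  have hstage : Stage e cls ζ ς {A | A ∈ L} L tab 0 :=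
    { nodup := hL
      mem := fun _ => Iff.rfl
      records := fun A => ⟨h₂ A, fun hA => by
        rw [h₃ A hA]
        exact initialState_nil e cls ζ ς L 2 le_rfl _⟩
      flags := fun R => by
        rw [h₁ _ (by simp [flagKey]), flagKey, initialState_nil e cls ζ ς L 3 (by omega)]
        have : Solver.flags cls 0 R = false := by
          rw [Bool.eq_false_iff, Ne, flags_iff]
          simp
        rw [this]
        rfl
      fn := fun p => by
        rw [h₁ _ (by simp [fnKey]), initialState_fn e cls ζ ς L]
      env := fun x hx => by
        rw [h₁ _ (by simp [varKey]), initialState_env e cls ζ ς L x hx]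
      fresh := fun j _ _ v => by
        rw [h₁ _ (by simp), h₁ _ (by simp)]
        exact ⟨initialState_nil e cls ζ ς L 4 (by omega) _,
          initialState_nil e cls ζ ς L 5 (by omega) _⟩ }
  obtain ⟨T, L', tab', tok', mode', hT₀, hT, hfin, hlayers⟩ :=
    runs_layers e hs hus hstage .nil .nil .nil false s le_rfl
  -- A last round removes the item for the empty list of clauses; the control stack is then `nil`
  -- and the loop stops.
  have hend := (step_layer_nil (univCode e us) .nil .nil (atomsCode e L') .nil tok' mode'
    tab').runs
  rw [restCode_self] at hlayers
  obtain ⟨t, ht, hloop⟩ := (hfacts.trans (hlayers.trans hend)).exec rfl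
  obtain ⟨t₁, ht₁, hpro⟩ := prologue.exec_run rfl (initialState e cls ζ ς L)
  rw [run_prologue] at hpro
  obtain ⟨t₂, ht₂, hepi⟩ := epilogue.exec_run rfl (conc (univCode e us)
    ⟨.nil, .nil, atomsCode e L', mode', .nil, tok', tab'⟩)
  refine ⟨solution cls (T s), _, _, ?_, .seq hpro (.seq hloop hepi), ?_, ⟨L', hfin.nodup,
    fun A => ?_, ?_⟩, fun A => ?_⟩
  · refine hT.isBestSolution hs hus fun A => ?_
    rw [hT₀]
    exact hA A
  · have hsum : ∑ i ∈ Finset.range s, layerCost cls us.length i =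
        ∑ i, (cls i).size * Fintype.card U ^ (cls i).depth := by
      rw [Finset.sum_range]
      refine Finset.sum_congr rfl fun i _ => ?_
      rw [layerCost, dif_pos i.2, hlen]
    rw [hsum] at ht
    exact time_bound ht₁ ht₂ ht (length_le_factCount cls ϱ₀ L hL hA)
  · rw [hfin.mem, recorded_solution]
  · rfl
  · rw [recorded_solution]
    exact hfin.records A
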